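/- Let $d\ge 1$, let $\lambda$ be Lebesgue measure on $\mathbb R^d$, and $H=L^2(\mathbb R^d,\lambda)$. Let $\mathbb M$ be the space of finite Borel measures on $\mathbb R^d$ with the weak topology, and let $\mathbb M^{ac}=\{\mu\in\mathbb M:\mu\ll\lambda\}$, $h_\mu=\frac{d\mu}{d\lambda}$, with the total variation distance $\lambda(|h_\mu-h_\nu|)$ and its Borel $\sigma$-algebra. **Form and weak extrinsic derivative.** A continuous $u:\mathbb M\to\mathbb R$ belongs to $C_{b,2}^{E,1}(\mathbb M)$ if $D^Eu(\mu)(x)=\lim_{\varepsilon\downarrow0}\varepsilon^{-1}\big(u(\mu+\varepsilon\delta_x)-u(\mu)\big)$ exists for all $(\mu,x)\in\mathbb M\times\mathbb R^d$ and is continuous in $(\mu,x)$, $u$ and $D^Eu$ are bounded, and $\sup_{\mu\in\mathbb M^{ac}}\|D^Eu(\mu)\|_{L^2(\mu)}<\infty$. For $\alpha,k>0$ let $T_\alpha=-\Delta+|x|^2+\alpha$, a self-adjoint operator on $H$ whose eigenvectors are the normalized Hermite functions $f_{n}$, $n\in\mathbb N_0^d$, with eigenvalues $2(n_1+\dots+n_d)+d+\alpha$.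 Let $H_{k,\alpha}=\mathcal D(T_\alpha^{k/2})$ with $\langle g,f\rangle_{H_{k,\alpha}}=\langle T_\alpha^{k/2}g,T_\alpha^{k/2}f\rangle_H$, let $d'>d$, and let $G_{k,\alpha}$ be the centered Gaussian measure on $H_{k,\alpha}$ with covariance operator $T_\alpha^{-d'}$. Put $\Psi_{\mathbb M}(f)=f^2\lambda$ and $\Lambda_{\mathbb M}=G_{k,\alpha}\circ\Psi_{\mathbb M}^{-1}$, a Borel probability measure on $\mathbb M^{ac}$. $(\mathcal E_{\mathbb M},\mathcal D(\mathcal E_{\mathbb M}))$ is the closure in $L^2(\mathbb M^{ac},\Lambda_{\mathbb M})$ of $\mathcal E_{\mathbb M}(u,v)=\int\mu\big((D^Eu)(D^Ev)\big)\,\Lambda_{\mathbb M}(d\mu)$, $u,v\in C_{b,2}^{E,1}(\mathbb M)$, and on $\mathcal D(\mathcal E_{\mathbb M})$ the weak extrinsic derivative $D^E$ is the closure of $(D^E,C_{b,2}^{E,1}(\mathbb M))$: $D^E\beta=w$ means that there are $u_n\in C_{b,2}^{E,1}(\mathbb M)$ with $u_n\to\beta$ in $L^2(\Lambda_{\mathbb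 M})$ and $\int\|D^Eu_n(\mu)-w(\mu)\|_{L^2(\mu)}^2\,\Lambda_{\mathbb M}(d\mu)\to0$. **Conditions** on a function $\beta:\mathbb M^{ac}\to\mathbb R\cup\{+\infty\}$, for constants $k,\theta,\alpha_1,\alpha_2$: * $(\beta1)$ $\beta(\mu)<\infty$ for every $\mu\in\mathbb M^{ac}$ with $\lambda\big((1+|\cdot|^{2k})h_\mu+h_\mu^{1/2}+h_\mu^\theta\big)<\infty$. * $(\beta2)$ $-\beta(\mu)\le\alpha_1\,\mu(1+|\cdot|^{2k})+\alpha_2\,\lambda(h_\mu^{1/2})$ for all $\mu\in\mathbb M^{ac}$. * $(\beta3)$ If $\mu_n,\mu\in\mathbb M^{ac}$, $(1+|\cdot|^{2k})h_\mu+h_\mu^{1/2}+h_\mu^\theta\in L^1(\lambda)$ and $\|(h_{\mu_n}-h_\mu)(1+|\cdot|^{2k})\|_{L^1(\lambda)}+\|h_{\mu_n}^{1/2}-h_\mu^{1/2}\|_{L^1(\lambda)}+\|h_{\mu_n}^\theta-h_\mu^\theta\|_{L^1(\lambda)}\to0$, then $e^{-\beta(\mu)}\le\liminf_n e^{-\beta(\mu_n)}$.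 **Proposition.** Let $K,k,\alpha_1\in(0,\infty)$ and $\theta\in\big(1,\frac d{(d-2)^+}\big]\cap(1,\infty)$. Let $q\in C^1((0,\infty))\cap C([0,\infty))$ be real-valued and let $\phi\in C(\mathbb R^d)$ satisfy $|\phi|\le\min\{\alpha_1(1+|\cdot|^{2k}),K(1+|\cdot|^k)\}$. Let $\beta_{q,\phi}(\mu)=\int_{\mathbb R^d}(q\circ h_\mu+\phi h_\mu)\,d\lambda$ if $q\circ h_\mu+\phi h_\mu\in L^1(\lambda)$, and $\beta_{q,\phi}(\mu)=\infty$ otherwise. Assume that for some $c\in(0,\infty)$ $$-c\,s^{1/2}\le q(s)\le c\,(s^{1/2}+s^\theta)\quad(s\ge0),\qquad \sup_{s>0}\frac{|q'(s)|}{s^{-1/2}+s^{\theta-1}}<\infty .$$ 1. $\beta_{q,\phi}$ satisfies $(\beta1)$–$(\beta3)$ with the given $k,\theta,\alpha_1$ and some $\alpha_2\in(0,\infty)$. 2. If in addition $\sup_{s>0}\frac{|q'(s^2)|}{s^{-1/2}+s^{\theta-1}}<\infty$, then for all $\alpha>0$ and $d'>d$ with $(d+\alpha)^{d'}>2\alpha_1$,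 and provided $k>\frac d2$, the functional $\beta_{q,\phi}$ is finite $\Lambda_{\mathbb M}$-a.e., belongs to $\mathcal D(\mathcal E_{\mathbb M})$, and has the weak extrinsic derivative $D^E\beta_{q,\phi}(\mu)=q'\circ h_\mu+\phi$ in $L^2(\mu)$ for $\Lambda_{\mathbb M}$-a.e. $\mu\in\mathbb M^{ac}$. -/

import Mathlib

open MeasureTheory Filter Topology Set
open scoped ENNReal NNReal

noncomputable section

namespace ExtrinsicFlow

/-- The base space `ℝᵈ` with its Euclidean norm; `volume` is Lebesgue measure `λ`. -/
abbrev Rd (d : ℕ) : Type := EuclideanSpace ℝ (Fin d)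

/-! ### Absolutely continuous finite measures, with the total variation distance -/

/-- The set `𝕄ᵃᶜ` of finite Borel measures on `ℝᵈ` that are absolutely continuous with respect to
Lebesgue measure. It is a `def`, so that it does not inherit the weak topology of `FiniteMeasure`:
it carries the total variation distance defined below. -/
def Mac (d : ℕ) : Type := {μ : FiniteMeasure (Rd d) // (μ : Measure (Rd d)) ≪ volume}

namespace Mac

variable {d : ℕ}

/-- An element of `𝕄ᵃᶜ` as a finite measure. -/
def toFM (μ : Mac d) : FiniteMeasure (Rd d) := μ.1

/-- An element of `𝕄ᵃᶜ` as a measure. -/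
def toM (μ : Mac d) : Measure (Rd d) := (μ.toFM : Measure (Rd d))

instance (μ : Mac d) : IsFiniteMeasure μ.toM :=
  inferInstanceAs (IsFiniteMeasure (μ.toFM : Measure (Rd d)))

theorem ac (μ : Mac d) : μ.toM ≪ volume := μ.2

/-- The density `h_μ = dμ/dλ`, as a real-valued nonnegative measurable function. -/
def dens (μ : Mac d) (x : Rd d) : ℝ := (μ.toM.rnDeriv volume x).toReal

theorem integrable_dens (μ : Mac d) : Integrable μ.dens volume :=
  Measure.integrable_toReal_rnDeriv

/-- The density as an element of `L¹(λ)`. -/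
def densL1 (μ : Mac d) : Lp ℝ 1 (volume : Measure (Rd d)) := μ.integrable_dens.toL1 μ.dens

theorem densL1_injective : Function.Injective (densL1 : Mac d → _) := by
  intro μ ν h
  have h1 : μ.dens =ᵐ[volume] ν.dens := (Integrable.toL1_eq_toL1_iff _ _ _ _).1 h
  have h2 : μ.toM.rnDeriv volume =ᵐ[volume] ν.toM.rnDeriv volume := by
    filter_upwards [h1, μ.toM.rnDeriv_lt_top volume, ν.toM.rnDeriv_lt_top volume] with x hx ha hb
    exact (ENNReal.toReal_eq_toReal_iff' ha.ne hb.ne).1 hx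
  apply Subtype.ext
  apply Subtype.ext
  change μ.toM = ν.toM
  rw [← Measure.withDensity_rnDeriv_eq _ _ μ.ac, ← Measure.withDensity_rnDeriv_eq _ _ ν.ac]
  exact withDensity_congr_ae h2

/-- The total variation distance `ρ_var(μ, ν) = λ(|h_μ - h_ν|)`. -/
instance : MetricSpace (Mac d) := MetricSpace.induced densL1 densL1_injective inferInstance

theorem dist_eq (μ ν : Mac d) : dist μ ν = ∫ x, |μ.dens x - ν.dens x| := by
  change dist μ.densL1 ν.densL1 = _
  rw [dist_eq_norm, densL1, densL1, ← Integrable.toL1_sub, L1.norm_eq_integral_norm]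
  refine integral_congr_ae ?_
  filter_upwards [(μ.integrable_dens.sub ν.integrable_dens).coeFn_toL1] with x hx
  rw [hx]
  rfl

/-- `𝕄ᵃᶜ` carries the Borel σ-algebra of the total variation distance. -/
instance : MeasurableSpace (Mac d) := borel _

instance : BorelSpace (Mac d) := ⟨rfl⟩

end Mac

/-! ### Hermite functions and the Gaussian measure -/

/-- The physicists' Hermite polynomial `ℋₙ(s) = 2^{n/2} Heₙ(√2 s)`, where `Heₙ` is the
probabilists' Hermite polynomial `Polynomial.hermite n`. -/
def physHermite (n : ℕ) (s : ℝ) : ℝ :=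
  Real.sqrt 2 ^ n * Polynomial.aeval (Real.sqrt 2 * s) (Polynomial.hermite n)

/-- The one-dimensional Hermite function `ξₙ(s) = (π^{1/2} 2ⁿ n!)^{-1/2} e^{-s²/2} ℋₙ(s)`. -/
def hermiteFn (n : ℕ) (s : ℝ) : ℝ :=
  (Real.sqrt (Real.sqrt Real.pi * 2 ^ n * (n.factorial : ℝ)))⁻¹ *
    Real.exp (-s ^ 2 / 2) * physHermite n s

/-- The eigenfunctions `f_{n₁,…,n_d}(x) = ∏ᵢ ξ_{nᵢ}(xᵢ)` of the harmonic oscillator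
`T_α = -Δ + |x|² + α`; they form an orthonormal basis of `L²(ℝᵈ)`. -/
def hermiteFnRd {d : ℕ} (n : Fin d → ℕ) (x : Rd d) : ℝ := ∏ i, hermiteFn (n i) (x i)

theorem continuous_hermiteFn (n : ℕ) : Continuous (hermiteFn n) := by
  unfold hermiteFn physHermite
  have h : Continuous fun s : ℝ =>
      Polynomial.aeval (Real.sqrt 2 * s) (Polynomial.hermite n) :=
    (Polynomial.continuous_aeval _).comp (continuous_const.mul continuous_id)
  fun_prop

theorem integrable_poly_mul_gaussian (p : Polynomial ℝ) :
    Integrable fun s : ℝ => p.eval s * Real.exp (-s ^ 2) := by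
  induction p using Polynomial.induction_on' with
  | add p q hp hq =>
    refine (hp.add hq).congr (Eventually.of_forall fun s => ?_)
    simp [add_mul]
  | monomial m a =>
    have h := (integrable_rpow_mul_exp_neg_mul_sq (b := 1) one_pos (s := (m : ℝ))
      (by have : (0 : ℝ) ≤ m := m.cast_nonneg
          linarith)).const_mul a
    refine h.congr (Eventually.of_forall fun s => ?_)
    simp [mul_assoc]

theorem integrable_hermiteFn_sq (n : ℕ) : Integrable fun s => hermiteFn n s ^ 2 := by
  let p : Polynomial ℝ :=
    ((Polynomial.hermite n).map (Int.castRingHom ℝ)).comp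
      (Polynomial.C (Real.sqrt 2) * Polynomial.X)
  let c : ℝ := (Real.sqrt (Real.sqrt Real.pi * 2 ^ n * (n.factorial : ℝ)))⁻¹ * Real.sqrt 2 ^ n
  refine ((integrable_poly_mul_gaussian (p ^ 2)).const_mul (c ^ 2)).congr
    (Eventually.of_forall fun s => ?_)
  have hp : Polynomial.aeval (Real.sqrt 2 * s) (Polynomial.hermite n) = p.eval s := by
    simp [p, Polynomial.aeval_def, Polynomial.eval_map]
  have he : Real.exp (-s ^ 2) = Real.exp (-s ^ 2 / 2) ^ 2 := by
    rw [← Real.exp_nat_mul]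
    congr 1
    push_cast
    ring
  simp only [hermiteFn, physHermite, hp, he, c, Polynomial.eval_pow]
  ring

theorem memLp_hermiteFnRd {d : ℕ} (n : Fin d → ℕ) :
    MemLp (hermiteFnRd n) 2 (volume : Measure (Rd d)) := by
  have hc : Continuous (hermiteFnRd n) := by
    unfold hermiteFnRd
    refine continuous_finsetProd _ fun i _ => (continuous_hermiteFn _).comp ?_
    fun_prop
  rw [memLp_two_iff_integrable_sq hc.aestronglyMeasurable]
  have h := Integrable.fintype_prod (ι := Fin d) (μ := fun _ => (volume : Measure ℝ))
    (f := fun i s => hermiteFn (n i) s ^ 2) fun i => integrable_hermiteFn_sq (n i)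
  have h2 := (PiLp.volume_preserving_ofLp (Fin d)).integrable_comp_of_integrable h
  refine h2.congr (Eventually.of_forall fun x => ?_)
  simp [hermiteFnRd, Finset.prod_pow]

/-- The Hilbert space `H = L²(ℝᵈ, λ)`. -/
abbrev HSp (d : ℕ) : Type := Lp ℝ 2 (volume : Measure (Rd d))

instance (d : ℕ) : MeasurableSpace (HSp d) := borel _

instance (d : ℕ) : BorelSpace (HSp d) := ⟨rfl⟩

/-- The normalized Hermite function of multi-index `n` as an element of `H`. -/
def hermiteH {d : ℕ} (n : Fin d → ℕ) : HSp d := (memLp_hermiteFnRd n).toLp (hermiteFnRd n)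

/-- The eigenvalue `2 (n₁ + ⋯ + n_d) + d + α` of `T_α`. -/
def eigval {d : ℕ} (α : ℝ) (n : Fin d → ℕ) : ℝ := 2 * ∑ i, (n i : ℝ) + d + α

/-- The orthonormal basis `eigval^{-k/2} f_n` of the Hilbert space `H_{k,α} = 𝒟(T_α^{k/2})` with
inner product `⟨g, f⟩_{H_{k,α}} = ⟨T_α^{k/2} g, T_α^{k/2} f⟩_H`. It consists of eigenvectors of
`T_α`. -/
def basisHk {d : ℕ} (k α : ℝ) (n : Fin d → ℕ) : HSp d := (eigval α n) ^ (-(k / 2)) • hermiteH n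

/-- The random series `∑ₙ eigval^{-d'/2} ωₙ eₙ`, where `eₙ` is the above orthonormal basis of
`H_{k,α}`. If `d' > d`, then `T_α^{-d'}` is of trace class on `H_{k,α}`, and for independent
standard normal `ωₙ` the series converges almost surely in `H_{k,α}`, hence in `H`. -/
def gaussSeries (d : ℕ) (k α d' : ℝ) (ω : (Fin d → ℕ) → ℝ) : HSp d :=
  ∑' n, ((eigval α n) ^ (-(d' / 2)) * ω n) • basisHk k α n

/-- The Gaussian measure `G_{k,α}`, regarded as a Borel measure on `H` (it is carried by
`H_{k,α}`): the centered Gaussian measure on `H_{k,α}` with covariance operator `T_α^{-d'}`,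
that is, the law of `∑ₙ eigval^{-d'/2} ωₙ eₙ` with independent standard normal `ωₙ`. -/
def gaussianMeasure (d : ℕ) (k α d' : ℝ) : Measure (HSp d) :=
  (Measure.infinitePi fun _ : Fin d → ℕ => ProbabilityTheory.gaussianReal 0 1).map
    (gaussSeries d k α d')

instance (d : ℕ) (k α d' : ℝ) : IsProbabilityMeasure (gaussianMeasure d k α d') := by
  have : Fact ((2 : ℝ≥0∞) ≠ ∞) := ⟨by simp⟩
  have : SecondCountableTopology (HSp d) := inferInstance
  refine Measure.isProbabilityMeasure_map (AEMeasurable.tsum fun i => Measurable.aemeasurable ?_)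
  exact ((measurable_pi_apply i).const_mul _).smul_const _

/-- The measure `f² λ`. -/
def sqMeasure {d : ℕ} (f : HSp d) : Measure (Rd d) :=
  volume.withDensity fun x => ENNReal.ofReal (f x ^ 2)

instance {d : ℕ} (f : HSp d) : IsFiniteMeasure (sqMeasure f) :=
  isFiniteMeasure_withDensity_ofReal (Lp.memLp f).integrable_sq.2

/-- The map `Ψ : H → 𝕄ᵃᶜ`, `f ↦ f² λ`. -/
def Psi {d : ℕ} (f : HSp d) : Mac d :=
  ⟨⟨sqMeasure f, inferInstance⟩, withDensity_absolutelyContinuous _ _⟩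

/-- The reference measure `Λ = G_{k,α} ∘ Ψ⁻¹` on `𝕄ᵃᶜ`. -/
def refMeasure (d : ℕ) (k α d' : ℝ) : Measure (Mac d) := (gaussianMeasure d k α d').map Psi

/-! ### Extrinsic derivatives and the domain of the form -/

/-- The Dirac measure at `x` as a finite measure. -/
def diracFM {d : ℕ} (x : Rd d) : FiniteMeasure (Rd d) := ⟨Measure.dirac x, inferInstance⟩

/-- `u` belongs to `C_{b,2}^{E,1}(𝕄)` and has extrinsic derivative `Du = Dᴱ u`. Here `𝕄`, the
space of all finite Borel measures, carries the weak topology. -/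
structure IsCbE12 {d : ℕ} (u : FiniteMeasure (Rd d) → ℝ)
    (Du : FiniteMeasure (Rd d) → Rd d → ℝ) : Prop where
  continuous : Continuous u
  hasExtrinsicDeriv : ∀ μ x, Tendsto
    (fun ε : ℝ => (u (μ + ε.toNNReal • diracFM x) - u μ) / ε) (𝓝[>] 0) (𝓝 (Du μ x))
  continuous_deriv : Continuous fun p : FiniteMeasure (Rd d) × Rd d => Du p.1 p.2
  bounded : ∃ C : ℝ, ∀ μ x, |u μ| + |Du μ x| ≤ C
  bounded_L2 : ∃ C : ℝ≥0, ∀ μ : Mac d, eLpNorm (Du μ.toFM) 2 μ.toM ≤ C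

/-- The quadratic form `∫ ‖D(μ)‖²_{L²(μ)} Λ(dμ)`. For `D = Dᴱ u` it is `ℰ(u, u)`. -/
def energy {d : ℕ} (Λ : Measure (Mac d)) (D : Mac d → Rd d → ℝ) : ℝ≥0∞ :=
  ∫⁻ μ, ∫⁻ x, ‖D μ x‖ₑ ^ 2 ∂μ.toM ∂Λ

/-- `β ∈ 𝒟(ℰ)`, where `(ℰ, 𝒟(ℰ))` is the closure in `L²(𝕄ᵃᶜ, Λ)` of the form
`ℰ(u, v) = ∫ μ(Dᴱu Dᴱv) Λ(dμ)`, `u, v ∈ C_{b,2}^{E,1}(𝕄)`: the function `β` is the `L²(Λ)`-limit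
of an `ℰ`-Cauchy sequence in `C_{b,2}^{E,1}(𝕄)`. -/
def MemFormDomain {d : ℕ} (Λ : Measure (Mac d)) (β : Mac d → ℝ) : Prop :=
  MemLp β 2 Λ ∧
  ∃ (u : ℕ → FiniteMeasure (Rd d) → ℝ) (Du : ℕ → FiniteMeasure (Rd d) → Rd d → ℝ),
    (∀ n, IsCbE12 (u n) (Du n)) ∧
    Tendsto (fun n => eLpNorm (fun μ : Mac d => u n μ.toFM - β μ) 2 Λ) atTop (𝓝 0) ∧
    Tendsto (fun p : ℕ × ℕ =>
      energy Λ fun μ x => Du p.1 μ.toFM x - Du p.2 μ.toFM x) (atTop ×ˢ atTop) (𝓝 0)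

/-- `w = Dᴱ β` for the closure `(Dᴱ, 𝒟(ℰ))` of the operator `(Dᴱ, C_{b,2}^{E,1}(𝕄))`, that is,
`(β, w)` is a limit of pairs `(u, Dᴱ u)`, `u ∈ C_{b,2}^{E,1}(𝕄)`, with respect to the `L²(Λ)`-norm
and the norm `(∫ ‖·‖²_{L²(μ)} Λ(dμ))^{1/2}`. -/
def HasWeakExtrinsicDeriv {d : ℕ} (Λ : Measure (Mac d)) (β : Mac d → ℝ)
    (w : Mac d → Rd d → ℝ) : Prop :=
  MemLp β 2 Λ ∧ (Measurable fun p : Mac d × Rd d => w p.1 p.2) ∧ energy Λ w < ∞ ∧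
  ∃ (u : ℕ → FiniteMeasure (Rd d) → ℝ) (Du : ℕ → FiniteMeasure (Rd d) → Rd d → ℝ),
    (∀ n, IsCbE12 (u n) (Du n)) ∧
    Tendsto (fun n => eLpNorm (fun μ : Mac d => u n μ.toFM - β μ) 2 Λ) atTop (𝓝 0) ∧
    Tendsto (fun n => energy Λ fun μ x => Du n μ.toFM x - w μ x) atTop (𝓝 0)

/-! ### The functional and the conditions on it -/

open scoped Classical in
/-- The functional `β_{q,φ}(μ) = ∫ (q ∘ h_μ + φ h_μ) dλ` if the integrand is in `L¹(λ)`, and `∞`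
otherwise. -/
def betaFun {d : ℕ} (q : ℝ → ℝ) (φ : Rd d → ℝ) (μ : Mac d) : EReal :=
  if Integrable (fun x => q (μ.dens x) + φ x * μ.dens x) volume then
    ((∫ x, (q (μ.dens x) + φ x * μ.dens x) : ℝ) : EReal)
  else ⊤

/-- `(1 + |·|^{2k}) h_μ + h_μ^{1/2} + h_μ^θ ∈ L¹(λ)`. -/
def NiceDensity {d : ℕ} (k θ : ℝ) (μ : Mac d) : Prop :=
  Integrable (fun x => (1 + ‖x‖ ^ (2 * k)) * μ.dens x + μ.dens x ^ (1 / 2 : ℝ) + μ.dens x ^ θ)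
    volume

/-- Condition (β1), with constants `k` and `θ`. -/
def Beta1 {d : ℕ} (k θ : ℝ) (β : Mac d → EReal) : Prop :=
  ∀ μ : Mac d, NiceDensity k θ μ → β μ < ⊤

/-- Condition (β2), with constants `k`, `α₁`, `α₂`. The right-hand side may be infinite. -/
def Beta2 {d : ℕ} (k α₁ α₂ : ℝ) (β : Mac d → EReal) : Prop :=
  ∀ μ : Mac d, -β μ ≤
    ((ENNReal.ofReal α₁ * ∫⁻ x, ENNReal.ofReal (1 + ‖x‖ ^ (2 * k)) ∂μ.toM
      + ENNReal.ofReal α₂ * ∫⁻ x, ENNReal.ofReal (μ.dens x ^ (1 / 2 : ℝ)) : ℝ≥0∞) : EReal)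

/-- Condition (β3), with constants `k` and `θ`. Here `EReal.exp` is the exponential function
`[-∞, ∞] → [0, ∞]`, with `e^{-∞} = 0`. -/
def Beta3 {d : ℕ} (k θ : ℝ) (β : Mac d → EReal) : Prop :=
  ∀ (ν : ℕ → Mac d) (μ : Mac d), NiceDensity k θ μ →
    Tendsto (fun n =>
      eLpNorm (fun x => ((ν n).dens x - μ.dens x) * (1 + ‖x‖ ^ (2 * k))) 1 volume
      + eLpNorm (fun x => (ν n).dens x ^ (1 / 2 : ℝ) - μ.dens x ^ (1 / 2 : ℝ)) 1 volume
      + eLpNorm (fun x => (ν n).dens x ^ θ - μ.dens x ^ θ) 1 volume) atTop (𝓝 0) →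
    EReal.exp (-β μ) ≤ liminf (fun n => EReal.exp (-β (ν n))) atTop

end ExtrinsicFlow

end

open ExtrinsicFlow

/-! Part 1 rests on one inequality. Integrating the bound on `q'` shows that `|q s - q t|` is at
most a constant times `|s^(1/2) - t^(1/2)| + |s^θ - t^θ|` (`exists_abs_sub_le_rpow`). The three
norms in (β3) therefore control the difference of the functional at two measures, and `β_{q,φ}` is
even continuous along such sequences. (β1) and (β2) follow by integrating the growth bounds on `q`
and `φ`.

Part 2 has a probabilistic and an approximation half. The probabilistic half shows that `niceMass`,
the integral of `h^(1/2) + h^θ + (1 + |x|^(2k)) h`, is square integrable under `Λ`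
(`lintegral_niceMass_sq_lt_top`). At a fixed point `x` a partial sum of the Gaussian series is a
combination of independent standard normals with variance `gaussVar`, so its `p`-th moment is of
order `gaussVar^(p/2)`. Minkowski's integral inequality reduces the claim to integrals of powers of
the variance. These are bounded uniformly in the partial sum by sup-norm and moment bounds for
Hermite functions and by the convergence of the sum of `eigval^(-d')`. The assumption `k > d/2`
enters twice: it makes the variance bounded in `x`, and it makes `(1 + |x|)^(-2k)` integrable, which
controls the square root of the variance. Fatou's lemma passes to the full series.

The approximation half uses `ψ(μ(1)) (∫ χ Q(h_μ * ρ) dλ + μ(g))`, where `ρ` is a mollifier, `χ` and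
`g` have compact support, `Q` is bounded with bounded derivative, and `ψ` cuts off large mass.
Mollification makes the density weakly continuous in `μ`, so this is a function in `C_{b,2}^{E,1}`,
with a derivative obtained by the chain rule (`TruncatedFunctional.isCbE12`). Two limits are then
taken, both by dominated convergence, in the graph norm `formDist`. Letting `ρ` tend to the Dirac
measure for fixed cutoffs uses bounds uniform in `ρ`
(`TruncatedFunctional.tendsto_lintegral_formDist`). Removing the cutoffs uses a bound by a quadratic
polynomial in `niceMass` (`IsApproximation.formDist_le`). The gradient needs `q'(s)^2 s` to be at
most of order `s^(1/2) + s^θ`, which is what the condition on `q'(s^2)` gives. A diagonal sequence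
places the pair of the functional and its gradient in the closure. -/

namespace ExtrinsicFlow

/-! ### Growth of `q` and the conditions (β1)–(β3). -/

theorem exists_abs_sub_le_rpow {q : ℝ → ℝ} {θ : ℝ} (hθ : 1 < θ) (hq0 : ContinuousOn q (Ici 0))
    (hq1 : ContDiffOn ℝ 1 q (Ioi 0))
    (hq' : ∃ C : ℝ, ∀ s : ℝ, 0 < s → |deriv q s| ≤ C * (s ^ (-(1 / 2) : ℝ) + s ^ (θ - 1))) :
    ∃ C : ℝ, 0 ≤ C ∧ ∀ s t : ℝ, 0 ≤ s → 0 ≤ t →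
      |q s - q t| ≤ C * (|s ^ (1 / 2 : ℝ) - t ^ (1 / 2 : ℝ)| + |s ^ θ - t ^ θ|) := by
  obtain ⟨C, hC⟩ := hq'
  set A := max C 0 with hA
  have hA0 : 0 ≤ A := le_max_right _ _
  have hθ0 : 0 < θ := by linarith
  -- `G` is an antiderivative of the bound on `|q'|`, so `G - q` and `G + q` both have nonnegative
  -- derivative on `(0, ∞)`. Continuity at `0` extends their monotonicity to `[0, ∞)`.
  let G : ℝ → ℝ := fun t => 2 * A * t ^ (1 / 2 : ℝ) + A / θ * t ^ θ
  have hGd : ∀ t, 0 < t → HasDerivAt G (A * (t ^ (-(1 / 2) : ℝ) + t ^ (θ - 1))) t := by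
    intro t ht
    have h1 := (Real.hasDerivAt_rpow_const (x := t) (p := 1 / 2) (Or.inl ht.ne')).const_mul (2 * A)
    have h2 := (Real.hasDerivAt_rpow_const (x := t) (p := θ) (Or.inl ht.ne')).const_mul (A / θ)
    refine (h1.add h2).congr_deriv ?_
    have : (1 / 2 - 1 : ℝ) = -(1 / 2) := by norm_num
    rw [this]
    field_simp
  have hGc : ContinuousOn G (Ici 0) := by
    refine Continuous.continuousOn ?_
    exact (continuous_const.mul (Real.continuous_rpow_const (by norm_num))).add
      (continuous_const.mul (Real.continuous_rpow_const hθ0.le))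
  have hqd : ∀ t, 0 < t → HasDerivAt q (deriv q t) t := fun t ht =>
    ((hq1.differentiableOn (by norm_num)).differentiableAt (Ioi_mem_nhds ht)).hasDerivAt
  have hb : ∀ t, 0 < t → |deriv q t| ≤ A * (t ^ (-(1 / 2) : ℝ) + t ^ (θ - 1)) := fun t ht =>
    (hC t ht).trans (mul_le_mul_of_nonneg_right (le_max_left _ _) (by positivity))
  have hm1 : MonotoneOn (fun t => G t - q t) (Ici 0) := by
    refine monotoneOn_of_deriv_nonneg (convex_Ici 0) (hGc.sub hq0) ?_ ?_
    · rw [interior_Ici]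
      exact fun t ht => ((hGd t ht).sub (hqd t ht)).differentiableAt.differentiableWithinAt
    · rw [interior_Ici]
      intro t ht
      have h := ((hGd t ht).sub (hqd t ht)).deriv
      change 0 ≤ deriv (G - q) t
      rw [h]
      linarith [(abs_le.1 (hb t ht)).2]
  have hm2 : MonotoneOn (fun t => G t + q t) (Ici 0) := by
    refine monotoneOn_of_deriv_nonneg (convex_Ici 0) (hGc.add hq0) ?_ ?_
    · rw [interior_Ici]
      exact fun t ht => ((hGd t ht).add (hqd t ht)).differentiableAt.differentiableWithinAt
    · rw [interior_Ici]
      intro t ht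
      have h := ((hGd t ht).add (hqd t ht)).deriv
      change 0 ≤ deriv (G + q) t
      rw [h]
      linarith [(abs_le.1 (hb t ht)).1]
  have hle : ∀ s t : ℝ, 0 ≤ s → s ≤ t →
      |q s - q t| ≤ 2 * A * (|s ^ (1 / 2 : ℝ) - t ^ (1 / 2 : ℝ)| + |s ^ θ - t ^ θ|) := by
    intro s t hs hst
    have h1 := hm1 hs (hs.trans hst : (0 : ℝ) ≤ t) hst
    have h2 := hm2 hs (hs.trans hst : (0 : ℝ) ≤ t) hst
    have h3 : |q s - q t| ≤ G t - G s := by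
      rw [abs_le]
      constructor <;> linarith
    refine h3.trans ?_
    have e1 : t ^ (1 / 2 : ℝ) - s ^ (1 / 2 : ℝ) ≤ |s ^ (1 / 2 : ℝ) - t ^ (1 / 2 : ℝ)| := by
      rw [abs_sub_comm]; exact le_abs_self _
    have e2 : t ^ θ - s ^ θ ≤ |s ^ θ - t ^ θ| := by
      rw [abs_sub_comm]; exact le_abs_self _
    have e3 : A / θ ≤ 2 * A := by
      rw [div_le_iff₀ hθ0]
      nlinarith
    have : G t - G s = 2 * A * (t ^ (1 / 2 : ℝ) - s ^ (1 / 2 : ℝ)) + A / θ * (t ^ θ - s ^ θ) := by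
      simp only [G]; ring
    rw [this, mul_add]
    refine add_le_add (mul_le_mul_of_nonneg_left e1 (by positivity)) ?_
    exact (mul_le_mul_of_nonneg_left e2 (by positivity)).trans
      (mul_le_mul_of_nonneg_right e3 (abs_nonneg _))
  refine ⟨2 * A, by positivity, fun s t hs ht => ?_⟩
  rcases le_total s t with h | h
  · exact hle s t hs h
  · rw [abs_sub_comm, abs_sub_comm (s ^ (1 / 2 : ℝ)), abs_sub_comm (s ^ θ)]
    exact hle t s ht h

variable {d : ℕ}

theorem Mac.dens_nonneg (μ : Mac d) (x : Rd d) : 0 ≤ μ.dens x := ENNReal.toReal_nonneg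

theorem Mac.measurable_dens (μ : Mac d) : Measurable μ.dens :=
  (Measure.measurable_rnDeriv _ _).ennreal_toReal

theorem Mac.toM_eq_withDensity (μ : Mac d) :
    μ.toM = volume.withDensity fun x => ENNReal.ofReal (μ.dens x) := by
  rw [← Measure.withDensity_rnDeriv_eq _ _ μ.ac]
  refine withDensity_congr_ae ?_
  have h : μ.toM.rnDeriv volume =ᵐ[volume] fun x => ENNReal.ofReal (μ.dens x) := by
    filter_upwards [μ.toM.rnDeriv_lt_top volume] with x hx
    exact (ENNReal.ofReal_toReal hx.ne).symm
  exact h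

/-- Nothing is known about `q` on negative arguments; composing with `max s 0` gives a globally
continuous function that agrees with `q` on the values of `f`. -/
theorem measurable_comp_of_continuousOn_Ici {α : Type*} [MeasurableSpace α] {q : ℝ → ℝ}
    (hq : ContinuousOn q (Ici 0)) {f : α → ℝ} (hf : Measurable f) (hf0 : ∀ x, 0 ≤ f x) :
    Measurable fun x => q (f x) := by
  have hc : Continuous fun s => q (max s 0) :=
    hq.comp_continuous (continuous_id.max continuous_const) fun s => mem_Ici.2 (le_max_right _ _)
  have := hc.measurable.comp hf
  simpa [Function.comp_def, max_eq_left (hf0 _)] using this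

/-- The three summands of `NiceDensity` are integrable separately. -/
theorem NiceDensity.integrable {k θ : ℝ} {μ : Mac d} (h : NiceDensity k θ μ) :
    Integrable (fun x => (1 + ‖x‖ ^ (2 * k)) * μ.dens x) volume ∧
      Integrable (fun x => μ.dens x ^ (1 / 2 : ℝ)) volume ∧
      Integrable (fun x => μ.dens x ^ θ) volume := by
  have hm := μ.measurable_dens
  have h1 : ∀ x, 0 ≤ (1 + ‖x‖ ^ (2 * k)) * μ.dens x := fun x =>
    mul_nonneg (by positivity) (μ.dens_nonneg x)
  have h2 : ∀ x, 0 ≤ μ.dens x ^ (1 / 2 : ℝ) := fun x => Real.rpow_nonneg (μ.dens_nonneg x) _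
  have h3 : ∀ x, 0 ≤ μ.dens x ^ θ := fun x => Real.rpow_nonneg (μ.dens_nonneg x) _
  refine ⟨Integrable.mono' h (Measurable.aestronglyMeasurable (by fun_prop)) (Eventually.of_forall fun x => ?_),
    Integrable.mono' h (Measurable.aestronglyMeasurable (by fun_prop)) (Eventually.of_forall fun x => ?_),
    Integrable.mono' h (Measurable.aestronglyMeasurable (by fun_prop)) (Eventually.of_forall fun x => ?_)⟩ <;>
  · rw [Real.norm_eq_abs, abs_of_nonneg (by first | exact h1 x | exact h2 x | exact h3 x)]
    linarith [h1 x, h2 x, h3 x]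

theorem abs_growth {q : ℝ → ℝ} {c θ : ℝ} (hc : 0 < c)
    (hq : ∀ s : ℝ, 0 ≤ s → -c * s ^ (1 / 2 : ℝ) ≤ q s ∧ q s ≤ c * (s ^ (1 / 2 : ℝ) + s ^ θ))
    {s : ℝ} (hs : 0 ≤ s) : |q s| ≤ c * (s ^ (1 / 2 : ℝ) + s ^ θ) := by
  have h := hq s hs
  have h1 : 0 ≤ s ^ θ := Real.rpow_nonneg hs _
  rw [abs_le]
  exact ⟨by nlinarith, h.2⟩

theorem integrable_betaIntegrand {q : ℝ → ℝ} {c θ k A : ℝ} {φ : Rd d → ℝ} (hc : 0 < c)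
    (hq0 : ContinuousOn q (Ici 0))
    (hq : ∀ s : ℝ, 0 ≤ s → -c * s ^ (1 / 2 : ℝ) ≤ q s ∧ q s ≤ c * (s ^ (1 / 2 : ℝ) + s ^ θ))
    (hφ : Continuous φ) (hφb : ∀ x, |φ x| ≤ A * (1 + ‖x‖ ^ (2 * k)))
    {μ : Mac d} (h : NiceDensity k θ μ) :
    Integrable (fun x => q (μ.dens x) + φ x * μ.dens x) volume := by
  obtain ⟨h1, h2, h3⟩ := h.integrable
  have hm := μ.measurable_dens
  have hmq := measurable_comp_of_continuousOn_Ici hq0 hm μ.dens_nonneg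
  refine Integrable.add (Integrable.mono' ((h2.add h3).const_mul c) hmq.aestronglyMeasurable
      (Eventually.of_forall fun x => abs_growth hc hq (μ.dens_nonneg x)))
    (Integrable.mono' (h1.const_mul A) (hφ.measurable.mul hm).aestronglyMeasurable
      (Eventually.of_forall fun x => ?_))
  rw [Real.norm_eq_abs, abs_mul, abs_of_nonneg (μ.dens_nonneg x), ← mul_assoc]
  exact mul_le_mul_of_nonneg_right (hφb x) (μ.dens_nonneg x)

theorem beta1_betaFun {q : ℝ → ℝ} {c θ k A : ℝ} {φ : Rd d → ℝ} (hc : 0 < c)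
    (hq0 : ContinuousOn q (Ici 0))
    (hq : ∀ s : ℝ, 0 ≤ s → -c * s ^ (1 / 2 : ℝ) ≤ q s ∧ q s ≤ c * (s ^ (1 / 2 : ℝ) + s ^ θ))
    (hφ : Continuous φ) (hφb : ∀ x, |φ x| ≤ A * (1 + ‖x‖ ^ (2 * k))) :
    Beta1 k θ (betaFun q φ) := by
  intro μ h
  have h1 := integrable_betaIntegrand hc hq0 hq hφ hφb h
  rw [betaFun, if_pos h1]
  exact EReal.coe_lt_top _

theorem beta2_betaFun {q : ℝ → ℝ} {c θ k A : ℝ} {φ : Rd d → ℝ} (hc : 0 < c) (hA : 0 < A)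
    (hq : ∀ s : ℝ, 0 ≤ s → -c * s ^ (1 / 2 : ℝ) ≤ q s ∧ q s ≤ c * (s ^ (1 / 2 : ℝ) + s ^ θ))
    (hφb : ∀ x, |φ x| ≤ A * (1 + ‖x‖ ^ (2 * k))) :
    Beta2 k A c (betaFun q φ) := by
  intro μ
  have hm := μ.measurable_dens
  have hM : ∫⁻ x, ENNReal.ofReal (1 + ‖x‖ ^ (2 * k)) ∂μ.toM =
      ∫⁻ x, ENNReal.ofReal ((1 + ‖x‖ ^ (2 * k)) * μ.dens x) := by
    rw [μ.toM_eq_withDensity, lintegral_withDensity_eq_lintegral_mul _ (by fun_prop) (by fun_prop)]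
    refine lintegral_congr fun x => ?_
    simp only [Pi.mul_apply]
    rw [mul_comm, ENNReal.ofReal_mul (by positivity)]
  rw [hM, betaFun]
  split_ifs with hI
  · have hIn : Integrable (fun x => -(q (μ.dens x) + φ x * μ.dens x)) volume := hI.neg
    have hb : ∀ x, -(q (μ.dens x) + φ x * μ.dens x) ≤
        A * ((1 + ‖x‖ ^ (2 * k)) * μ.dens x) + c * μ.dens x ^ (1 / 2 : ℝ) := by
      intro x
      have h1 := (hq _ (μ.dens_nonneg x)).1
      have h2 := mul_le_mul_of_nonneg_right ((neg_le_abs (φ x)).trans (hφb x)) (μ.dens_nonneg x)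
      linarith
    rw [← EReal.coe_neg, ← integral_neg, ← lintegral_const_mul _ (by fun_prop),
      ← lintegral_const_mul _ (by fun_prop), ← lintegral_add_left (by fun_prop)]
    have h3 : ENNReal.ofReal (∫ x, -(q (μ.dens x) + φ x * μ.dens x)) ≤
        ∫⁻ x, (ENNReal.ofReal A * ENNReal.ofReal ((1 + ‖x‖ ^ (2 * k)) * μ.dens x) +
          ENNReal.ofReal c * ENNReal.ofReal (μ.dens x ^ (1 / 2 : ℝ))) := by
      -- Passing to the positive part makes the integrand nonnegative, so the pointwise bound can be
      -- integrated in `[0, ∞]` even when its integral is infinite.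
      have h4 : ∫ x, -(q (μ.dens x) + φ x * μ.dens x) ≤
          ∫ x, max (-(q (μ.dens x) + φ x * μ.dens x)) 0 :=
        integral_mono hIn hIn.pos_part fun x => le_max_left _ _
      refine (ENNReal.ofReal_le_ofReal h4).trans ?_
      rw [ofReal_integral_eq_lintegral_ofReal hIn.pos_part
        (Eventually.of_forall fun x => le_max_right _ _)]
      refine lintegral_mono fun x => ?_
      have hn1 : 0 ≤ (1 + ‖x‖ ^ (2 * k)) * μ.dens x := mul_nonneg (by positivity) (μ.dens_nonneg x)
      have hn2 : 0 ≤ μ.dens x ^ (1 / 2 : ℝ) := Real.rpow_nonneg (μ.dens_nonneg x) _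
      rw [← ENNReal.ofReal_mul hA.le, ← ENNReal.ofReal_mul hc.le,
        ← ENNReal.ofReal_add (by positivity) (by positivity)]
      exact ENNReal.ofReal_le_ofReal (max_le (hb x) (by positivity))
    refine le_trans ?_ (EReal.coe_ennreal_le_coe_ennreal_iff.2 h3)
    rw [EReal.coe_ennreal_ofReal]
    exact EReal.coe_le_coe_iff.2 (le_max_left _ _)
  -- Here the functional is `⊤` and its negative is `⊥`.
  · simp

theorem NiceDensity.congr_of_eLpNorm_lt_top {k θ : ℝ} {μ ν : Mac d} (h : NiceDensity k θ μ)
    (h1 : eLpNorm (fun x => (ν.dens x - μ.dens x) * (1 + ‖x‖ ^ (2 * k))) 1 volume < ∞)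
    (h2 : eLpNorm (fun x => ν.dens x ^ (1 / 2 : ℝ) - μ.dens x ^ (1 / 2 : ℝ)) 1 volume < ∞)
    (h3 : eLpNorm (fun x => ν.dens x ^ θ - μ.dens x ^ θ) 1 volume < ∞) :
    NiceDensity k θ ν := by
  obtain ⟨g1, g2, g3⟩ := h.integrable
  have hm := μ.measurable_dens
  have hn := ν.measurable_dens
  have i1 := memLp_one_iff_integrable.1 (⟨Measurable.aestronglyMeasurable (by fun_prop), h1⟩ :
    MemLp (fun x => (ν.dens x - μ.dens x) * (1 + ‖x‖ ^ (2 * k))) 1 volume)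
  have i2 := memLp_one_iff_integrable.1 (⟨Measurable.aestronglyMeasurable (by fun_prop), h2⟩ :
    MemLp (fun x => ν.dens x ^ (1 / 2 : ℝ) - μ.dens x ^ (1 / 2 : ℝ)) 1 volume)
  have i3 := memLp_one_iff_integrable.1 (⟨Measurable.aestronglyMeasurable (by fun_prop), h3⟩ :
    MemLp (fun x => ν.dens x ^ θ - μ.dens x ^ θ) 1 volume)
  refine ((((i1.add g1).add (i2.add g2)).add (i3.add g3))).congr (Eventually.of_forall fun x => ?_)
  simp only [Pi.add_apply]
  ring

/-- More than lower semicontinuity holds: the integrals differ by at most `A + C` times the sum of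
the three norms, so `β(ν n)` converges to `β(μ)`. -/
theorem beta3_betaFun {q : ℝ → ℝ} {c C θ k A : ℝ} {φ : Rd d → ℝ} (hc : 0 < c) (hA : 0 < A)
    (hC : 0 ≤ C) (hq0 : ContinuousOn q (Ici 0))
    (hq : ∀ s : ℝ, 0 ≤ s → -c * s ^ (1 / 2 : ℝ) ≤ q s ∧ q s ≤ c * (s ^ (1 / 2 : ℝ) + s ^ θ))
    (hL : ∀ s t : ℝ, 0 ≤ s → 0 ≤ t →
      |q s - q t| ≤ C * (|s ^ (1 / 2 : ℝ) - t ^ (1 / 2 : ℝ)| + |s ^ θ - t ^ θ|))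
    (hφ : Continuous φ) (hφb : ∀ x, |φ x| ≤ A * (1 + ‖x‖ ^ (2 * k))) :
    Beta3 k θ (betaFun q φ) := by
  intro ν μ hμ hlim
  set e1 : ℕ → ℝ≥0∞ := fun n =>
    eLpNorm (fun x => ((ν n).dens x - μ.dens x) * (1 + ‖x‖ ^ (2 * k))) 1 volume with he1
  set e2 : ℕ → ℝ≥0∞ := fun n =>
    eLpNorm (fun x => (ν n).dens x ^ (1 / 2 : ℝ) - μ.dens x ^ (1 / 2 : ℝ)) 1 volume with he2
  set e3 : ℕ → ℝ≥0∞ := fun n =>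
    eLpNorm (fun x => (ν n).dens x ^ θ - μ.dens x ^ θ) 1 volume with he3
  replace hlim : Tendsto (fun n => e1 n + e2 n + e3 n) atTop (𝓝 0) := hlim
  have hev : ∀ᶠ n in atTop, NiceDensity k θ (ν n) := by
    -- Norms in `[0, ∞]` that tend to `0` are eventually finite, which makes the density of `ν n`
    -- nice and the functional finite at `ν n`.
    filter_upwards [hlim.eventually_lt_const (u := ∞) (by simp)] with n hn
    have hn' := ENNReal.add_lt_top.1 hn
    have hn'' := ENNReal.add_lt_top.1 hn'.1
    exact hμ.congr_of_eLpNorm_lt_top hn''.1 hn''.2 hn'.2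
  have i1 := integrable_betaIntegrand hc hq0 hq hφ hφb hμ
  have hint : ∀ n, NiceDensity k θ (ν n) →
      ‖(∫ x, (q ((ν n).dens x) + φ x * (ν n).dens x)) - ∫ x, (q (μ.dens x) + φ x * μ.dens x)‖ₑ
        ≤ ENNReal.ofReal (A + C) * (e1 n + e2 n + e3 n) := by
    intro n hn
    have j1 := integrable_betaIntegrand hc hq0 hq hφ hφb hn
    have hm := μ.measurable_dens
    have hmn := (ν n).measurable_dens
    rw [← integral_sub j1 i1]
    refine (enorm_integral_le_lintegral_enorm _).trans ?_
    simp only [he1, he2, he3, eLpNorm_one_eq_lintegral_enorm]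
    rw [← lintegral_add_left (by fun_prop), ← lintegral_add_left (by fun_prop),
      ← lintegral_const_mul _ (by fun_prop)]
    refine lintegral_mono fun x => ?_
    simp only [← ofReal_norm, Real.norm_eq_abs]
    rw [← ENNReal.ofReal_add (by positivity) (by positivity),
      ← ENNReal.ofReal_add (by positivity) (by positivity), ← ENNReal.ofReal_mul (by positivity)]
    refine ENNReal.ofReal_le_ofReal ?_
    have h1 := hL _ _ ((ν n).dens_nonneg x) (μ.dens_nonneg x)
    have h2 : |φ x * ((ν n).dens x - μ.dens x)| ≤
        A * |((ν n).dens x - μ.dens x) * (1 + ‖x‖ ^ (2 * k))| := by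
      have hp : (0 : ℝ) ≤ 1 + ‖x‖ ^ (2 * k) := by positivity
      rw [abs_mul, abs_mul, abs_of_nonneg hp]
      have := mul_le_mul_of_nonneg_right (hφb x) (abs_nonneg ((ν n).dens x - μ.dens x))
      linarith
    have h3 : q ((ν n).dens x) + φ x * (ν n).dens x - (q (μ.dens x) + φ x * μ.dens x) =
        (q ((ν n).dens x) - q (μ.dens x)) + φ x * ((ν n).dens x - μ.dens x) := by ring
    rw [h3]
    refine (abs_add_le _ _).trans ?_
    have n1 := abs_nonneg (((ν n).dens x - μ.dens x) * (1 + ‖x‖ ^ (2 * k)))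
    have n2 := abs_nonneg ((ν n).dens x ^ (1 / 2 : ℝ) - μ.dens x ^ (1 / 2 : ℝ))
    have n3 := abs_nonneg ((ν n).dens x ^ θ - μ.dens x ^ θ)
    nlinarith [mul_nonneg hC n1, mul_nonneg hA.le n2, mul_nonneg hA.le n3]
  have hreal : Tendsto (fun n => ∫ x, (q ((ν n).dens x) + φ x * (ν n).dens x)) atTop
      (𝓝 (∫ x, (q (μ.dens x) + φ x * μ.dens x))) := by
    rw [tendsto_iff_edist_tendsto_0]
    have h0 : Tendsto (fun n => ENNReal.ofReal (A + C) * (e1 n + e2 n + e3 n)) atTop (𝓝 0) := by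
      simpa using ENNReal.Tendsto.const_mul hlim (Or.inr ENNReal.ofReal_ne_top)
    refine tendsto_of_tendsto_of_tendsto_of_le_of_le' tendsto_const_nhds h0
      (Eventually.of_forall fun _ => zero_le) ?_
    filter_upwards [hev] with n hn
    rw [edist_eq_enorm_sub]
    exact hint n hn
  have hbeta : Tendsto (fun n => EReal.exp (-betaFun q φ (ν n))) atTop
      (𝓝 (EReal.exp (-betaFun q φ μ))) := by
    refine (ENNReal.continuous_exp.tendsto _).comp ((continuous_neg.tendsto _).comp ?_)
    have e : betaFun q φ μ = ((∫ x, (q (μ.dens x) + φ x * μ.dens x) : ℝ) : EReal) := by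
      rw [betaFun, if_pos i1]
    rw [e]
    refine ((continuous_coe_real_ereal.tendsto _).comp hreal).congr' ?_
    filter_upwards [hev] with n hn
    have j1 := integrable_betaIntegrand hc hq0 hq hφ hφb hn
    rw [betaFun, if_pos j1]
    rfl
  exact hbeta.liminf_eq.ge

/-! ### One-dimensional Hermite functions: ladder relations, normalization, moments and sup bound.
-/

/-- The Appell property. It turns the defining recursion, which involves a derivative, into a
three-term recurrence. -/
theorem derivative_hermite_succ (n : ℕ) :
    Polynomial.derivative (Polynomial.hermite (n + 1)) =
      (n + 1 : Polynomial ℤ) * Polynomial.hermite n := by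
  induction n with
  | zero => simp
  | succ n ih =>
    rw [Polynomial.hermite_succ (n + 1), Polynomial.derivative_sub, Polynomial.derivative_mul, ih,
      Polynomial.derivative_mul, Polynomial.derivative_X, Polynomial.hermite_succ n]
    simp
    ring

theorem physHermite_zero (s : ℝ) : physHermite 0 s = 1 := by simp [physHermite]

theorem physHermite_one (s : ℝ) : physHermite 1 s = 2 * s := by
  simp [physHermite, ← mul_assoc]

theorem physHermite_succ_succ (n : ℕ) (s : ℝ) :
    physHermite (n + 2) s = 2 * s * physHermite (n + 1) s - 2 * (n + 1) * physHermite n s := by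
  have h2 : Real.sqrt 2 * Real.sqrt 2 = 2 := Real.mul_self_sqrt (by norm_num)
  unfold physHermite
  rw [Polynomial.hermite_succ (n + 1), derivative_hermite_succ]
  simp only [map_sub, map_mul, Polynomial.aeval_X, map_add, map_natCast, map_one]
  rw [pow_succ, pow_succ]
  linear_combination (Real.sqrt 2 ^ n * Real.sqrt 2 * s *
    Polynomial.aeval (Real.sqrt 2 * s) (Polynomial.hermite (n + 1)) - (n + 1) * Real.sqrt 2 ^ n *
    Polynomial.aeval (Real.sqrt 2 * s) (Polynomial.hermite n)) * h2

theorem hasDerivAt_physHermite_succ (n : ℕ) (s : ℝ) :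
    HasDerivAt (physHermite (n + 1)) (2 * (n + 1) * physHermite n s) s := by
  have h2 : Real.sqrt 2 * Real.sqrt 2 = 2 := Real.mul_self_sqrt (by norm_num)
  have h1 := (Polynomial.hasDerivAt_aeval (Polynomial.hermite (n + 1)) (Real.sqrt 2 * s)).comp s
    ((hasDerivAt_id s).const_mul (Real.sqrt 2))
  refine (h1.const_mul (Real.sqrt 2 ^ (n + 1))).congr_deriv ?_
  rw [derivative_hermite_succ]
  simp only [map_mul, map_add, map_natCast, map_one, physHermite]
  rw [pow_succ]
  linear_combination ((n + 1) * Real.sqrt 2 ^ n *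
    Polynomial.aeval (Real.sqrt 2 * s) (Polynomial.hermite n)) * h2

/-- The normalizing constant of `hermiteFn n`. -/
noncomputable def hermiteConst (n : ℕ) : ℝ :=
  (Real.sqrt (Real.sqrt Real.pi * 2 ^ n * (n.factorial : ℝ)))⁻¹

theorem hermiteConst_eq_succ (n : ℕ) :
    hermiteConst n = hermiteConst (n + 1) * Real.sqrt (2 * (n + 1)) := by
  unfold hermiteConst
  have h : Real.sqrt Real.pi * 2 ^ (n + 1) * ((n + 1).factorial : ℝ) =
      (Real.sqrt Real.pi * 2 ^ n * (n.factorial : ℝ)) * (2 * (n + 1)) := by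
    rw [Nat.factorial_succ]; push_cast; ring
  have h0 : Real.sqrt (2 * (n + 1) : ℝ) ≠ 0 := by positivity
  rw [h, Real.sqrt_mul (by positivity) (2 * (n + 1) : ℝ), mul_inv,
    inv_mul_cancel_right₀ h0]

theorem hermiteFn_eq (n : ℕ) (s : ℝ) :
    hermiteFn n s = hermiteConst n * Real.exp (-s ^ 2 / 2) * physHermite n s := rfl

/-- This and the next lemma rewrite ratios of consecutive normalizing constants so that the ladder
coefficient `√((n + 1) / 2)` appears. -/
theorem half_hermiteConst (n : ℕ) :
    hermiteConst n = 2 * Real.sqrt ((n + 1 : ℕ) / 2) * hermiteConst (n + 1) := by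
  rw [hermiteConst_eq_succ n]
  have : (2 * (n + 1) : ℝ) = 2 ^ 2 * ((n + 1 : ℕ) / 2) := by push_cast; ring
  rw [this, Real.sqrt_mul (by norm_num), Real.sqrt_sq (by norm_num)]
  ring

theorem succ_mul_hermiteConst (n : ℕ) :
    (n + 1) * hermiteConst (n + 1) = Real.sqrt ((n + 1 : ℕ) / 2) * hermiteConst n := by
  rw [half_hermiteConst n]
  have : Real.sqrt ((n + 1 : ℕ) / 2) * Real.sqrt ((n + 1 : ℕ) / 2) = (n + 1 : ℕ) / 2 :=
    Real.mul_self_sqrt (by positivity)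
  push_cast at this ⊢
  linear_combination (-2 * hermiteConst (n + 1)) * this

/-- Multiplication by `s` is the sum of the raising and lowering operators, up to a factor. For `n =
0` the truncated index `n - 1 = 0` is harmless, because its coefficient `√(0 / 2)` vanishes. -/
theorem mul_hermiteFn (n : ℕ) (s : ℝ) :
    s * hermiteFn n s = Real.sqrt ((n + 1 : ℕ) / 2) * hermiteFn (n + 1) s +
      Real.sqrt (n / 2) * hermiteFn (n - 1) s := by
  cases n with
  | zero =>
    have h := half_hermiteConst 0
    simp only [hermiteFn_eq, physHermite_zero, zero_add, physHermite_one, Nat.cast_zero, zero_div,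
      Real.sqrt_zero, zero_mul, add_zero] at h ⊢
    rw [h]; ring
  | succ n =>
    have h1 := half_hermiteConst (n + 1)
    have h2 := succ_mul_hermiteConst n
    have h3 := physHermite_succ_succ n s
    simp only [hermiteFn_eq, Nat.add_sub_cancel]
    rw [h3]
    linear_combination (Real.exp (-s ^ 2 / 2) * (s * physHermite (n + 1) s
      - (n + 1) * physHermite n s)) * h1 + Real.exp (-s ^ 2 / 2) * physHermite n s * h2

/-- The Gaussian factor contributes `-s ξₙ`, which is expanded by `mul_hermiteFn`; the derivative of
the polynomial contributes twice the lowering term. -/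
theorem hasDerivAt_hermiteFn (n : ℕ) (s : ℝ) :
    HasDerivAt (hermiteFn n) (Real.sqrt (n / 2) * hermiteFn (n - 1) s -
      Real.sqrt ((n + 1 : ℕ) / 2) * hermiteFn (n + 1) s) s := by
  have hg : HasDerivAt (fun s : ℝ => hermiteConst n * Real.exp (-s ^ 2 / 2))
      (hermiteConst n * (Real.exp (-s ^ 2 / 2) * (-s))) s := by
    have h : HasDerivAt (fun s : ℝ => -s ^ 2 / 2) (-s) s := by
      refine (((hasDerivAt_pow 2 s).neg).div_const 2).congr_deriv ?_
      simp
      ring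
    exact (h.exp).const_mul _
  have hm := mul_hermiteFn n s
  cases n with
  | zero =>
    have hp : HasDerivAt (physHermite 0) 0 s := by
      have : physHermite 0 = fun _ => (1 : ℝ) := funext physHermite_zero
      rw [this]; exact hasDerivAt_const _ _
    refine (hg.mul hp).congr_deriv ?_
    rw [hermiteFn_eq 0 s] at hm
    linear_combination (-1 : ℝ) * hm
  | succ n =>
    refine (hg.mul (hasDerivAt_physHermite_succ n s)).congr_deriv ?_
    have h2 := succ_mul_hermiteConst n
    rw [hermiteFn_eq (n + 1) s] at hm
    simp only [Nat.add_sub_cancel, hermiteFn_eq n s] at hm ⊢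
    linear_combination (-1 : ℝ) * hm + 2 * Real.exp (-s ^ 2 / 2) * physHermite n s * h2

theorem memLp_hermiteFn (n : ℕ) : MemLp (hermiteFn n) 2 volume :=
  (memLp_two_iff_integrable_sq (continuous_hermiteFn n).aestronglyMeasurable).2
    (integrable_hermiteFn_sq n)

theorem integrable_hermiteFn_mul (n m : ℕ) :
    Integrable fun s => hermiteFn n s * hermiteFn m s :=
  (memLp_hermiteFn n).integrable_mul (memLp_hermiteFn m)

/-- The derivative of `ξₙ ξₙ₊₁` integrates to zero. Computing `s ξₙ ξₙ₊₁` in two ways identifies its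
mixed terms, so the derivative equals `2a (ξₙ² - ξₙ₊₁²)` and consecutive norms agree. Orthogonality
is not needed. -/
theorem integral_hermiteFn_sq (n : ℕ) : ∫ s, hermiteFn n s ^ 2 = 1 := by
  induction n with
  | zero =>
    have h : ∀ s, hermiteFn 0 s ^ 2 = (Real.sqrt Real.pi)⁻¹ * Real.exp (-1 * s ^ 2) := by
      intro s
      have he : Real.exp (-1 * s ^ 2) = Real.exp (-s ^ 2 / 2) ^ 2 := by
        rw [← Real.exp_nat_mul]
        congr 1
        push_cast
        ring
      rw [hermiteFn_eq, physHermite_zero, he, hermiteConst]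
      simp only [pow_zero, mul_one, Nat.factorial_zero, Nat.cast_one]
      rw [mul_pow, inv_pow, Real.sq_sqrt (Real.sqrt_nonneg _)]
    simp_rw [h]
    rw [integral_const_mul, integral_gaussian, div_one, inv_mul_cancel₀]
    positivity
  | succ n ih =>
    have hi := integrable_hermiteFn_mul
    set a := Real.sqrt ((n + 1 : ℕ) / 2) with ha
    set b := Real.sqrt (n / 2) with hb
    set c := Real.sqrt ((n + 2 : ℕ) / 2) with hc
    have hapos : 0 < a := Real.sqrt_pos.2 (by positivity)
    have hint : Integrable fun s => (b * (hermiteFn (n - 1) s * hermiteFn (n + 1) s)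
        - c * (hermiteFn n s * hermiteFn (n + 2) s)) :=
      ((hi (n - 1) (n + 1)).const_mul b).sub ((hi n (n + 2)).const_mul c)
    have hint2 : Integrable fun s => a * hermiteFn n s ^ 2 - a * hermiteFn (n + 1) s ^ 2 :=
      ((integrable_hermiteFn_sq n).const_mul a).sub ((integrable_hermiteFn_sq (n + 1)).const_mul a)
    have hd : ∀ s, HasDerivAt (fun s => hermiteFn n s * hermiteFn (n + 1) s)
        ((b * (hermiteFn (n - 1) s * hermiteFn (n + 1) s)
          - c * (hermiteFn n s * hermiteFn (n + 2) s))
          + (a * hermiteFn n s ^ 2 - a * hermiteFn (n + 1) s ^ 2)) s := by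
      intro s
      refine ((hasDerivAt_hermiteFn n s).mul (hasDerivAt_hermiteFn (n + 1) s)).congr_deriv ?_
      simp only [Nat.add_sub_cancel]
      ring
    have h0 := integral_eq_zero_of_hasDerivAt_of_integrable hd (hint.add hint2) (hi n (n + 1))
    rw [integral_add hint hint2] at h0
    have h1 : ∀ s, b * (hermiteFn (n - 1) s * hermiteFn (n + 1) s)
        - c * (hermiteFn n s * hermiteFn (n + 2) s) =
          a * hermiteFn n s ^ 2 - a * hermiteFn (n + 1) s ^ 2 := by
      intro s
      have e1 := mul_hermiteFn n s
      have e2 := mul_hermiteFn (n + 1) s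
      simp only [Nat.add_sub_cancel] at e2
      linear_combination (-hermiteFn (n + 1) s) * e1 + hermiteFn n s * e2
    rw [integral_congr_ae (Eventually.of_forall h1), integral_sub
      ((integrable_hermiteFn_sq n).const_mul a) ((integrable_hermiteFn_sq (n + 1)).const_mul a),
      integral_const_mul, integral_const_mul, ih] at h0
    have : a * (1 - ∫ s, hermiteFn (n + 1) s ^ 2) = 0 := by linarith
    rcases mul_eq_zero.1 this with h | h
    · exact absurd h hapos.ne'
    · linarith

theorem lintegral_hermiteFn_sq (n : ℕ) : ∫⁻ s, ENNReal.ofReal (hermiteFn n s ^ 2) = 1 := by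
  rw [← ofReal_integral_eq_lintegral_ofReal (integrable_hermiteFn_sq n)
    (Eventually.of_forall fun s => sq_nonneg _), integral_hermiteFn_sq, ENNReal.ofReal_one]

theorem sq_mul_hermiteFn_le (n : ℕ) (s : ℝ) :
    (s * hermiteFn n s) ^ 2 ≤ (n + 1) * hermiteFn (n + 1) s ^ 2 + n * hermiteFn (n - 1) s ^ 2 := by
  rw [mul_hermiteFn]
  refine (add_sq_le).trans ?_
  rw [mul_pow, mul_pow, Real.sq_sqrt (by positivity), Real.sq_sqrt (by positivity)]
  push_cast
  linarith

/-- Each factor `s²` is traded for a factor `n + 1` by `sq_mul_hermiteFn_le`, at the price of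
shifting the index by one. -/
theorem exists_moment_hermiteFn_le (j : ℕ) : ∃ C : ℝ, 0 ≤ C ∧ ∀ n : ℕ,
    ∫⁻ s, ENNReal.ofReal (s ^ (2 * j) * hermiteFn n s ^ 2) ≤
      ENNReal.ofReal (C * (n + 1 : ℝ) ^ j) := by
  induction j with
  | zero =>
    refine ⟨1, zero_le_one, fun n => ?_⟩
    simp [lintegral_hermiteFn_sq]
  | succ j ih =>
    obtain ⟨C, hC, h⟩ := ih
    -- The `2 ^ j` pays for the raised index, through `(n + 2) ^ j ≤ 2 ^ j (n + 1) ^ j`, and the `1`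
    -- pays for the lowered index.
    refine ⟨C * (2 ^ j + 1), by positivity, fun n => ?_⟩
    have hc := continuous_hermiteFn
    have hm : ∀ m, Measurable fun s => ENNReal.ofReal (s ^ (2 * j) * hermiteFn m s ^ 2) := fun m =>
      (((continuous_id.pow _).mul ((hc m).pow 2)).measurable).ennreal_ofReal
    calc ∫⁻ s, ENNReal.ofReal (s ^ (2 * (j + 1)) * hermiteFn n s ^ 2)
        ≤ ∫⁻ s, (ENNReal.ofReal (n + 1) * ENNReal.ofReal (s ^ (2 * j) * hermiteFn (n + 1) s ^ 2)
          + ENNReal.ofReal n * ENNReal.ofReal (s ^ (2 * j) * hermiteFn (n - 1) s ^ 2)) := by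
          refine lintegral_mono fun s => ?_
          have hp : 0 ≤ s ^ (2 * j) := by rw [pow_mul]; positivity
          rw [← ENNReal.ofReal_mul (by positivity), ← ENNReal.ofReal_mul (by positivity),
            ← ENNReal.ofReal_add (by positivity) (by positivity)]
          refine ENNReal.ofReal_le_ofReal ?_
          have := mul_le_mul_of_nonneg_left (sq_mul_hermiteFn_le n s) hp
          calc s ^ (2 * (j + 1)) * hermiteFn n s ^ 2 = s ^ (2 * j) * (s * hermiteFn n s) ^ 2 := by
                ring
            _ ≤ _ := this
            _ = _ := by ring
      _ ≤ ENNReal.ofReal (n + 1) * ENNReal.ofReal (C * ((n + 1 : ℕ) + 1 : ℝ) ^ j)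
          + ENNReal.ofReal n * ENNReal.ofReal (C * ((n - 1 : ℕ) + 1 : ℝ) ^ j) := by
          rw [lintegral_add_left ((hm _).const_mul _), lintegral_const_mul _ (hm _),
            lintegral_const_mul _ (hm _)]
          gcongr
          · exact h _
          · exact h _
      _ ≤ ENNReal.ofReal (C * (2 ^ j + 1) * (n + 1 : ℝ) ^ (j + 1)) := by
          rw [← ENNReal.ofReal_mul (by positivity), ← ENNReal.ofReal_mul (by positivity),
            ← ENNReal.ofReal_add (by positivity) (by positivity)]
          refine ENNReal.ofReal_le_ofReal ?_
          have h1 : (((n + 1 : ℕ) : ℝ) + 1) ^ j ≤ 2 ^ j * (n + 1 : ℝ) ^ j := by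
            rw [← mul_pow]
            refine pow_le_pow_left₀ (by positivity) ?_ _
            push_cast
            have : (0 : ℝ) ≤ n := n.cast_nonneg
            linarith
          have h2 : (((n - 1 : ℕ) : ℝ) + 1) ^ j ≤ (n + 1 : ℝ) ^ j := by
            refine pow_le_pow_left₀ (by positivity) ?_ _
            have : ((n - 1 : ℕ) : ℝ) ≤ n := by exact_mod_cast Nat.sub_le n 1
            linarith
          calc (n + 1 : ℝ) * (C * (((n + 1 : ℕ) : ℝ) + 1) ^ j)
                + n * (C * (((n - 1 : ℕ) : ℝ) + 1) ^ j)
              ≤ (n + 1 : ℝ) * (C * (2 ^ j * (n + 1 : ℝ) ^ j))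
                + (n + 1) * (C * (n + 1 : ℝ) ^ j) := by
                gcongr
                linarith
            _ = C * (2 ^ j + 1) * (n + 1 : ℝ) ^ (j + 1) := by ring

/-- The crude uniform bound `ξₙ² ≤ 3 √(n + 1)`. -/
theorem hermiteFn_sq_le (n : ℕ) (s : ℝ) : hermiteFn n s ^ 2 ≤ 3 * Real.sqrt (n + 1) := by
  set D : ℝ → ℝ := fun s => Real.sqrt (n / 2) * hermiteFn (n - 1) s -
      Real.sqrt ((n + 1 : ℕ) / 2) * hermiteFn (n + 1) s with hD
  -- The value `ξₙ(s)²` is the integral of `2 ξₙ ξₙ'` over `(-∞, s]`, which is at most `t ‖ξₙ‖² +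
  -- ‖ξₙ'‖² / t` in `L²` norms. Since `‖ξₙ‖² = 1` and the bound used for `‖ξₙ'‖²` is `2n + 1`, this
  -- `t` balances the two terms.
  set t := Real.sqrt (n + 1) with ht
  have htpos : 0 < t := Real.sqrt_pos.2 (by positivity)
  have htsq : t ^ 2 = n + 1 := Real.sq_sqrt (by positivity)
  have hDL : MemLp D 2 volume :=
    ((memLp_hermiteFn (n - 1)).const_mul _).sub ((memLp_hermiteFn (n + 1)).const_mul _)
  have hd : ∀ s, HasDerivAt (fun s => hermiteFn n s ^ 2) (2 * (hermiteFn n s * D s)) s := by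
    intro s
    refine ((hasDerivAt_hermiteFn n s).pow 2).congr_deriv ?_
    simp only [hD]
    push_cast
    ring
  have hi : Integrable fun s => 2 * (hermiteFn n s * D s) :=
    ((memLp_hermiteFn n).integrable_mul hDL).const_mul 2
  have hlim := tendsto_zero_of_hasDerivAt_of_integrableOn_Iic (a := s) (fun x _ => hd x)
    hi.integrableOn (integrable_hermiteFn_sq n).integrableOn
  have hI := integral_Iic_of_hasDerivAt_of_tendsto' (a := s) (fun x _ => hd x) hi.integrableOn hlim
  rw [sub_zero] at hI
  rw [← hI]
  have hsq := integrable_hermiteFn_sq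
  have hg : Integrable fun x => t * hermiteFn n x ^ 2 +
      (n * hermiteFn (n - 1) x ^ 2 + (n + 1) * hermiteFn (n + 1) x ^ 2) / t :=
    ((hsq n).const_mul t).add
      ((((hsq (n - 1)).const_mul (n : ℝ)).add ((hsq (n + 1)).const_mul (n + 1 : ℝ))).div_const t)
  have hle : ∀ x, 2 * (hermiteFn n x * D x) ≤ t * hermiteFn n x ^ 2 +
      (n * hermiteFn (n - 1) x ^ 2 + (n + 1) * hermiteFn (n + 1) x ^ 2) / t := by
    intro x
    have h1 : D x ^ 2 ≤ n * hermiteFn (n - 1) x ^ 2 + (n + 1) * hermiteFn (n + 1) x ^ 2 := by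
      have := add_sq_le (a := Real.sqrt (n / 2) * hermiteFn (n - 1) x)
        (b := -(Real.sqrt ((n + 1 : ℕ) / 2) * hermiteFn (n + 1) x))
      rw [neg_sq, mul_pow, mul_pow, Real.sq_sqrt (by positivity), Real.sq_sqrt (by positivity)]
        at this
      simp only [hD]
      push_cast at this ⊢
      linarith
    have h2 : 2 * (hermiteFn n x * D x) ≤ t * hermiteFn n x ^ 2 + D x ^ 2 / t := by
      have h3 : 0 ≤ (t * hermiteFn n x - D x) ^ 2 / t := by positivity
      have h4 : (t * hermiteFn n x - D x) ^ 2 / t =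
          t * hermiteFn n x ^ 2 + D x ^ 2 / t - 2 * (hermiteFn n x * D x) := by
        field_simp
        ring
      linarith
    refine h2.trans ?_
    gcongr
  calc ∫ x in Iic s, 2 * (hermiteFn n x * D x)
      ≤ ∫ x in Iic s, (t * hermiteFn n x ^ 2 +
        (n * hermiteFn (n - 1) x ^ 2 + (n + 1) * hermiteFn (n + 1) x ^ 2) / t) :=
        setIntegral_mono hi.integrableOn hg.integrableOn hle
    _ ≤ ∫ x, (t * hermiteFn n x ^ 2 +
        (n * hermiteFn (n - 1) x ^ 2 + (n + 1) * hermiteFn (n + 1) x ^ 2) / t) :=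
        setIntegral_le_integral hg (Eventually.of_forall fun x => by positivity)
    _ = t + (n + (n + 1)) / t := by
        have hg2 : Integrable fun x =>
            (n * hermiteFn (n - 1) x ^ 2 + (n + 1) * hermiteFn (n + 1) x ^ 2) / t :=
          (((hsq (n - 1)).const_mul (n : ℝ)).add
            ((hsq (n + 1)).const_mul (n + 1 : ℝ))).div_const t
        rw [integral_add ((hsq n).const_mul t) hg2,
          integral_const_mul, integral_div, integral_add ((hsq (n - 1)).const_mul (n : ℝ))
            ((hsq (n + 1)).const_mul (n + 1 : ℝ)), integral_const_mul, integral_const_mul,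
          integral_hermiteFn_sq, integral_hermiteFn_sq, integral_hermiteFn_sq]
        ring
    _ ≤ 3 * t := by
        have : (n + (n + 1 : ℝ)) / t ≤ 2 * t := by
          rw [div_le_iff₀ htpos]
          nlinarith
        linarith


theorem integrable_pow_mul_hermiteFn_sq (j n : ℕ) :
    Integrable fun s => s ^ (2 * j) * hermiteFn n s ^ 2 := by
  obtain ⟨C, -, h⟩ := exists_moment_hermiteFn_le j
  have hc := continuous_hermiteFn n
  refine ⟨(by fun_prop : Continuous fun s => s ^ (2 * j) * hermiteFn n s ^ 2).aestronglyMeasurable,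
    ?_⟩
  rw [hasFiniteIntegral_iff_ofReal]
  · exact (h n).trans_lt ENNReal.ofReal_lt_top
  · exact Eventually.of_forall fun s => by
      have : 0 ≤ s ^ (2 * j) := by rw [pow_mul]; positivity
      positivity

theorem exists_integral_moment_hermiteFn_le (j : ℕ) : ∃ C : ℝ, 0 ≤ C ∧ ∀ n : ℕ,
    ∫ s, s ^ (2 * j) * hermiteFn n s ^ 2 ≤ C * (n + 1 : ℝ) ^ j := by
  obtain ⟨C, hC, h⟩ := exists_moment_hermiteFn_le j
  refine ⟨C, hC, fun n => ?_⟩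
  have h1 := h n
  rw [← ofReal_integral_eq_lintegral_ofReal (integrable_pow_mul_hermiteFn_sq j n)
    (Eventually.of_forall fun s => by
      have : 0 ≤ s ^ (2 * j) := by rw [pow_mul]; positivity
      positivity)] at h1
  exact (ENNReal.ofReal_le_ofReal_iff (by positivity)).1 h1

/-! ### Hermite functions in several variables. -/

theorem continuous_hermiteFnRd (n : Fin d → ℕ) : Continuous (hermiteFnRd n) := by
  unfold hermiteFnRd
  refine continuous_finsetProd _ fun i _ => (continuous_hermiteFn _).comp ?_
  fun_prop

theorem integrable_prod_coord {f : Fin d → ℝ → ℝ} (hf : ∀ i, Integrable (f i)) :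
    Integrable (fun x : Rd d => ∏ i, f i (x i)) ∧
      ∫ x : Rd d, ∏ i, f i (x i) = ∏ i, ∫ s, f i s := by
  have h := Integrable.fintype_prod (ι := Fin d) (μ := fun _ => (volume : Measure ℝ)) hf
  have hp := PiLp.volume_preserving_ofLp (Fin d)
  refine ⟨hp.integrable_comp_of_integrable h, ?_⟩
  have h2 := hp.integral_comp (MeasurableEquiv.toLp 2 (Fin d → ℝ)).symm.measurableEmbedding
    (fun y : Fin d → ℝ => ∏ i, f i (y i))
  exact h2.trans (integral_fintype_prod_volume_eq_prod f)

theorem integrable_hermiteFnRd_sq (n : Fin d → ℕ) :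
    Integrable fun x : Rd d => hermiteFnRd n x ^ 2 :=
  (memLp_two_iff_integrable_sq (continuous_hermiteFnRd n).aestronglyMeasurable).1
    (memLp_hermiteFnRd n)

theorem integral_hermiteFnRd_sq (n : Fin d → ℕ) : ∫ x : Rd d, hermiteFnRd n x ^ 2 = 1 := by
  have h := (integrable_prod_coord (d := d) fun i => integrable_hermiteFn_sq (n i)).2
  simp only [integral_hermiteFn_sq, Finset.prod_const_one] at h
  rw [← h]
  simp [hermiteFnRd, Finset.prod_pow]

theorem integrable_coord_pow_mul_hermiteFnRd_sq (j : ℕ) (n : Fin d → ℕ) (i : Fin d) :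
    Integrable (fun x : Rd d => x i ^ (2 * j) * hermiteFnRd n x ^ 2) ∧
      ∫ x : Rd d, x i ^ (2 * j) * hermiteFnRd n x ^ 2 =
        ∫ s, s ^ (2 * j) * hermiteFn (n i) s ^ 2 := by
  -- The weight is placed in the `i`-th factor only; all other factors integrate to one.
  let f : Fin d → ℝ → ℝ := fun m s => (if m = i then s ^ (2 * j) else 1) * hermiteFn (n m) s ^ 2
  have hf : ∀ m, Integrable (f m) := by
    intro m
    by_cases hm : m = i
    · simpa [f, hm] using integrable_pow_mul_hermiteFn_sq j (n i)
    · simpa [f, hm] using integrable_hermiteFn_sq (n m)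
  have e : ∀ x : Rd d, ∏ m, f m (x m) = x i ^ (2 * j) * hermiteFnRd n x ^ 2 := by
    intro x
    simp only [f, Finset.prod_mul_distrib, hermiteFnRd, Finset.prod_pow]
    congr 1
    rw [Finset.prod_ite_eq' Finset.univ i fun m => x m ^ (2 * j)]
    simp
  obtain ⟨h1, h2⟩ := integrable_prod_coord hf
  simp only [e] at h1 h2
  refine ⟨h1, h2.trans ?_⟩
  rw [Finset.prod_eq_single i]
  · simp [f]
  · intro m _ hm
    simp [f, hm, integral_hermiteFn_sq]
  · simp

/-! ### Bounds in terms of the eigenvalues. -/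

section Eigval

variable {α : ℝ}

/-- The existence of an index `i` forces `d ≥ 1`, and this term of the eigenvalue pays for the `1`.
-/
theorem coord_succ_le_eigval (hα : 0 < α) (n : Fin d → ℕ) (i : Fin d) :
    (n i + 1 : ℝ) ≤ eigval α n := by
  have h1 : (n i : ℝ) ≤ ∑ i, (n i : ℝ) :=
    Finset.single_le_sum (f := fun i => (n i : ℝ)) (fun _ _ => Nat.cast_nonneg _)
      (Finset.mem_univ i)
  have h2 : (1 : ℝ) ≤ d := by
    have : 0 < d := i.pos
    exact_mod_cast this
  have h3 : (0 : ℝ) ≤ n i := Nat.cast_nonneg _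
  unfold eigval
  linarith

theorem one_le_eigval (hd : 1 ≤ d) (hα : 0 < α) (n : Fin d → ℕ) : 1 ≤ eigval α n := by
  have h := coord_succ_le_eigval hα n ⟨0, hd⟩
  have h3 : (0 : ℝ) ≤ n ⟨0, hd⟩ := Nat.cast_nonneg _
  linarith

theorem hermiteFnRd_sq_le (hd : 1 ≤ d) (hα : 0 < α) (n : Fin d → ℕ) (x : Rd d) :
    hermiteFnRd n x ^ 2 ≤ 3 ^ d * eigval α n ^ (d / 2 : ℝ) := by
  have hL := one_le_eigval hd hα n
  have h : hermiteFnRd n x ^ 2 ≤ ∏ _i : Fin d, 3 * Real.sqrt (eigval α n) := by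
    rw [hermiteFnRd, ← Finset.prod_pow]
    refine Finset.prod_le_prod (fun i _ => sq_nonneg _) fun i _ => ?_
    refine (hermiteFn_sq_le _ _).trans ?_
    have := coord_succ_le_eigval hα n i
    gcongr
  refine h.trans (le_of_eq ?_)
  rw [Finset.prod_const, Finset.card_univ, Fintype.card_fin, mul_pow, Real.sqrt_eq_rpow,
    ← Real.rpow_natCast, ← Real.rpow_natCast, ← Real.rpow_mul (by linarith)]
  congr 2
  ring

/-- Writing `eigval^(-p)` as a product of `d` equal factors and bounding the `i`-th one by `(nᵢ +
1)^(-p/d)` reduces the sum to the `d`-th power of a convergent one-dimensional series. -/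
theorem exists_sum_eigval_rpow_le (hd : 1 ≤ d) (hα : 0 < α) {p : ℝ} (hp : (d : ℝ) < p) :
    ∃ B : ℝ, 0 ≤ B ∧ ∀ s : Finset (Fin d → ℕ), ∑ n ∈ s, eigval α n ^ (-p) ≤ B := by
  have hd0 : (0 : ℝ) < d := by exact_mod_cast hd
  have hr : 1 < p / d := (one_lt_div hd0).2 hp
  let g : ℕ → ℝ := fun m => 1 / ((m + 1 : ℕ) : ℝ) ^ (p / d)
  have hg : Summable g := (summable_nat_add_iff 1).2 (Real.summable_one_div_nat_rpow.2 hr)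
  have hg0 : ∀ m, 0 ≤ g m := fun m => by positivity
  have hle : ∀ n : Fin d → ℕ, eigval α n ^ (-p) ≤ ∏ i, g (n i) := by
    intro n
    have hL := one_le_eigval hd hα n
    have hL0 : 0 < eigval α n := by linarith
    have e : eigval α n ^ (-p) = ∏ _i : Fin d, eigval α n ^ (-(p / d)) := by
      rw [Finset.prod_const, Finset.card_univ, Fintype.card_fin, ← Real.rpow_natCast,
        ← Real.rpow_mul hL0.le]
      congr 1
      field_simp
    rw [e]
    refine Finset.prod_le_prod (fun i _ => by positivity) fun i _ => ?_
    simp only [g, one_div]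
    rw [← Real.rpow_neg (by positivity)]
    refine Real.rpow_le_rpow_of_nonpos (by positivity) ?_ (by linarith)
    have := coord_succ_le_eigval hα n i
    push_cast
    exact this
  refine ⟨(∑' m, g m) ^ d, pow_nonneg (tsum_nonneg hg0) _, fun s => ?_⟩
  -- The finite set is enclosed in a box `t^d`, over which the sum of products factors.
  let t : Finset ℕ := s.biUnion fun n => Finset.univ.image n
  have hst : s ⊆ Fintype.piFinset fun _ : Fin d => t := by
    intro n hn
    rw [Fintype.mem_piFinset]
    intro i
    exact Finset.mem_biUnion.2 ⟨n, hn, Finset.mem_image_of_mem _ (Finset.mem_univ _)⟩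
  calc ∑ n ∈ s, eigval α n ^ (-p) ≤ ∑ n ∈ s, ∏ i, g (n i) := Finset.sum_le_sum fun n _ => hle n
    _ ≤ ∑ n ∈ Fintype.piFinset fun _ : Fin d => t, ∏ i, g (n i) :=
        Finset.sum_le_sum_of_subset_of_nonneg hst fun n _ _ => Finset.prod_nonneg fun i _ => hg0 _
    _ = ∏ _i : Fin d, ∑ m ∈ t, g m := (Finset.prod_univ_sum (fun _ => t) fun _ m => g m).symm
    _ = (∑ m ∈ t, g m) ^ d := by simp
    _ ≤ _ := pow_le_pow_left₀ (Finset.sum_nonneg fun m _ => hg0 m)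
        (hg.sum_le_tsum t fun m _ => hg0 m) _

/-- The natural scale of `|x|²` in the state `n` is the eigenvalue `L`. With `t = |x|² / L` the
power `t^k` is at most `1 + t^(m+1)`, whose expectation is bounded uniformly in `n` by the
coordinate moments. -/
theorem exists_weighted_moment_hermiteFnRd_le (hd : 1 ≤ d) (hα : 0 < α) {k : ℝ} (hk : 0 < k) :
    ∃ C : ℝ, 0 ≤ C ∧ ∀ n : Fin d → ℕ,
      ∫⁻ x : Rd d, ENNReal.ofReal ((1 + ‖x‖ ^ (2 * k)) * hermiteFnRd n x ^ 2) ≤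
        ENNReal.ofReal (C * eigval α n ^ k) := by
  obtain ⟨m, hm⟩ : ∃ m : ℕ, k ≤ m := exists_nat_ge k
  obtain ⟨C, hC, h⟩ := exists_integral_moment_hermiteFn_le (m + 1)
  refine ⟨2 + (d : ℝ) ^ m * (d * C), by positivity, fun n => ?_⟩
  have hL := one_le_eigval hd hα n
  set L := eigval α n with hLdef
  have hL0 : 0 < L := by linarith
  let F : Rd d → ℝ := fun x => (1 + L ^ k) * hermiteFnRd n x ^ 2 +
    L ^ k * ((L ^ (m + 1))⁻¹ * ((d : ℝ) ^ m * ∑ i, x i ^ (2 * (m + 1)) * hermiteFnRd n x ^ 2))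
  have hi := fun i => (integrable_coord_pow_mul_hermiteFnRd_sq (m + 1) n i).1
  have hi2 : Integrable fun x : Rd d => ∑ i, x i ^ (2 * (m + 1)) * hermiteFnRd n x ^ 2 :=
    integrable_finsetSum _ fun i _ => hi i
  have hFi : Integrable F :=
    ((integrable_hermiteFnRd_sq n).const_mul _).add (((hi2.const_mul _).const_mul _).const_mul _)
  have hF : ∀ x, (1 + ‖x‖ ^ (2 * k)) * hermiteFnRd n x ^ 2 ≤ F x := by
    intro x
    have h1 : ‖x‖ ^ (2 * k) ≤ L ^ k * (1 + (L ^ (m + 1))⁻¹ * (‖x‖ ^ 2) ^ (m + 1)) := by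
      have e : ‖x‖ ^ (2 * k) = L ^ k * (‖x‖ ^ 2 / L) ^ k := by
        rw [← Real.mul_rpow hL0.le (by positivity), mul_div_cancel₀ _ hL0.ne',
          Real.rpow_mul (norm_nonneg _), Real.rpow_two]
      rw [e]
      refine mul_le_mul_of_nonneg_left ?_ (by positivity)
      have e2 : (L ^ (m + 1))⁻¹ * (‖x‖ ^ 2) ^ (m + 1) = (‖x‖ ^ 2 / L) ^ (m + 1) := by
        rw [div_pow]; field_simp
      rw [e2]
      set t := ‖x‖ ^ 2 / L
      have ht : 0 ≤ t := by positivity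
      rcases le_total t 1 with h | h
      · have := Real.rpow_le_one ht h hk.le
        have : 0 ≤ t ^ (m + 1) := by positivity
        linarith
      · have : t ^ k ≤ t ^ ((m + 1 : ℕ) : ℝ) :=
          Real.rpow_le_rpow_of_exponent_le h (by push_cast; linarith)
        rw [Real.rpow_natCast] at this
        linarith
    have h2 : (‖x‖ ^ 2) ^ (m + 1) ≤ (d : ℝ) ^ m * ∑ i, x i ^ (2 * (m + 1)) := by
      rw [EuclideanSpace.real_norm_sq_eq]
      -- The power mean inequality splits `|x|^(2(m+1))` into coordinate powers.
      have := pow_sum_le_card_mul_sum_pow (s := Finset.univ) (f := fun i : Fin d => x i ^ 2)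
        (fun i _ => sq_nonneg _) m
      simpa [← pow_mul] using this
    have h3 : ‖x‖ ^ (2 * k) ≤
        L ^ k * (1 + (L ^ (m + 1))⁻¹ * ((d : ℝ) ^ m * ∑ i, x i ^ (2 * (m + 1)))) := by
      refine h1.trans ?_
      gcongr
    have h4 := mul_le_mul_of_nonneg_right (add_le_add_right h3 1) (sq_nonneg (hermiteFnRd n x))
    refine h4.trans (le_of_eq ?_)
    simp only [F]
    rw [← Finset.sum_mul]
    ring
  have hF0 : ∀ x, 0 ≤ F x := fun x => le_trans (by positivity) (hF x)
  refine (lintegral_mono fun x => ENNReal.ofReal_le_ofReal (hF x)).trans ?_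
  rw [← ofReal_integral_eq_lintegral_ofReal hFi (Eventually.of_forall hF0)]
  refine ENNReal.ofReal_le_ofReal ?_
  have hsum : ∫ x : Rd d, ∑ i, x i ^ (2 * (m + 1)) * hermiteFnRd n x ^ 2 ≤
      d * (C * L ^ (m + 1)) := by
    rw [integral_finsetSum _ fun i _ => hi i]
    have : ∀ i ∈ Finset.univ, ∫ x : Rd d, x i ^ (2 * (m + 1)) * hermiteFnRd n x ^ 2 ≤
        C * L ^ (m + 1) := by
      intro i _
      rw [(integrable_coord_pow_mul_hermiteFnRd_sq (m + 1) n i).2]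
      refine (h (n i)).trans ?_
      have := coord_succ_le_eigval hα n i
      gcongr
    simpa using Finset.sum_le_sum this
  have hLk : 1 ≤ L ^ k := Real.one_le_rpow hL hk.le
  have e : ∫ x, F x = (1 + L ^ k) * 1 + L ^ k * ((L ^ (m + 1))⁻¹ * ((d : ℝ) ^ m *
      ∫ x : Rd d, ∑ i, x i ^ (2 * (m + 1)) * hermiteFnRd n x ^ 2)) := by
    simp only [F]
    rw [integral_add ((integrable_hermiteFnRd_sq n).const_mul _)
      (((hi2.const_mul _).const_mul _).const_mul _), integral_const_mul, integral_hermiteFnRd_sq,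
      integral_const_mul, integral_const_mul, integral_const_mul]
  rw [e]
  have h5 : L ^ k * ((L ^ (m + 1))⁻¹ * ((d : ℝ) ^ m *
      ∫ x : Rd d, ∑ i, x i ^ (2 * (m + 1)) * hermiteFnRd n x ^ 2)) ≤
      L ^ k * ((L ^ (m + 1))⁻¹ * ((d : ℝ) ^ m * (d * (C * L ^ (m + 1))))) := by gcongr
  have h6 : L ^ k * ((L ^ (m + 1))⁻¹ * ((d : ℝ) ^ m * (d * (C * L ^ (m + 1))))) =
      (d : ℝ) ^ m * (d * C) * L ^ k := by field_simp
  linarith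

end Eigval

/-! ### The pointwise variance of the partial sums. -/

/-- The coefficient of the standard normal variable of index `n` in `gaussSeries`, with respect to
the Hermite basis of `H`. -/
noncomputable def gaussCoef (k α d' : ℝ) (n : Fin d → ℕ) : ℝ :=
  eigval α n ^ (-(d' / 2)) * eigval α n ^ (-(k / 2))

/-- The pointwise variance of a finite partial sum of `gaussSeries`. -/
noncomputable def gaussVar (k α d' : ℝ) (s : Finset (Fin d → ℕ)) (x : Rd d) : ℝ :=
  ∑ n ∈ s, (gaussCoef k α d' n * hermiteFnRd n x) ^ 2

theorem gaussVar_nonneg (k α d' : ℝ) (s : Finset (Fin d → ℕ)) (x : Rd d) :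
    0 ≤ gaussVar k α d' s x := Finset.sum_nonneg fun _ _ => sq_nonneg _

theorem continuous_gaussVar (k α d' : ℝ) (s : Finset (Fin d → ℕ)) :
    Continuous (gaussVar k α d' s) :=
  continuous_finsetSum _ fun n _ => (continuous_const.mul (continuous_hermiteFnRd n)).pow 2

theorem gaussCoef_sq {k α d' : ℝ} (hd : 1 ≤ d) (hα : 0 < α) (n : Fin d → ℕ) :
    gaussCoef k α d' n ^ 2 = eigval α n ^ (-(d' + k)) := by
  have hL := one_le_eigval hd hα n
  rw [gaussCoef, ← Real.rpow_add (by linarith), ← Real.rpow_natCast, ← Real.rpow_mul (by linarith)]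
  congr 1
  push_cast
  ring

/-- The sup bound for `f_n²` costs `eigval^(d/2)`, while the squared coefficient is
`eigval^(-(d'+k))`. With `k > d/2` at most the summable `eigval^(-d')` is left. -/
theorem exists_gaussVar_le {k α d' : ℝ} (hd : 1 ≤ d) (hα : 0 < α) (hd' : (d : ℝ) < d')
    (hk : (d : ℝ) / 2 < k) :
    ∃ B : ℝ, 0 ≤ B ∧ ∀ (s : Finset (Fin d → ℕ)) (x : Rd d), gaussVar k α d' s x ≤ B := by
  obtain ⟨B, hB, h⟩ := exists_sum_eigval_rpow_le hd hα hd'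
  refine ⟨3 ^ d * B, by positivity, fun s x => ?_⟩
  calc gaussVar k α d' s x ≤ ∑ n ∈ s, 3 ^ d * eigval α n ^ (-d') := by
        refine Finset.sum_le_sum fun n _ => ?_
        have hL := one_le_eigval hd hα n
        rw [mul_pow, gaussCoef_sq hd hα]
        calc eigval α n ^ (-(d' + k)) * hermiteFnRd n x ^ 2
            ≤ eigval α n ^ (-(d' + k)) * (3 ^ d * eigval α n ^ (d / 2 : ℝ)) := by
              have := hermiteFnRd_sq_le hd hα n x
              have h0 : 0 ≤ eigval α n ^ (-(d' + k)) := by positivity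
              gcongr
          _ = 3 ^ d * eigval α n ^ (-(d' + k) + d / 2 : ℝ) := by
              rw [Real.rpow_add (by linarith)]; ring
          _ ≤ 3 ^ d * eigval α n ^ (-d') := by
              gcongr
              linarith
    _ = 3 ^ d * ∑ n ∈ s, eigval α n ^ (-d') := (Finset.mul_sum _ _ _).symm
    _ ≤ 3 ^ d * B := by gcongr; exact h s

/-- The weighted moment of `f_n²` costs `eigval^k`, which cancels the same factor in the squared
coefficient and leaves `eigval^(-d')`. -/
theorem exists_lintegral_weight_gaussVar_le {k α d' : ℝ} (hd : 1 ≤ d) (hα : 0 < α) (hk : 0 < k)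
    (hd' : (d : ℝ) < d') :
    ∃ B : ℝ, 0 ≤ B ∧ ∀ s : Finset (Fin d → ℕ),
      ∫⁻ x : Rd d, ENNReal.ofReal ((1 + ‖x‖ ^ (2 * k)) * gaussVar k α d' s x) ≤
        ENNReal.ofReal B := by
  obtain ⟨B, hB, h⟩ := exists_sum_eigval_rpow_le hd hα hd'
  obtain ⟨C, hC, hw⟩ := exists_weighted_moment_hermiteFnRd_le hd hα hk
  refine ⟨C * B, by positivity, fun s => ?_⟩
  have hterm : ∀ n : Fin d → ℕ, Measurable fun x : Rd d =>
      ENNReal.ofReal ((1 + ‖x‖ ^ (2 * k)) * hermiteFnRd n x ^ 2) := by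
    intro n
    have := (continuous_hermiteFnRd n).measurable
    fun_prop
  have e : ∀ x : Rd d, ENNReal.ofReal ((1 + ‖x‖ ^ (2 * k)) * gaussVar k α d' s x) =
      ∑ n ∈ s, ENNReal.ofReal (gaussCoef k α d' n ^ 2) *
        ENNReal.ofReal ((1 + ‖x‖ ^ (2 * k)) * hermiteFnRd n x ^ 2) := by
    intro x
    rw [gaussVar, Finset.mul_sum, ENNReal.ofReal_sum_of_nonneg fun n _ => by positivity]
    refine Finset.sum_congr rfl fun n _ => ?_
    rw [← ENNReal.ofReal_mul (sq_nonneg _)]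
    congr 1
    ring
  simp_rw [e]
  rw [lintegral_finsetSum _ fun n _ => (hterm n).const_mul _]
  calc ∑ n ∈ s, ∫⁻ x : Rd d, ENNReal.ofReal (gaussCoef k α d' n ^ 2) *
        ENNReal.ofReal ((1 + ‖x‖ ^ (2 * k)) * hermiteFnRd n x ^ 2)
      ≤ ∑ n ∈ s, ENNReal.ofReal (C * eigval α n ^ (-d')) := by
        refine Finset.sum_le_sum fun n _ => ?_
        have hL := one_le_eigval hd hα n
        rw [lintegral_const_mul _ (hterm n)]
        refine (mul_le_mul_right (hw n) _).trans ?_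
        rw [← ENNReal.ofReal_mul (sq_nonneg _), gaussCoef_sq hd hα]
        refine ENNReal.ofReal_le_ofReal (le_of_eq ?_)
        rw [show -d' = -(d' + k) + k by ring, Real.rpow_add (by linarith)]
        ring
    _ = ENNReal.ofReal (C * ∑ n ∈ s, eigval α n ^ (-d')) := by
        rw [Finset.mul_sum, ENNReal.ofReal_sum_of_nonneg]
        intro n _
        have hL := one_le_eigval hd hα n
        positivity
    _ ≤ ENNReal.ofReal (C * B) := ENNReal.ofReal_le_ofReal (by gcongr; exact h s)

theorem one_add_rpow_le {k t : ℝ} (hk : 0 < k) (ht : 0 ≤ t) :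
    (1 + t) ^ (2 * k) ≤ 2 ^ (2 * k) * (1 + t ^ (2 * k)) := by
  have h2 : (0 : ℝ) < 2 ^ (2 * k) := by positivity
  have ht2 : 0 ≤ t ^ (2 * k) := by positivity
  rcases le_total t 1 with h | h
  · have : (1 + t) ^ (2 * k) ≤ 2 ^ (2 * k) :=
      Real.rpow_le_rpow (by linarith) (by linarith) (by linarith)
    nlinarith
  · have : (1 + t) ^ (2 * k) ≤ (2 * t) ^ (2 * k) :=
      Real.rpow_le_rpow (by linarith) (by linarith) (by linarith)
    rw [Real.mul_rpow (by norm_num) ht] at this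
    nlinarith

/-- Everything is reduced to the weighted integral of the variance `v`. The power `v^θ` is linear in
`v` by the sup bound, and `v^(1/2)` is at most `1/p + p v` with `p = (1 + |x|)^(2k)`, where `1/p` is
integrable because `2k > d`. -/
theorem exists_lintegral_gaussVar_le {k α d' θ : ℝ} (hd : 1 ≤ d) (hα : 0 < α)
    (hk : (d : ℝ) / 2 < k) (hd' : (d : ℝ) < d') (hθ : 1 < θ) :
    ∃ B : ℝ, 0 ≤ B ∧ ∀ s : Finset (Fin d → ℕ),
      ∫⁻ x : Rd d, ENNReal.ofReal (gaussVar k α d' s x ^ (1 / 2 : ℝ) + gaussVar k α d' s x ^ θ +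
        (1 + ‖x‖ ^ (2 * k)) * gaussVar k α d' s x) ≤ ENNReal.ofReal B := by
  have hd0 : (0 : ℝ) < d := by exact_mod_cast hd
  have hk0 : 0 < k := by linarith
  obtain ⟨A, hA, hsup⟩ := exists_gaussVar_le hd hα hd' hk
  obtain ⟨W, hW, hw⟩ := exists_lintegral_weight_gaussVar_le (k := k) hd hα hk0 hd'
  have hI : Integrable (fun x : Rd d => (1 + ‖x‖) ^ (-(2 * k))) :=
    integrable_one_add_norm (by simp; linarith)
  set M : ℝ := 2 ^ (2 * k) + A ^ (θ - 1) + 1 with hM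
  have hM0 : 0 ≤ M := by positivity
  refine ⟨(∫ x : Rd d, (1 + ‖x‖) ^ (-(2 * k))) + M * W, by positivity, fun s => ?_⟩
  have hb : ∀ x : Rd d, gaussVar k α d' s x ^ (1 / 2 : ℝ) + gaussVar k α d' s x ^ θ +
        (1 + ‖x‖ ^ (2 * k)) * gaussVar k α d' s x ≤ (1 + ‖x‖) ^ (-(2 * k)) +
        M * ((1 + ‖x‖ ^ (2 * k)) * gaussVar k α d' s x) := by
    intro x
    have hv := gaussVar_nonneg k α d' s x
    have hvA := hsup s x
    set v := gaussVar k α d' s x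
    set w := ‖x‖ ^ (2 * k)
    have hw0 : 0 ≤ w := by positivity
    have h1 : v ^ (1 / 2 : ℝ) ≤ (1 + ‖x‖) ^ (-(2 * k)) + 2 ^ (2 * k) * (1 + w) * v := by
      have hg := one_add_rpow_le hk0 (norm_nonneg x)
      have hp : 0 < (1 + ‖x‖) ^ (2 * k) := by positivity
      set p := (1 + ‖x‖) ^ (2 * k)
      rw [Real.rpow_neg (by positivity), ← Real.sqrt_eq_rpow]
      have h2 : Real.sqrt v ≤ p⁻¹ + p * v := by
        have hs := Real.sq_sqrt hv
        -- Expanding this nonnegative quantity gives exactly `1/p + p v - √v`.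
        have : 0 ≤ p⁻¹ * ((1 - p * Real.sqrt v) ^ 2 + p * Real.sqrt v) := by positivity
        have e : p⁻¹ * ((1 - p * Real.sqrt v) ^ 2 + p * Real.sqrt v) =
            p⁻¹ + p * Real.sqrt v ^ 2 - Real.sqrt v := by
          field_simp
          ring
        rw [e, hs] at this
        linarith
      refine h2.trans ?_
      gcongr
    have h3 : v ^ θ ≤ A ^ (θ - 1) * v := by
      rcases hv.eq_or_lt with h0 | h0
      · rw [← h0, Real.zero_rpow (by linarith), mul_zero]
      · have : v ^ θ = v ^ (θ - 1) * v := by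
          rw [← Real.rpow_add_one h0.ne']; congr 1; ring
        rw [this]
        have := Real.rpow_le_rpow hv hvA (by linarith : 0 ≤ θ - 1)
        gcongr
    have h4 : A ^ (θ - 1) * v ≤ A ^ (θ - 1) * ((1 + w) * v) := by
      refine mul_le_mul_of_nonneg_left ?_ (by positivity)
      nlinarith [mul_nonneg hw0 hv]
    have h5 : M * ((1 + w) * v) = 2 ^ (2 * k) * (1 + w) * v + A ^ (θ - 1) * ((1 + w) * v)
        + (1 + w) * v := by rw [hM]; ring
    linarith
  calc ∫⁻ x : Rd d, ENNReal.ofReal (gaussVar k α d' s x ^ (1 / 2 : ℝ) + gaussVar k α d' s x ^ θ +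
        (1 + ‖x‖ ^ (2 * k)) * gaussVar k α d' s x)
      ≤ ∫⁻ x : Rd d, (ENNReal.ofReal ((1 + ‖x‖) ^ (-(2 * k))) + ENNReal.ofReal M *
          ENNReal.ofReal ((1 + ‖x‖ ^ (2 * k)) * gaussVar k α d' s x)) := by
        refine lintegral_mono fun x => ?_
        have hv := gaussVar_nonneg k α d' s x
        rw [← ENNReal.ofReal_mul hM0, ← ENNReal.ofReal_add (by positivity) (by positivity)]
        exact ENNReal.ofReal_le_ofReal (hb x)
    _ ≤ ENNReal.ofReal (∫ x : Rd d, (1 + ‖x‖) ^ (-(2 * k))) +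
          ENNReal.ofReal M * ENNReal.ofReal W := by
        have hmeas := (continuous_gaussVar k α d' s).measurable
        rw [lintegral_add_left (by fun_prop), lintegral_const_mul _ (by fun_prop),
          ofReal_integral_eq_lintegral_ofReal hI (Eventually.of_forall fun x => by positivity)]
        gcongr
        exact hw s
    _ = _ := by
        rw [← ENNReal.ofReal_mul hM0, ← ENNReal.ofReal_add (by positivity) (by positivity)]

/-! ### Minkowski's integral inequality and Gaussian moments. -/

/-- Minkowski's integral inequality in `L²(P)`: the square is a double integral over `(x, y)`,
Tonelli moves the integral in `ω` inside, and Cauchy–Schwarz in `ω` separates `x` from `y`. -/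
theorem sq_lintegral_lintegral_le {Ω X : Type*} [MeasurableSpace Ω] [MeasurableSpace X]
    {P : Measure Ω} {μ : Measure X} [SFinite P] [SFinite μ] {G : Ω → X → ℝ≥0∞}
    (hG : Measurable (Function.uncurry G)) :
    ∫⁻ ω, (∫⁻ x, G ω x ∂μ) ^ 2 ∂P ≤ (∫⁻ x, (∫⁻ ω, G ω x ^ 2 ∂P) ^ (1 / 2 : ℝ) ∂μ) ^ 2 := by
  have hx : ∀ x, Measurable fun ω => G ω x := fun x => hG.comp measurable_prodMk_right
  have hω : ∀ ω, Measurable (G ω) := fun ω => hG.comp measurable_prodMk_left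
  have e1 : ∀ ω, (∫⁻ x, G ω x ∂μ) ^ 2 = ∫⁻ x, ∫⁻ y, G ω x * G ω y ∂μ ∂μ := by
    intro ω
    rw [sq, ← lintegral_mul_const _ (hω ω)]
    refine lintegral_congr fun x => ?_
    rw [lintegral_const_mul _ (hω ω)]
  have hm3 : Measurable fun p : Ω × X × X => G p.1 p.2.1 * G p.1 p.2.2 :=
    (hG.comp (measurable_fst.prodMk measurable_snd.fst)).mul
      (hG.comp (measurable_fst.prodMk measurable_snd.snd))
  have hsq : Measurable fun x => (∫⁻ ω, G ω x ^ 2 ∂P) ^ (1 / 2 : ℝ) := by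
    have : Measurable fun x => ∫⁻ ω, G ω x ^ 2 ∂P :=
      Measurable.lintegral_prod_left' (f := fun p : Ω × X => G p.1 p.2 ^ 2) (hG.pow_const 2)
    exact this.pow_const _
  calc ∫⁻ ω, (∫⁻ x, G ω x ∂μ) ^ 2 ∂P
      = ∫⁻ ω, ∫⁻ x, ∫⁻ y, G ω x * G ω y ∂μ ∂μ ∂P := lintegral_congr e1
    _ = ∫⁻ x, ∫⁻ ω, ∫⁻ y, G ω x * G ω y ∂μ ∂P ∂μ := by
        refine lintegral_lintegral_swap (Measurable.aemeasurable ?_)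
        have : Measurable fun q : (Ω × X) × X => G q.1.1 q.1.2 * G q.1.1 q.2 :=
          hm3.comp (measurable_fst.fst.prodMk (measurable_fst.snd.prodMk measurable_snd))
        exact this.lintegral_prod_right'
    _ = ∫⁻ x, ∫⁻ y, ∫⁻ ω, G ω x * G ω y ∂P ∂μ ∂μ := by
        refine lintegral_congr fun x => lintegral_lintegral_swap (Measurable.aemeasurable ?_)
        exact hm3.comp (measurable_fst.prodMk (measurable_const.prodMk measurable_snd))
    _ ≤ ∫⁻ x, ∫⁻ y, (∫⁻ ω, G ω x ^ 2 ∂P) ^ (1 / 2 : ℝ) * (∫⁻ ω, G ω y ^ 2 ∂P) ^ (1 / 2 : ℝ) ∂μ ∂μ := by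
        refine lintegral_mono fun x => lintegral_mono fun y => ?_
        have h := ENNReal.lintegral_mul_le_Lp_mul_Lq P Real.HolderConjugate.two_two
          (hx x).aemeasurable (hx y).aemeasurable
        simp only [ENNReal.rpow_two, Pi.mul_apply] at h
        exact h
    _ = (∫⁻ x, (∫⁻ ω, G ω x ^ 2 ∂P) ^ (1 / 2 : ℝ) ∂μ) ^ 2 := by
        rw [sq, ← lintegral_mul_const _ hsq]
        refine lintegral_congr fun x => ?_
        rw [lintegral_const_mul _ hsq]

theorem rpow_le_mul_exp {p y : ℝ} (hp : 0 < p) (hy : 0 ≤ y) : y ^ p ≤ p ^ p * Real.exp y := by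
  have h1 : y / p ≤ Real.exp (y / p) := by linarith [Real.add_one_le_exp (y / p)]
  have h2 := Real.rpow_le_rpow (by positivity) h1 hp.le
  rw [Real.div_rpow hy hp.le, ← Real.exp_mul, div_mul_cancel₀ _ hp.ne',
    div_le_iff₀ (by positivity)] at h2
  linarith

/-- The sub-Gaussian parameter is the exact variance, since parameters add over independent
coordinates. This gives exponential moments without identifying the law of the sum. -/
theorem hasSubgaussianMGF_gaussianSum {ι : Type*} (a : ι → ℝ) (s : Finset ι) :
    ProbabilityTheory.HasSubgaussianMGF (fun ω : ι → ℝ => ∑ n ∈ s, a n * ω n)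
      (∑ n ∈ s, ⟨a n ^ 2, sq_nonneg _⟩)
      (Measure.infinitePi fun _ : ι => ProbabilityTheory.gaussianReal 0 1) := by
  refine ProbabilityTheory.HasSubgaussianMGF.sum_of_iIndepFun
    (X := fun n (ω : ι → ℝ) => a n * ω n)
    (ProbabilityTheory.iIndepFun_infinitePi (X := fun n (y : ℝ) => a n * y) (by fun_prop)) ?_
  intro n _
  have h0 : ProbabilityTheory.HasSubgaussianMGF (fun y : ℝ => y) 1
      (ProbabilityTheory.gaussianReal 0 1) := by
    refine ⟨fun t => ProbabilityTheory.integrable_exp_mul_gaussianReal t, fun t => ?_⟩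
    rw [ProbabilityTheory.mgf_fun_id_gaussianReal]
    simp
  have h1 : ProbabilityTheory.HasSubgaussianMGF (fun ω : ι → ℝ => ω n) 1
      (Measure.infinitePi fun _ : ι => ProbabilityTheory.gaussianReal 0 1) := by
    refine ProbabilityTheory.HasSubgaussianMGF.of_map (X := fun y : ℝ => y)
      (Y := fun ω : ι → ℝ => ω n) (measurable_pi_apply n).aemeasurable ?_
    rw [Measure.infinitePi_map_eval]
    exact h0
  have h2 := h1.const_mul (a n)
  have h3 : (⟨a n ^ 2, sq_nonneg (a n)⟩ : ℝ≥0) * 1 = ⟨a n ^ 2, sq_nonneg (a n)⟩ := mul_one _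
  exact (congrArg (fun c => ProbabilityTheory.HasSubgaussianMGF (fun ω : ι → ℝ => a n * ω n) c
    (Measure.infinitePi fun _ : ι => ProbabilityTheory.gaussianReal 0 1)) h3).mp h2

theorem lintegral_exp_gaussianSum_le {ι : Type*} (a : ι → ℝ) (s : Finset ι) (t : ℝ) :
    ∫⁻ ω, ENNReal.ofReal (Real.exp (t * ∑ n ∈ s, a n * ω n))
      ∂(Measure.infinitePi fun _ : ι => ProbabilityTheory.gaussianReal 0 1) ≤
        ENNReal.ofReal (Real.exp ((∑ n ∈ s, a n ^ 2) * t ^ 2 / 2)) := by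
  have h := hasSubgaussianMGF_gaussianSum a s
  rw [← ofReal_integral_eq_lintegral_ofReal (h.integrable_exp_mul t)
    (Eventually.of_forall fun _ => (Real.exp_pos _).le)]
  refine ENNReal.ofReal_le_ofReal ((h.mgf_le t).trans (le_of_eq ?_))
  congr 3
  exact NNReal.coe_sum _ _

/-- After division by the standard deviation `r`, a power is dominated by exponentials with a
bounded expectation. The constant depends on `p` alone, so it is uniform in the partial sum and in
the point `x` at which the field is evaluated. -/
theorem exists_lintegral_rpow_gaussianSum_le (p : ℝ) (hp : 0 < p) :
    ∃ C : ℝ, 0 ≤ C ∧ ∀ {ι : Type} (a : ι → ℝ) (s : Finset ι),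
      ∫⁻ ω, ENNReal.ofReal (|∑ n ∈ s, a n * ω n| ^ p)
        ∂(Measure.infinitePi fun _ : ι => ProbabilityTheory.gaussianReal 0 1) ≤
          ENNReal.ofReal (C * (∑ n ∈ s, a n ^ 2) ^ (p / 2)) := by
  refine ⟨p ^ p * (2 * Real.exp (1 / 2)), by positivity, fun {ι} a s => ?_⟩
  set V := ∑ n ∈ s, a n ^ 2 with hV
  have hV0 : 0 ≤ V := Finset.sum_nonneg fun _ _ => sq_nonneg _
  -- Zero variance is treated apart because the rescaling divides by `r`; in that case the sum
  -- vanishes identically.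
  rcases hV0.eq_or_lt with h0 | hpos
  · have ha : ∀ n ∈ s, a n = 0 := by
      intro n hn
      have := (Finset.sum_eq_zero_iff_of_nonneg fun i _ => sq_nonneg (a i)).1 h0.symm n hn
      exact pow_eq_zero_iff (two_ne_zero) |>.1 this
    have : ∀ ω : ι → ℝ, ∑ n ∈ s, a n * ω n = 0 := fun ω =>
      Finset.sum_eq_zero fun n hn => by rw [ha n hn, zero_mul]
    simp [this, Real.zero_rpow hp.ne']
  · set r := Real.sqrt V with hr
    have hr0 : 0 < r := Real.sqrt_pos.2 hpos
    have hr2 : r ^ 2 = V := Real.sq_sqrt hV0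
    have hrp : r ^ p = V ^ (p / 2) := by
      rw [hr, Real.sqrt_eq_rpow, ← Real.rpow_mul hV0]
      congr 1
      ring
    have hb : ∀ y : ℝ, |y| ^ p ≤ r ^ p * p ^ p * (Real.exp (r⁻¹ * y) + Real.exp (-r⁻¹ * y)) := by
      intro y
      have h1 := rpow_le_mul_exp hp (y := |y| / r) (by positivity)
      rw [Real.div_rpow (abs_nonneg _) hr0.le, div_le_iff₀ (by positivity)] at h1
      have h2 : Real.exp (|y| / r) ≤ Real.exp (r⁻¹ * y) + Real.exp (-r⁻¹ * y) := by
        rcases abs_cases y with ⟨h, -⟩ | ⟨h, -⟩ <;> rw [h]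
        · have : y / r = r⁻¹ * y := by ring
          rw [this]
          linarith [Real.exp_pos (-r⁻¹ * y)]
        · have : -y / r = -r⁻¹ * y := by ring
          rw [this]
          linarith [Real.exp_pos (r⁻¹ * y)]
      calc |y| ^ p ≤ p ^ p * Real.exp (|y| / r) * r ^ p := h1
        _ ≤ p ^ p * (Real.exp (r⁻¹ * y) + Real.exp (-r⁻¹ * y)) * r ^ p := by gcongr
        _ = _ := by ring
    have he1 := lintegral_exp_gaussianSum_le a s r⁻¹
    have he2 := lintegral_exp_gaussianSum_le a s (-r⁻¹)
    rw [← hV, neg_sq] at he2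
    rw [← hV] at he1
    have hv : V * r⁻¹ ^ 2 / 2 = 1 / 2 := by
      rw [← hr2]; field_simp
    rw [hv] at he1 he2
    have hmeas : ∀ t : ℝ, Measurable fun ω : ι → ℝ =>
        ENNReal.ofReal (Real.exp (t * ∑ n ∈ s, a n * ω n)) := fun t => by fun_prop
    calc ∫⁻ ω, ENNReal.ofReal (|∑ n ∈ s, a n * ω n| ^ p)
          ∂(Measure.infinitePi fun _ : ι => ProbabilityTheory.gaussianReal 0 1)
        ≤ ∫⁻ ω, ENNReal.ofReal (r ^ p * p ^ p) *
            (ENNReal.ofReal (Real.exp (r⁻¹ * ∑ n ∈ s, a n * ω n)) +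
              ENNReal.ofReal (Real.exp (-r⁻¹ * ∑ n ∈ s, a n * ω n)))
          ∂(Measure.infinitePi fun _ : ι => ProbabilityTheory.gaussianReal 0 1) := by
          refine lintegral_mono fun ω => ?_
          rw [← ENNReal.ofReal_add (Real.exp_pos _).le (Real.exp_pos _).le,
            ← ENNReal.ofReal_mul (by positivity)]
          exact ENNReal.ofReal_le_ofReal (hb _)
      _ ≤ ENNReal.ofReal (r ^ p * p ^ p) *
          (ENNReal.ofReal (Real.exp (1 / 2)) + ENNReal.ofReal (Real.exp (1 / 2))) := by
          rw [lintegral_const_mul' _ _ ENNReal.ofReal_ne_top, lintegral_add_left (hmeas _)]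
          gcongr
      _ = _ := by
          rw [← ENNReal.ofReal_add (Real.exp_pos _).le (Real.exp_pos _).le,
            ← ENNReal.ofReal_mul (by positivity), hrp]
          congr 1
          ring


/-! ### Square integrability of the Gaussian field in the norms of `NiceDensity`. -/

/-- The integrand of `NiceDensity` at the measure `f² λ`, as a function of `t = f x`. -/
noncomputable def niceIntegrand (k θ : ℝ) (x : Rd d) (t : ℝ) : ℝ :=
  |t| + |t| ^ (2 * θ) + (1 + ‖x‖ ^ (2 * k)) * t ^ 2

theorem niceIntegrand_nonneg (k θ : ℝ) (x : Rd d) (t : ℝ) : 0 ≤ niceIntegrand k θ x t := by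
  unfold niceIntegrand; positivity

theorem measurable_niceIntegrand (k θ : ℝ) :
    Measurable fun p : Rd d × ℝ => niceIntegrand k θ p.1 p.2 := by
  have h : Measurable fun p : Rd d × ℝ => |p.2| := measurable_snd.abs
  unfold niceIntegrand
  fun_prop

theorem continuous_niceIntegrand (k : ℝ) {θ : ℝ} (hθ : 1 < θ) (x : Rd d) :
    Continuous (niceIntegrand k θ x) := by
  unfold niceIntegrand
  have : Continuous fun t : ℝ => |t| ^ (2 * θ) :=
    continuous_abs.rpow_const fun t => Or.inr (by linarith)
  fun_prop

/-- A finite partial sum of `gaussSeries`, as a function on `ℝᵈ`. -/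
noncomputable def partialField (k α d' : ℝ) (s : Finset (Fin d → ℕ)) (ω : (Fin d → ℕ) → ℝ)
    (x : Rd d) : ℝ := ∑ n ∈ s, (gaussCoef k α d' n * hermiteFnRd n x) * ω n

theorem measurable_partialField (k α d' : ℝ) (s : Finset (Fin d → ℕ)) :
    Measurable fun p : ((Fin d → ℕ) → ℝ) × Rd d => partialField k α d' s p.1 p.2 := by
  unfold partialField
  refine Finset.measurable_fun_sum _ fun n _ => ?_
  have h1 : Measurable fun p : ((Fin d → ℕ) → ℝ) × Rd d => hermiteFnRd n p.2 :=
    (continuous_hermiteFnRd n).measurable.comp measurable_snd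
  have h2 : Measurable fun p : ((Fin d → ℕ) → ℝ) × Rd d => p.1 n :=
    (measurable_pi_apply n).comp measurable_fst
  exact (h1.const_mul _).mul h2

/-- From `(a + b + c)² ≤ 3 (a² + b² + c²)`; the exponents `2`, `4θ` and `4` are the Gaussian moments
that will be inserted. -/
theorem ofReal_niceIntegrand_sq_le (k θ : ℝ) (x : Rd d) (t : ℝ) :
    ENNReal.ofReal (niceIntegrand k θ x t) ^ 2 ≤
      ENNReal.ofReal 3 * (ENNReal.ofReal (|t| ^ (2 : ℝ)) + ENNReal.ofReal (|t| ^ (4 * θ)) +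
        ENNReal.ofReal ((1 + ‖x‖ ^ (2 * k)) ^ 2) * ENNReal.ofReal (|t| ^ (4 : ℝ))) := by
  set W := 1 + ‖x‖ ^ (2 * k) with hW
  rw [← ENNReal.ofReal_pow (niceIntegrand_nonneg _ _ _ _), ← ENNReal.ofReal_mul (by positivity),
    ← ENNReal.ofReal_add (by positivity) (by positivity),
    ← ENNReal.ofReal_add (by positivity) (by positivity), ← ENNReal.ofReal_mul (by positivity)]
  refine ENNReal.ofReal_le_ofReal ?_
  have e1 : |t| ^ (2 : ℝ) = |t| ^ 2 := Real.rpow_natCast _ 2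
  have e2 : |t| ^ (4 * θ) = (|t| ^ (2 * θ)) ^ 2 := by
    rw [← Real.rpow_natCast, ← Real.rpow_mul (abs_nonneg _)]; congr 1; push_cast; ring
  have e3 : W ^ 2 * |t| ^ (4 : ℝ) = (W * t ^ 2) ^ 2 := by
    have : |t| ^ (4 : ℝ) = |t| ^ 4 := Real.rpow_natCast _ 4
    rw [this, show |t| ^ 4 = (|t| ^ 2) ^ 2 by ring, sq_abs]; ring
  rw [e1, e2, e3, niceIntegrand, ← hW]
  generalize |t| ^ (2 * θ) = b
  generalize W * t ^ 2 = c
  generalize |t| = a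
  nlinarith [sq_nonneg (a - b), sq_nonneg (a - c), sq_nonneg (b - c)]

/-- Reassembles the three moments into one perfect square, so that the `L²(P)` norm of the integrand
is linear in `V^(1/2) + V^θ + W V`, whose integral over `x` is already bounded. -/
theorem three_mul_moments_le {V W C1 C2 C3 : ℝ} (θ : ℝ) (hV : 0 ≤ V) (hW : 0 ≤ W) (hC1 : 0 ≤ C1)
    (hC2 : 0 ≤ C2) (hC3 : 0 ≤ C3) :
    3 * (C1 * V ^ (2 / 2 : ℝ) + C2 * V ^ (4 * θ / 2 : ℝ) + W ^ 2 * (C3 * V ^ (4 / 2 : ℝ))) ≤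
      (Real.sqrt (3 * (C1 + C2 + C3)) * (V ^ (1 / 2 : ℝ) + V ^ θ + W * V)) ^ 2 := by
  have e1 : V ^ (2 / 2 : ℝ) = (V ^ (1 / 2 : ℝ)) ^ 2 := by
    rw [← Real.rpow_natCast, ← Real.rpow_mul hV]; congr 1; push_cast; ring
  have e2 : V ^ (4 * θ / 2 : ℝ) = (V ^ θ) ^ 2 := by
    rw [← Real.rpow_natCast, ← Real.rpow_mul hV]; congr 1; push_cast; ring
  have e3 : V ^ (4 / 2 : ℝ) = V ^ 2 := by
    rw [← Real.rpow_natCast]; congr 1; norm_num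
  have ha : 0 ≤ V ^ (1 / 2 : ℝ) := by positivity
  have hb : 0 ≤ V ^ θ := by positivity
  have hc : 0 ≤ W * V := by positivity
  have e4 : W ^ 2 * (C3 * V ^ 2) = C3 * (W * V) ^ 2 := by ring
  rw [e1, e2, e3, e4, mul_pow (Real.sqrt _), Real.sq_sqrt (by positivity), mul_assoc]
  refine mul_le_mul_of_nonneg_left ?_ (by norm_num)
  generalize V ^ (1 / 2 : ℝ) = a at *
  generalize V ^ θ = b at *
  generalize W * V = c at *
  have l1 : a ^ 2 ≤ (a + b + c) ^ 2 := pow_le_pow_left₀ ha (by linarith) 2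
  have l2 : b ^ 2 ≤ (a + b + c) ^ 2 := pow_le_pow_left₀ hb (by linarith) 2
  have l3 : c ^ 2 ≤ (a + b + c) ^ 2 := pow_le_pow_left₀ hc (by linarith) 2
  rw [add_mul, add_mul]
  exact add_le_add (add_le_add (mul_le_mul_of_nonneg_left l1 hC1)
    (mul_le_mul_of_nonneg_left l2 hC2)) (mul_le_mul_of_nonneg_left l3 hC3)

theorem lintegral_niceIntegrand_sq_rpow_le {Ω : Type*} [MeasurableSpace Ω] {P : Measure Ω}
    (k θ : ℝ) (x : Rd d) {S : Ω → ℝ} (hS : Measurable S) {V C1 C2 C3 : ℝ} (hV : 0 ≤ V)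
    (hC1 : 0 ≤ C1) (hC2 : 0 ≤ C2) (hC3 : 0 ≤ C3)
    (g1 : ∫⁻ ω, ENNReal.ofReal (|S ω| ^ (2 : ℝ)) ∂P ≤ ENNReal.ofReal (C1 * V ^ (2 / 2 : ℝ)))
    (g2 : ∫⁻ ω, ENNReal.ofReal (|S ω| ^ (4 * θ)) ∂P ≤ ENNReal.ofReal (C2 * V ^ (4 * θ / 2 : ℝ)))
    (g3 : ∫⁻ ω, ENNReal.ofReal (|S ω| ^ (4 : ℝ)) ∂P ≤ ENNReal.ofReal (C3 * V ^ (4 / 2 : ℝ))) :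
    (∫⁻ ω, ENNReal.ofReal (niceIntegrand k θ x (S ω)) ^ 2 ∂P) ^ (1 / 2 : ℝ) ≤
      ENNReal.ofReal (Real.sqrt (3 * (C1 + C2 + C3)) *
        (V ^ (1 / 2 : ℝ) + V ^ θ + (1 + ‖x‖ ^ (2 * k)) * V)) := by
  have hW : 0 ≤ 1 + ‖x‖ ^ (2 * k) := by positivity
  have key := lintegral_mono (μ := P) fun ω => ofReal_niceIntegrand_sq_le k θ x (S ω)
  generalize 1 + ‖x‖ ^ (2 * k) = W at *
  have ha : Measurable fun ω => |S ω| := hS.abs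
  rw [lintegral_const_mul' _ _ ENNReal.ofReal_ne_top, lintegral_add_left (by fun_prop),
    lintegral_add_left (by fun_prop), lintegral_const_mul' _ _ ENNReal.ofReal_ne_top] at key
  have key2 : ∫⁻ ω, ENNReal.ofReal (niceIntegrand k θ x (S ω)) ^ 2 ∂P ≤
      ENNReal.ofReal 3 * (ENNReal.ofReal (C1 * V ^ (2 / 2 : ℝ)) +
        ENNReal.ofReal (C2 * V ^ (4 * θ / 2 : ℝ)) +
        ENNReal.ofReal (W ^ 2) * ENNReal.ofReal (C3 * V ^ (4 / 2 : ℝ))) :=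
    key.trans (mul_le_mul_right (add_le_add (add_le_add g1 g2) (mul_le_mul_right g3 _)) _)
  have n1 : 0 ≤ C1 * V ^ (2 / 2 : ℝ) := by positivity
  have n2 : 0 ≤ C2 * V ^ (4 * θ / 2 : ℝ) := by positivity
  have n3 : 0 ≤ C3 * V ^ (4 / 2 : ℝ) := by positivity
  rw [← ENNReal.ofReal_mul (sq_nonneg W), ← ENNReal.ofReal_add n1 n2,
    ← ENNReal.ofReal_add (add_nonneg n1 n2) (mul_nonneg (sq_nonneg W) n3),
    ← ENNReal.ofReal_mul (by norm_num)] at key2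
  have key3 := key2.trans
    (ENNReal.ofReal_le_ofReal (three_mul_moments_le θ hV hW hC1 hC2 hC3))
  refine (ENNReal.rpow_le_rpow key3 (by norm_num)).trans (le_of_eq ?_)
  have hn : 0 ≤ Real.sqrt (3 * (C1 + C2 + C3)) * (V ^ (1 / 2 : ℝ) + V ^ θ + W * V) := by positivity
  rw [ENNReal.ofReal_rpow_of_nonneg (sq_nonneg _) (by norm_num), ← Real.sqrt_eq_rpow,
    Real.sqrt_sq hn]

theorem exists_lintegral_niceIntegrand_sq_le (k : ℝ) {θ : ℝ} (hθ : 1 < θ) (α d' : ℝ) :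
    ∃ C : ℝ, 0 ≤ C ∧ ∀ (s : Finset (Fin d → ℕ)) (x : Rd d),
      (∫⁻ ω, ENNReal.ofReal (niceIntegrand k θ x (partialField k α d' s ω x)) ^ 2
        ∂(Measure.infinitePi fun _ : Fin d → ℕ => ProbabilityTheory.gaussianReal 0 1))
          ^ (1 / 2 : ℝ) ≤ ENNReal.ofReal (C * (gaussVar k α d' s x ^ (1 / 2 : ℝ) +
            gaussVar k α d' s x ^ θ + (1 + ‖x‖ ^ (2 * k)) * gaussVar k α d' s x)) := by
  obtain ⟨C1, hC1, h1⟩ := exists_lintegral_rpow_gaussianSum_le 2 (by norm_num)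
  obtain ⟨C2, hC2, h2⟩ := exists_lintegral_rpow_gaussianSum_le (4 * θ) (by linarith)
  obtain ⟨C3, hC3, h3⟩ := exists_lintegral_rpow_gaussianSum_le 4 (by norm_num)
  refine ⟨Real.sqrt (3 * (C1 + C2 + C3)), by positivity, fun s x => ?_⟩
  exact lintegral_niceIntegrand_sq_rpow_le k θ x
    ((measurable_partialField k α d' s).comp measurable_prodMk_right) (gaussVar_nonneg k α d' s x)
    hC1 hC2 hC3 (h1 (fun n => gaussCoef k α d' n * hermiteFnRd n x) s)
    (h2 (fun n => gaussCoef k α d' n * hermiteFnRd n x) s)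
    (h3 (fun n => gaussCoef k α d' n * hermiteFnRd n x) s)

/-- Minkowski's inequality moves the second moment inside the integral over `x`, where it is a
multiple of the variance expression bounded by `exists_lintegral_gaussVar_le`. -/
theorem exists_lintegral_partialField_le {k α d' θ : ℝ} (hd : 1 ≤ d) (hα : 0 < α)
    (hk : (d : ℝ) / 2 < k) (hd' : (d : ℝ) < d') (hθ : 1 < θ) :
    ∃ B : ℝ, ∀ s : Finset (Fin d → ℕ),
      ∫⁻ ω, (∫⁻ x, ENNReal.ofReal (niceIntegrand k θ x (partialField k α d' s ω x))) ^ 2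
        ∂(Measure.infinitePi fun _ : Fin d → ℕ => ProbabilityTheory.gaussianReal 0 1) ≤
          ENNReal.ofReal B := by
  obtain ⟨C, hC, h⟩ := exists_lintegral_niceIntegrand_sq_le (d := d) k hθ α d'
  obtain ⟨B, hB, hb⟩ := exists_lintegral_gaussVar_le hd hα hk hd' hθ
  refine ⟨(C * B) ^ 2, fun s => ?_⟩
  have hm : Measurable (Function.uncurry fun (ω : (Fin d → ℕ) → ℝ) (x : Rd d) =>
      ENNReal.ofReal (niceIntegrand k θ x (partialField k α d' s ω x))) :=
    ((measurable_niceIntegrand k θ).comp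
      (measurable_snd.prodMk (measurable_partialField k α d' s))).ennreal_ofReal
  refine (sq_lintegral_lintegral_le hm).trans ?_
  rw [ENNReal.ofReal_pow (by positivity)]
  gcongr
  refine (lintegral_mono fun x => h s x).trans ?_
  simp_rw [ENNReal.ofReal_mul hC]
  rw [lintegral_const_mul' _ _ ENNReal.ofReal_ne_top]
  gcongr
  exact hb s

/-- Fatou's lemma for `L²` convergence: a subsequence realizes the lower limit, and a further one
converges almost everywhere. -/
theorem lintegral_comp_le_liminf {X : Type*} [MeasurableSpace X] {μ : Measure X}
    {G : X → ℝ → ℝ≥0∞} (hG : Measurable fun p : X × ℝ => G p.1 p.2)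
    (hGc : ∀ x, Continuous (G x)) {f : ℕ → Lp ℝ 2 μ} {g : Lp ℝ 2 μ}
    (h : Tendsto f atTop (𝓝 g)) :
    ∫⁻ x, G x (g x) ∂μ ≤ liminf (fun n => ∫⁻ x, G x (f n x) ∂μ) atTop := by
  obtain ⟨φ, hφ1, hφ2⟩ := exists_seq_tendsto_liminf (f := atTop)
    (u := fun n => ∫⁻ x, G x (f n x) ∂μ)
  have h1 : Tendsto (fun n => f (φ n)) atTop (𝓝 g) := h.comp hφ2
  obtain ⟨ψ, hψ1, hψ2⟩ := (tendstoInMeasure_of_tendsto_Lp h1).exists_seq_tendsto_ae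
  have hm : ∀ n, AEMeasurable (fun x => G x (f n x)) μ := fun n =>
    hG.comp_aemeasurable (aemeasurable_id.prodMk (Lp.aestronglyMeasurable (f n)).aemeasurable)
  calc ∫⁻ x, G x (g x) ∂μ = ∫⁻ x, liminf (fun n => G x (f (φ (ψ n)) x)) atTop ∂μ := by
        refine lintegral_congr_ae ?_
        filter_upwards [hψ2] with x hx
        exact ((((hGc x).tendsto _).comp hx).liminf_eq).symm
    _ ≤ liminf (fun n => ∫⁻ x, G x (f (φ (ψ n)) x) ∂μ) atTop :=
        lintegral_liminf_le' fun n => hm _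
    _ = _ := (hφ1.comp hψ1.tendsto_atTop).liminf_eq

theorem coeFn_sum_smul_basisHk (k α d' : ℝ) (s : Finset (Fin d → ℕ)) (ω : (Fin d → ℕ) → ℝ) :
    (∑ n ∈ s, ((eigval α n) ^ (-(d' / 2)) * ω n) • basisHk k α n : HSp d) =ᵐ[volume]
      partialField k α d' s ω := by
  classical
  have hterm : ∀ n : Fin d → ℕ, (((eigval α n) ^ (-(d' / 2)) * ω n) • basisHk k α n : HSp d)
      =ᵐ[volume] fun x => (gaussCoef k α d' n * hermiteFnRd n x) * ω n := by
    intro n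
    rw [basisHk, smul_smul]
    filter_upwards [Lp.coeFn_smul ((eigval α n) ^ (-(d' / 2)) * ω n * (eigval α n) ^ (-(k / 2)))
      (hermiteH n), (memLp_hermiteFnRd n).coeFn_toLp] with x h1 h2
    rw [h1, Pi.smul_apply, hermiteH, h2, gaussCoef, smul_eq_mul]
    ring
  induction s using Finset.induction_on with
  | empty =>
    simp only [Finset.sum_empty]
    filter_upwards [Lp.coeFn_zero ℝ 2 (volume : Measure (Rd d))] with x hx
    simp [partialField]
  | insert n s hn ih =>
    rw [Finset.sum_insert hn]
    filter_upwards [Lp.coeFn_add (((eigval α n) ^ (-(d' / 2)) * ω n) • basisHk k α n : HSp d)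
      (∑ n ∈ s, ((eigval α n) ^ (-(d' / 2)) * ω n) • basisHk k α n), hterm n, ih] with x h1 h2 h3
    rw [h1, Pi.add_apply, h2, h3, partialField, partialField, Finset.sum_insert hn]

/-- Fatou's lemma is applied twice, in `x` for each path and then in `ω`, along a sequence of finite
index sets tending to `atTop`; the bound on the partial sums is uniform. -/
theorem lintegral_gaussSeries_lt_top {k α d' θ : ℝ} (hd : 1 ≤ d) (hα : 0 < α)
    (hk : (d : ℝ) / 2 < k) (hd' : (d : ℝ) < d') (hθ : 1 < θ) :
    ∫⁻ ω, (∫⁻ x, ENNReal.ofReal (niceIntegrand k θ x (gaussSeries d k α d' ω x))) ^ 2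
        ∂(Measure.infinitePi fun _ : Fin d → ℕ => ProbabilityTheory.gaussianReal 0 1) < ∞ := by
  obtain ⟨B, hB⟩ := exists_lintegral_partialField_le hd hα hk hd' hθ
  obtain ⟨t, ht⟩ := exists_seq_tendsto (atTop : Filter (Finset (Fin d → ℕ)))
  have hm : ∀ s, Measurable (Function.uncurry fun (ω : (Fin d → ℕ) → ℝ) (x : Rd d) =>
      ENNReal.ofReal (niceIntegrand k θ x (partialField k α d' s ω x))) := fun s =>
    ((measurable_niceIntegrand k θ).comp
      (measurable_snd.prodMk (measurable_partialField k α d' s))).ennreal_ofReal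
  have hpath : ∀ ω, (∫⁻ x, ENNReal.ofReal (niceIntegrand k θ x (gaussSeries d k α d' ω x))) ^ 2 ≤
      liminf (fun N => (∫⁻ x, ENNReal.ofReal
        (niceIntegrand k θ x (partialField k α d' (t N) ω x))) ^ 2) atTop := by
    intro ω
    by_cases hs : Summable fun n => ((eigval α n) ^ (-(d' / 2)) * ω n) • basisHk (d := d) k α n
    · have h1 : Tendsto (fun N => (∑ n ∈ t N, ((eigval α n) ^ (-(d' / 2)) * ω n) •
          basisHk k α n : HSp d)) atTop (𝓝 (gaussSeries d k α d' ω)) := hs.hasSum.comp ht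
      have h2 := lintegral_comp_le_liminf
        (G := fun (x : Rd d) t => ENNReal.ofReal (niceIntegrand k θ x t))
        (measurable_niceIntegrand k θ).ennreal_ofReal
        (fun x => ENNReal.continuous_ofReal.comp (continuous_niceIntegrand k hθ x)) h1
      have h3 : ∀ N, ∫⁻ x, ENNReal.ofReal (niceIntegrand k θ x
          ((∑ n ∈ t N, ((eigval α n) ^ (-(d' / 2)) * ω n) • basisHk k α n : HSp d) x)) =
          ∫⁻ x, ENNReal.ofReal (niceIntegrand k θ x (partialField k α d' (t N) ω x)) := by
        intro N
        refine lintegral_congr_ae ?_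
        filter_upwards [coeFn_sum_smul_basisHk k α d' (t N) ω] with x hx
        rw [hx]
      simp_rw [h3] at h2
      refine (pow_le_pow_left₀ zero_le h2 2).trans (le_of_eq ?_)
      exact Monotone.map_liminf_of_continuousAt (F := atTop) (f := fun z : ℝ≥0∞ => z ^ 2)
        (fun a b hab => pow_le_pow_left₀ zero_le hab 2) _ (ENNReal.continuous_pow 2).continuousAt
    -- On a path without convergence the series has the default value `0`, at which the integrand
    -- vanishes. Hence almost sure convergence is not required.
    · have h0 : gaussSeries d k α d' ω = 0 := tsum_eq_zero_of_not_summable hs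
      have : ∫⁻ x, ENNReal.ofReal (niceIntegrand k θ x (gaussSeries d k α d' ω x)) = 0 := by
        rw [h0, lintegral_congr_ae (g := fun _ => 0), lintegral_zero]
        filter_upwards [Lp.coeFn_zero ℝ 2 (volume : Measure (Rd d))] with x hx
        rw [hx]
        have : (2 * θ) ≠ 0 := by linarith
        simp [niceIntegrand, Real.zero_rpow this]
      rw [this]
      simp
  calc _ ≤ ∫⁻ ω, liminf (fun N => (∫⁻ x, ENNReal.ofReal
        (niceIntegrand k θ x (partialField k α d' (t N) ω x))) ^ 2) atTop
        ∂(Measure.infinitePi fun _ : Fin d → ℕ => ProbabilityTheory.gaussianReal 0 1) :=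
        lintegral_mono hpath
    _ ≤ liminf (fun N => ∫⁻ ω, (∫⁻ x, ENNReal.ofReal
        (niceIntegrand k θ x (partialField k α d' (t N) ω x))) ^ 2
        ∂(Measure.infinitePi fun _ : Fin d → ℕ => ProbabilityTheory.gaussianReal 0 1)) atTop := by
        refine lintegral_liminf_le fun N => ?_
        exact ((hm (t N)).lintegral_prod_right').pow_const 2
    _ ≤ liminf (fun _ : ℕ => ENNReal.ofReal B) atTop :=
        liminf_le_liminf (Eventually.of_forall fun N => hB (t N))
    _ < ∞ := by simp

/-- The quantity whose finiteness is `NiceDensity`. -/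
noncomputable def niceMass (k θ : ℝ) (μ : Mac d) : ℝ≥0∞ :=
  ∫⁻ x, ENNReal.ofReal (μ.dens x ^ (1 / 2 : ℝ) + μ.dens x ^ θ + (1 + ‖x‖ ^ (2 * k)) * μ.dens x)

theorem dens_Psi (f : HSp d) : (Psi f).dens =ᵐ[volume] fun x => f x ^ 2 := by
  have hm : AEMeasurable (fun x => ENNReal.ofReal (f x ^ 2)) (volume : Measure (Rd d)) :=
    ((Lp.aestronglyMeasurable f).aemeasurable.pow_const 2).ennreal_ofReal
  filter_upwards [Measure.rnDeriv_withDensity₀ volume hm] with x hx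
  change ((sqMeasure f).rnDeriv volume x).toReal = _
  rw [sqMeasure, hx, ENNReal.toReal_ofReal (sq_nonneg _)]

theorem niceMass_Psi (k θ : ℝ) (f : HSp d) :
    niceMass k θ (Psi f) = ∫⁻ x, ENNReal.ofReal (niceIntegrand k θ x (f x)) := by
  refine lintegral_congr_ae ?_
  filter_upwards [dens_Psi f] with x hx
  rw [hx, niceIntegrand, ← sq_abs (f x), ← Real.sqrt_eq_rpow, Real.sqrt_sq (abs_nonneg _),
    ← Real.rpow_natCast, ← Real.rpow_mul (abs_nonneg _)]
  push_cast
  rfl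

/-- `niceMass` is square integrable with respect to the image `Λ` of the Gaussian measure. -/
theorem lintegral_niceMass_sq_lt_top {k α d' θ : ℝ} (hd : 1 ≤ d) (hα : 0 < α)
    (hk : (d : ℝ) / 2 < k) (hd' : (d : ℝ) < d') (hθ : 1 < θ) :
    ∫⁻ μ, niceMass k θ μ ^ 2 ∂(refMeasure d k α d') < ∞ := by
  -- Only an upper bound is needed, and the integral over an image measure is at most the integral
  -- of the composition without any measurability of the map.
  refine ((lintegral_map_le (fun μ => niceMass k θ μ ^ 2) Psi).trans
    (lintegral_map_le (fun f => niceMass k θ (Psi f) ^ 2) (gaussSeries d k α d'))).trans_lt ?_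
  simp_rw [niceMass_Psi]
  exact lintegral_gaussSeries_lt_top hd hα hk hd' hθ

/-! ### Mollified truncated functionals and their extrinsic derivatives. -/

/-- A symmetric mollifier on `ℝᵈ`. -/
structure IsMollifier (ρ : Rd d → ℝ) : Prop where
  continuous : Continuous ρ
  hasCompactSupport : HasCompactSupport ρ
  nonneg : ∀ x, 0 ≤ ρ x
  even : ∀ x, ρ (-x) = ρ x
  integral_eq_one : ∫ x, ρ x = 1

/-- The density `x ↦ ∫ ρ(x - y) μ(dy)` of the convolution of `μ` with `ρ`. -/
noncomputable def mollify (ρ : Rd d → ℝ) (μ : Measure (Rd d)) (x : Rd d) : ℝ := ∫ y, ρ (x - y) ∂μ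

namespace IsMollifier

variable {ρ : Rd d → ℝ} (h : IsMollifier ρ)

include h

theorem exists_bound : ∃ C, ∀ x, ‖ρ x‖ ≤ C := h.hasCompactSupport.exists_bound_of_continuous
  h.continuous

theorem continuous_sub (x : Rd d) : Continuous fun y => ρ (x - y) :=
  h.continuous.comp (continuous_const.sub continuous_id)

theorem integrable_comp_sub (μ : Measure (Rd d)) [IsFiniteMeasure μ] (x : Rd d) :
    Integrable (fun y => ρ (x - y)) μ := by
  obtain ⟨C, hC⟩ := h.exists_bound
  exact Integrable.of_bound (h.continuous_sub x).aestronglyMeasurable C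
    (Eventually.of_forall fun y => hC _)

theorem mollify_nonneg (μ : Measure (Rd d)) (x : Rd d) : 0 ≤ mollify ρ μ x :=
  integral_nonneg fun _ => h.nonneg _

theorem integrable : Integrable ρ :=
  h.continuous.integrable_of_hasCompactSupport h.hasCompactSupport

theorem integral_comp_sub_right (y : Rd d) : ∫ x, ρ (x - y) = 1 := by
  rw [integral_sub_right_eq_self ρ y, h.integral_eq_one]

/-- For fixed `x₀` this is weak convergence tested on `ρ(x₀ - ·)`. Moving `x` costs the uniform
modulus of continuity of `ρ` times the total mass, which is locally bounded in the weak topology. -/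
theorem continuous_mollify :
    Continuous fun p : FiniteMeasure (Rd d) × Rd d => mollify ρ (p.1 : Measure (Rd d)) p.2 := by
  rw [continuous_iff_continuousAt]
  rintro ⟨μ₀, x₀⟩
  obtain ⟨C, hC⟩ := h.exists_bound
  have h1 : Tendsto (fun p : FiniteMeasure (Rd d) × Rd d => mollify ρ (p.1 : Measure (Rd d)) x₀)
      (𝓝 (μ₀, x₀)) (𝓝 (mollify ρ (μ₀ : Measure (Rd d)) x₀)) := by
    have := (FiniteMeasure.tendsto_iff_forall_integral_tendsto.1 (continuous_fst.tendsto (μ₀, x₀)))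
      (BoundedContinuousFunction.ofNormedAddCommGroup (fun y => ρ (x₀ - y)) (h.continuous_sub x₀) C
        fun y => hC _)
    exact this
  have h2 : Tendsto (fun p : FiniteMeasure (Rd d) × Rd d =>
      mollify ρ (p.1 : Measure (Rd d)) p.2 - mollify ρ (p.1 : Measure (Rd d)) x₀)
      (𝓝 (μ₀, x₀)) (𝓝 0) := by
    rw [Metric.tendsto_nhds]
    intro ε hε
    have hm : ∀ᶠ p : FiniteMeasure (Rd d) × Rd d in 𝓝 (μ₀, x₀), (p.1.mass : ℝ) < μ₀.mass + 1 := by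
      have : Continuous fun p : FiniteMeasure (Rd d) × Rd d => (p.1.mass : ℝ) := by fun_prop
      exact (this.tendsto (μ₀, x₀)).eventually_lt_const (by simp)
    have hpos : (0 : ℝ) < μ₀.mass + 1 := by positivity
    obtain ⟨δ, hδ, hu⟩ := Metric.uniformContinuous_iff.1
      (h.hasCompactSupport.uniformContinuous_of_continuous h.continuous)
      (ε / (μ₀.mass + 1)) (by positivity)
    have hd : ∀ᶠ p : FiniteMeasure (Rd d) × Rd d in 𝓝 (μ₀, x₀), dist p.2 x₀ < δ :=
      (continuous_snd.tendsto (μ₀, x₀)).eventually (Metric.ball_mem_nhds x₀ hδ)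
    filter_upwards [hm, hd] with p hp1 hp2
    rw [dist_zero_right, mollify, mollify, ← integral_sub (h.integrable_comp_sub _ _)
      (h.integrable_comp_sub _ _)]
    have hb : ∀ y, ‖ρ (p.2 - y) - ρ (x₀ - y)‖ ≤ ε / (μ₀.mass + 1) := by
      intro y
      have := hu (a := p.2 - y) (b := x₀ - y) (by simpa using hp2)
      rw [dist_eq_norm] at this
      exact this.le
    have h3 := norm_integral_le_of_norm_le_const (μ := (p.1 : Measure (Rd d)))
      (Eventually.of_forall hb)
    refine h3.trans_lt ?_
    have e : (p.1 : Measure (Rd d)).real univ = p.1.mass := rfl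
    rw [e]
    calc ε / (μ₀.mass + 1) * p.1.mass < ε / (μ₀.mass + 1) * (μ₀.mass + 1) := by gcongr
      _ = ε := by field_simp
  have := h2.add h1
  simp only [sub_add_cancel, zero_add] at this
  exact this

end IsMollifier

theorem continuous_integral_of_bound {g : Rd d → ℝ} (hg : Continuous g) {C : ℝ}
    (hC : ∀ x, |g x| ≤ C) :
    Continuous fun μ : FiniteMeasure (Rd d) => ∫ x, g x ∂(μ : Measure (Rd d)) := by
  exact FiniteMeasure.continuous_integral_boundedContinuousFunction
      (BoundedContinuousFunction.ofNormedAddCommGroup g hg C hC)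

/-- The data of a truncated functional `μ ↦ ψ(μ(1)) (∫ χ Q(h_μ) dλ + μ(g))`. -/
structure TruncatedFunctional (d : ℕ) where
  χ : Rd d → ℝ
  g : Rd d → ℝ
  Q : ℝ → ℝ
  Q' : ℝ → ℝ
  ψ : ℝ → ℝ
  ψ' : ℝ → ℝ
  M : ℝ
  B : ℝ
  hM : 0 ≤ M
  hB : 0 ≤ B
  continuous_χ : Continuous χ
  hasCompactSupport_χ : HasCompactSupport χ
  abs_χ_le : ∀ x, |χ x| ≤ 1
  continuous_g : Continuous g
  abs_g_le : ∀ x, |g x| ≤ M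
  hasDeriv_Q : ∀ s, 0 ≤ s → HasDerivWithinAt Q (Q' s) (Ici 0) s
  continuousOn_Q' : ContinuousOn Q' (Ici 0)
  abs_Q_le : ∀ s, 0 ≤ s → |Q s| ≤ M
  abs_Q'_le : ∀ s, 0 ≤ s → |Q' s| ≤ M
  hasDeriv_ψ : ∀ t, HasDerivAt ψ (ψ' t) t
  continuous_ψ' : Continuous ψ'
  abs_ψ_le : ∀ t, |ψ t| ≤ M
  abs_ψ'_le : ∀ t, |ψ' t| ≤ M
  ψ_eq_zero : ∀ t, B ≤ t → ψ t = 0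
  ψ'_eq_zero : ∀ t, B ≤ t → ψ' t = 0

namespace TruncatedFunctional

variable (T : TruncatedFunctional d) (ρ : Rd d → ℝ)

/-- The mollified functional without the truncation of the mass. -/
noncomputable def inner (μ : FiniteMeasure (Rd d)) : ℝ :=
  (∫ x, T.χ x * T.Q (mollify ρ (μ : Measure (Rd d)) x)) + ∫ x, T.g x ∂(μ : Measure (Rd d))

/-- The extrinsic derivative of `T.inner ρ`. -/
noncomputable def innerDeriv (μ : FiniteMeasure (Rd d)) (y : Rd d) : ℝ :=
  (∫ x, T.χ x * T.Q' (mollify ρ (μ : Measure (Rd d)) x) * ρ (x - y)) + T.g y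

/-- The mollified truncated functional. -/
noncomputable def fn (μ : FiniteMeasure (Rd d)) : ℝ := T.ψ μ.mass * T.inner ρ μ

/-- The extrinsic derivative of `T.fn ρ`. -/
noncomputable def fnDeriv (μ : FiniteMeasure (Rd d)) (y : Rd d) : ℝ :=
  T.ψ' μ.mass * T.inner ρ μ + T.ψ μ.mass * T.innerDeriv ρ μ y

theorem continuousOn_Q : ContinuousOn T.Q (Ici 0) := fun s hs =>
  (T.hasDeriv_Q s hs).continuousWithinAt

theorem continuous_ψ : Continuous T.ψ :=
  continuous_iff_continuousAt.2 fun t => (T.hasDeriv_ψ t).continuousAt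

/-- An upper bound of `∫ |χ| dλ`. -/
noncomputable def mass : ℝ := ∫ x, |T.χ x|

theorem mass_nonneg : 0 ≤ T.mass := integral_nonneg fun _ => abs_nonneg _

theorem integrable_χ : Integrable T.χ :=
  T.continuous_χ.integrable_of_hasCompactSupport T.hasCompactSupport_χ

variable {ρ} (h : IsMollifier ρ)

include h

theorem continuous_inner : Continuous (T.inner ρ) := by
  have hg := continuous_integral_of_bound T.continuous_g T.abs_g_le
  have hc : Continuous fun p : FiniteMeasure (Rd d) × Rd d =>
      T.χ p.2 * T.Q (mollify ρ (p.1 : Measure (Rd d)) p.2) :=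
    (T.continuous_χ.comp continuous_snd).mul (T.continuousOn_Q.comp_continuous h.continuous_mollify
      fun p => h.mollify_nonneg _ _)
  have := continuousOn_integral_of_compact_support (μ := (volume : Measure (Rd d)))
    (f := fun (μ : FiniteMeasure (Rd d)) x => T.χ x * T.Q (mollify ρ (μ : Measure (Rd d)) x))
    (s := univ) T.hasCompactSupport_χ.isCompact hc.continuousOn
    (fun μ x _ hx => by rw [image_eq_zero_of_notMem_tsupport hx, zero_mul])
  exact (continuousOn_univ.1 this).add hg

theorem continuous_innerDeriv :
    Continuous fun p : FiniteMeasure (Rd d) × Rd d => T.innerDeriv ρ p.1 p.2 := by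
  have hg : Continuous fun p : FiniteMeasure (Rd d) × Rd d => T.g p.2 :=
    T.continuous_g.comp continuous_snd
  have hc : Continuous fun p : (FiniteMeasure (Rd d) × Rd d) × Rd d =>
      T.χ p.2 * T.Q' (mollify ρ (p.1.1 : Measure (Rd d)) p.2) * ρ (p.2 - p.1.2) := by
    have h1 : Continuous fun p : (FiniteMeasure (Rd d) × Rd d) × Rd d =>
        T.Q' (mollify ρ (p.1.1 : Measure (Rd d)) p.2) :=
      T.continuousOn_Q'.comp_continuous (h.continuous_mollify.comp
        ((continuous_fst.comp continuous_fst).prodMk continuous_snd)) fun p => h.mollify_nonneg _ _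
    exact ((T.continuous_χ.comp continuous_snd).mul h1).mul
      (h.continuous.comp (continuous_snd.sub (continuous_snd.comp continuous_fst)))
  have := continuousOn_integral_of_compact_support (μ := (volume : Measure (Rd d)))
    (f := fun (p : FiniteMeasure (Rd d) × Rd d) x =>
      T.χ x * T.Q' (mollify ρ (p.1 : Measure (Rd d)) x) * ρ (x - p.2))
    (s := univ) T.hasCompactSupport_χ.isCompact hc.continuousOn
    (fun μ x _ hx => by rw [image_eq_zero_of_notMem_tsupport hx, zero_mul, zero_mul])
  exact (continuousOn_univ.1 this).add hg

theorem continuous_fn : Continuous (T.fn ρ) :=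
  (T.continuous_ψ.comp (by fun_prop)).mul (T.continuous_inner h)

theorem continuous_fnDeriv :
    Continuous fun p : FiniteMeasure (Rd d) × Rd d => T.fnDeriv ρ p.1 p.2 :=
  ((T.continuous_ψ'.comp (by fun_prop)).mul ((T.continuous_inner h).comp continuous_fst)).add
    ((T.continuous_ψ.comp (by fun_prop)).mul (T.continuous_innerDeriv h))

theorem abs_inner_le (μ : FiniteMeasure (Rd d)) :
    |T.inner ρ μ| ≤ T.M * T.mass + T.M * μ.mass := by
  rw [inner]
  refine (abs_add_le _ _).trans (add_le_add ?_ ?_)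
  · rw [mass, ← integral_const_mul, ← Real.norm_eq_abs]
    refine norm_integral_le_of_norm_le (T.integrable_χ.abs.const_mul _)
      (Eventually.of_forall fun x => ?_)
    rw [Real.norm_eq_abs, abs_mul, mul_comm]
    exact mul_le_mul_of_nonneg_right (T.abs_Q_le _ (h.mollify_nonneg _ _)) (abs_nonneg _)
  · exact norm_integral_le_of_norm_le_const (f := T.g) (Eventually.of_forall T.abs_g_le)

/-- Since `ρ` has integral one, the bound does not depend on the mollifier; this provides domination
when the mollifier is removed. -/
theorem abs_innerDeriv_le (μ : FiniteMeasure (Rd d)) (y : Rd d) :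
    |T.innerDeriv ρ μ y| ≤ 2 * T.M := by
  have h1 : |∫ x, T.χ x * T.Q' (mollify ρ (μ : Measure (Rd d)) x) * ρ (x - y)| ≤ T.M := by
    have e : T.M = ∫ x, T.M * ρ (x - y) := by
      rw [integral_const_mul, h.integral_comp_sub_right, mul_one]
    rw [e, ← Real.norm_eq_abs]
    refine norm_integral_le_of_norm_le ((h.integrable.comp_sub_right y).const_mul _)
      (Eventually.of_forall fun x => ?_)
    rw [Real.norm_eq_abs, abs_mul, abs_mul, abs_of_nonneg (h.nonneg _)]
    refine mul_le_mul_of_nonneg_right ?_ (h.nonneg _)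
    calc |T.χ x| * |T.Q' (mollify ρ (μ : Measure (Rd d)) x)| ≤ 1 * T.M := by
          refine mul_le_mul (T.abs_χ_le x) (T.abs_Q'_le _ (h.mollify_nonneg _ _)) (abs_nonneg _)
            zero_le_one
      _ = T.M := one_mul _
  rw [innerDeriv]
  exact (abs_add_le _ _).trans (by linarith [T.abs_g_le y])

/-- A bound of `T.fn ρ`, uniform in the mollifier. -/
theorem abs_fn_le (μ : FiniteMeasure (Rd d)) :
    |T.fn ρ μ| ≤ T.M * (T.M * T.mass + T.M * T.B) := by
  have hM := T.hM
  have hB := T.hB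
  have hm := T.mass_nonneg
  rw [fn]
  rcases le_or_gt T.B μ.mass with hb | hb
  · rw [T.ψ_eq_zero _ hb, zero_mul, abs_zero]; positivity
  · rw [abs_mul]
    refine mul_le_mul (T.abs_ψ_le _) ((T.abs_inner_le h μ).trans ?_) (abs_nonneg _) T.hM
    gcongr

theorem abs_fnDeriv_le (μ : FiniteMeasure (Rd d)) (y : Rd d) :
    |T.fnDeriv ρ μ y| ≤ T.M * (T.M * T.mass + T.M * T.B) + T.M * (2 * T.M) := by
  have hM := T.hM
  have hB := T.hB
  have hm := T.mass_nonneg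
  rw [fnDeriv]
  rcases le_or_gt T.B μ.mass with hb | hb
  · rw [T.ψ_eq_zero _ hb, T.ψ'_eq_zero _ hb, zero_mul, zero_mul, add_zero, abs_zero]; positivity
  · refine (abs_add_le _ _).trans (add_le_add ?_ ?_)
    · rw [abs_mul]
      refine mul_le_mul (T.abs_ψ'_le _) ((T.abs_inner_le h μ).trans ?_) (abs_nonneg _) T.hM
      gcongr
    · rw [abs_mul]
      exact mul_le_mul (T.abs_ψ_le _) (T.abs_innerDeriv_le h μ y) (abs_nonneg _) T.hM

omit h in
theorem fnDeriv_eq_zero {μ : FiniteMeasure (Rd d)} (hμ : T.B ≤ μ.mass) (y : Rd d) :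
    T.fnDeriv ρ μ y = 0 := by
  rw [fnDeriv, T.ψ_eq_zero _ hμ, T.ψ'_eq_zero _ hμ, zero_mul, zero_mul, add_zero]

omit h in
theorem abs_Q_sub_le {s t : ℝ} (hs : 0 ≤ s) (ht : 0 ≤ t) : |T.Q t - T.Q s| ≤ T.M * |t - s| :=
  Convex.norm_image_sub_le_of_norm_hasDerivWithin_le (s := Ici 0) (fun x hx => T.hasDeriv_Q x hx)
    (fun x hx => T.abs_Q'_le x hx) (convex_Ici 0) hs ht

theorem mollify_add_smul_dirac (μ : FiniteMeasure (Rd d)) (y x : Rd d) {ε : ℝ} (hε : 0 ≤ ε) :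
    mollify ρ ((μ + ε.toNNReal • diracFM y : FiniteMeasure (Rd d)) : Measure (Rd d)) x =
      mollify ρ (μ : Measure (Rd d)) x + ε * ρ (x - y) := by
  have e : ((μ + ε.toNNReal • diracFM y : FiniteMeasure (Rd d)) : Measure (Rd d)) =
      (μ : Measure (Rd d)) + ε.toNNReal • Measure.dirac y := rfl
  rw [mollify, e, integral_add_measure (h.integrable_comp_sub _ _) (h.integrable_comp_sub _ _),
    integral_smul_nnreal_measure, integral_dirac, NNReal.smul_def, Real.coe_toNNReal _ hε,
    smul_eq_mul, mollify]

omit h in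
theorem mass_add_smul_dirac (μ : FiniteMeasure (Rd d)) (y : Rd d) {ε : ℝ} (hε : 0 ≤ ε) :
    ((μ + ε.toNNReal • diracFM y : FiniteMeasure (Rd d)).mass : ℝ) = μ.mass + ε := by
  have e : (diracFM y).mass = 1 := by
    have : ((diracFM y).mass : ℝ≥0∞) = 1 := by
      rw [FiniteMeasure.ennreal_mass]
      exact measure_univ (μ := Measure.dirac y)
    exact_mod_cast this
  have e2 : (μ + ε.toNNReal • diracFM y : FiniteMeasure (Rd d)).mass =
      μ.mass + ε.toNNReal * (diracFM y).mass := by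
    simp only [FiniteMeasure.mass, FiniteMeasure.coeFn_add, FiniteMeasure.coeFn_smul, Pi.add_apply,
      Pi.smul_apply, smul_eq_mul]
  rw [e2, e]
  push_cast
  rw [Real.coe_toNNReal _ hε, mul_one]

/-- Adding `ε δ_y` to `μ` adds `ε ρ(x - y)` to the mollified density, so this is differentiation
under the integral. The Lipschitz bound on `Q` dominates the difference quotients. -/
theorem tendsto_inner_slope (μ : FiniteMeasure (Rd d)) (y : Rd d) :
    Tendsto (fun ε : ℝ => (T.inner ρ (μ + ε.toNNReal • diracFM y) - T.inner ρ μ) / ε) (𝓝[>] 0)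
      (𝓝 (T.innerDeriv ρ μ y)) := by
  obtain ⟨C, hC⟩ := h.exists_bound
  have hM := T.hM
  have hmc : Continuous fun x => mollify ρ (μ : Measure (Rd d)) x :=
    h.continuous_mollify.comp (continuous_const.prodMk continuous_id)
  have hsc : Continuous fun x => ρ (x - y) := h.continuous.comp (continuous_id.sub continuous_const)
  have hnn : ∀ ε : ℝ, 0 < ε → ∀ x, 0 ≤ mollify ρ (μ : Measure (Rd d)) x + ε * ρ (x - y) :=
    fun ε hε x => add_nonneg (h.mollify_nonneg _ _) (mul_nonneg hε.le (h.nonneg _))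
  have hcQ : ∀ ε : ℝ, 0 < ε →
      Continuous fun x => T.χ x * T.Q (mollify ρ (μ : Measure (Rd d)) x + ε * ρ (x - y)) :=
    fun ε hε => T.continuous_χ.mul (T.continuousOn_Q.comp_continuous
      (hmc.add (continuous_const.mul hsc)) (hnn ε hε))
  have hcQ0 : Continuous fun x => T.χ x * T.Q (mollify ρ (μ : Measure (Rd d)) x) :=
    T.continuous_χ.mul (T.continuousOn_Q.comp_continuous hmc fun x => h.mollify_nonneg _ _)
  have hint : ∀ ε : ℝ, 0 < ε →
      Integrable fun x => T.χ x * T.Q (mollify ρ (μ : Measure (Rd d)) x + ε * ρ (x - y)) :=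
    fun ε hε => (hcQ ε hε).integrable_of_hasCompactSupport T.hasCompactSupport_χ.mul_right
  have hint0 : Integrable fun x => T.χ x * T.Q (mollify ρ (μ : Measure (Rd d)) x) :=
    hcQ0.integrable_of_hasCompactSupport T.hasCompactSupport_χ.mul_right
  have hlim : Tendsto (fun ε : ℝ => ∫ x, T.χ x * ((T.Q (mollify ρ (μ : Measure (Rd d)) x +
      ε * ρ (x - y)) - T.Q (mollify ρ (μ : Measure (Rd d)) x)) / ε)) (𝓝[>] 0)
      (𝓝 (∫ x, T.χ x * T.Q' (mollify ρ (μ : Measure (Rd d)) x) * ρ (x - y))) := by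
    refine tendsto_integral_filter_of_dominated_convergence (fun x => |T.χ x| * (T.M * C)) ?_ ?_
      (T.integrable_χ.abs.mul_const _) (Eventually.of_forall fun x => ?_)
    · filter_upwards [self_mem_nhdsWithin] with ε hε
      have : (fun x => T.χ x * ((T.Q (mollify ρ (μ : Measure (Rd d)) x +
          ε * ρ (x - y)) - T.Q (mollify ρ (μ : Measure (Rd d)) x)) / ε)) = fun x =>
          (T.χ x * T.Q (mollify ρ (μ : Measure (Rd d)) x + ε * ρ (x - y)) -
            T.χ x * T.Q (mollify ρ (μ : Measure (Rd d)) x)) / ε := by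
        funext x; ring
      rw [this]
      exact (((hcQ ε hε).sub hcQ0).div_const ε).aestronglyMeasurable
    · filter_upwards [self_mem_nhdsWithin] with ε (hε : 0 < ε)
      refine Eventually.of_forall fun x => ?_
      rw [norm_mul, Real.norm_eq_abs, Real.norm_eq_abs, abs_div, abs_of_pos hε]
      refine mul_le_mul_of_nonneg_left ?_ (abs_nonneg _)
      rw [div_le_iff₀ hε]
      refine (T.abs_Q_sub_le (h.mollify_nonneg _ _) (hnn ε hε x)).trans ?_
      rw [add_sub_cancel_left, abs_mul, abs_of_pos hε]
      have := hC (x - y)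
      rw [Real.norm_eq_abs] at this
      calc T.M * (ε * |ρ (x - y)|) ≤ T.M * (ε * C) := by gcongr
        _ = T.M * C * ε := by ring
    · rw [mul_assoc]
      refine Tendsto.const_mul _ ?_
      set a := mollify ρ (μ : Measure (Rd d)) x with ha
      have ha0 : 0 ≤ a := h.mollify_nonneg _ _
      have hr : 0 ≤ ρ (x - y) := h.nonneg _
      -- `Q` is only known to be differentiable within `[0, ∞)`, and the mollified density may
      -- vanish, so the chain rule is used within that half line.
      have hin : HasDerivWithinAt (fun ε : ℝ => a + ε * ρ (x - y)) (ρ (x - y)) (Ici 0) 0 := by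
        have := (((hasDerivAt_id (0 : ℝ)).mul_const (ρ (x - y))).const_add a).hasDerivWithinAt
          (s := Ici 0)
        simpa using this
      have hQ : HasDerivWithinAt T.Q (T.Q' a) (Ici 0) (a + 0 * ρ (x - y)) := by
        simpa using T.hasDeriv_Q a ha0
      have hcomp := HasDerivWithinAt.comp (0 : ℝ) hQ hin (fun ε (hε : 0 ≤ ε) =>
        (by positivity : 0 ≤ a + ε * ρ (x - y)))
      have hsl := hasDerivWithinAt_iff_tendsto_slope.1 hcomp
      have hset : Ici (0 : ℝ) \ {0} = Ioi 0 := by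
        ext t; simp [lt_iff_le_and_ne, eq_comm]
      rw [hset] at hsl
      refine hsl.congr fun ε => ?_
      simp [slope_def_field]
  refine (hlim.add_const (T.g y)).congr' ?_
  filter_upwards [self_mem_nhdsWithin] with ε (hε : 0 < ε)
  have e : ((μ + ε.toNNReal • diracFM y : FiniteMeasure (Rd d)) : Measure (Rd d)) =
      (μ : Measure (Rd d)) + ε.toNNReal • Measure.dirac y := rfl
  have hgi : ∀ ν : Measure (Rd d), IsFiniteMeasure ν → Integrable T.g ν := fun ν _ =>
    Integrable.of_bound T.continuous_g.aestronglyMeasurable T.M (Eventually.of_forall T.abs_g_le)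
  rw [inner, inner]
  simp_rw [mollify_add_smul_dirac h μ y _ hε.le]
  rw [e, integral_add_measure (hgi _ inferInstance) (hgi _ inferInstance),
    integral_smul_nnreal_measure, integral_dirac, NNReal.smul_def, Real.coe_toNNReal _ hε.le,
    smul_eq_mul]
  have e2 : ∀ x, T.χ x * ((T.Q (mollify ρ (μ : Measure (Rd d)) x +
      ε * ρ (x - y)) - T.Q (mollify ρ (μ : Measure (Rd d)) x)) / ε) =
      (T.χ x * T.Q (mollify ρ (μ : Measure (Rd d)) x + ε * ρ (x - y)) -
        T.χ x * T.Q (mollify ρ (μ : Measure (Rd d)) x)) / ε := fun x => by ring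
  simp_rw [e2]
  rw [integral_div, integral_sub (hint ε hε) hint0]
  field_simp
  ring

theorem isCbE12 : IsCbE12 (T.fn ρ) (T.fnDeriv ρ) where
  continuous := T.continuous_fn h
  hasExtrinsicDeriv := by
    intro μ y
    have h1 := T.tendsto_inner_slope h μ y
    have hψ : Tendsto (fun ε : ℝ => (T.ψ (μ.mass + ε) - T.ψ μ.mass) / ε) (𝓝[>] 0)
        (𝓝 (T.ψ' μ.mass)) := by
      have := (T.hasDeriv_ψ μ.mass).tendsto_slope_zero_right
      refine this.congr fun ε => ?_
      rw [smul_eq_mul]; ring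
    have hψ2 : Tendsto (fun ε : ℝ => T.ψ (μ.mass + ε)) (𝓝[>] 0) (𝓝 (T.ψ μ.mass)) := by
      have hc : Continuous fun ε : ℝ => T.ψ (μ.mass + ε) := T.continuous_ψ.comp (by fun_prop)
      have := (hc.tendsto 0).mono_left (nhdsWithin_le_nhds (s := Ioi 0))
      simpa using this
    have h2 := (hψ.mul_const (T.inner ρ μ)).add (hψ2.mul h1)
    refine h2.congr' ?_
    filter_upwards [self_mem_nhdsWithin] with ε (hε : 0 < ε)
    rw [fn, fn, mass_add_smul_dirac μ y hε.le]
    field_simp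
    ring
  continuous_deriv := T.continuous_fnDeriv h
  bounded := ⟨_, fun μ x => add_le_add (T.abs_fn_le h μ) (T.abs_fnDeriv_le h μ x)⟩
  bounded_L2 := by
    set K := T.M * (T.M * T.mass + T.M * T.B) + T.M * (2 * T.M) with hK
    have hK0 : 0 ≤ K := by
      have hM := T.hM
      have hB := T.hB
      have hm := T.mass_nonneg
      positivity
    -- The derivative vanishes when the mass is at least `B`; otherwise it is bounded by `K` on a
    -- space of mass at most `B`.
    refine ⟨T.B.toNNReal ^ (1 / 2 : ℝ) * K.toNNReal, fun μ => ?_⟩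
    rcases le_or_gt T.B μ.toFM.mass with hb | hb
    · have : T.fnDeriv ρ μ.toFM = 0 := funext fun y => T.fnDeriv_eq_zero hb y
      rw [this, eLpNorm_zero]
      exact zero_le
    · have h1 := eLpNorm_le_of_ae_bound (p := 2) (μ := μ.toM) (f := T.fnDeriv ρ μ.toFM) (C := K)
        (Eventually.of_forall fun y => T.abs_fnDeriv_le h μ.toFM y)
      refine h1.trans ?_
      push_cast
      have hm : μ.toM univ ≤ (T.B.toNNReal : ℝ≥0∞) := by
        have e : μ.toM univ = (μ.toFM.mass : ℝ≥0∞) := FiniteMeasure.ennreal_mass.symm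
        rw [e]
        refine ENNReal.coe_le_coe.2 ?_
        rw [Real.le_toNNReal_iff_coe_le T.hB]
        exact hb.le
      rw [ENNReal.coe_rpow_of_nonneg _ (by norm_num)]
      refine mul_le_mul' ?_ le_rfl
      have e2 : ((2 : ℝ≥0∞).toReal⁻¹) = 1 / 2 := by norm_num
      rw [e2]
      exact ENNReal.rpow_le_rpow hm (by norm_num)

end TruncatedFunctional

/-! ### Standard mollifiers and a jointly measurable density. -/

/-- The standard bump function with inner radius `1 / (n + 1)` and outer radius `2 / (n + 1)`. -/
noncomputable def stdBump (d n : ℕ) : ContDiffBump (0 : Rd d) where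
  rIn := 1 / ((n : ℝ) + 1)
  rOut := 2 / ((n : ℝ) + 1)
  rIn_pos := by positivity
  rIn_lt_rOut := by gcongr; norm_num

/-- The standard sequence of mollifiers on `ℝᵈ`. -/
noncomputable def stdMollifier (d n : ℕ) : Rd d → ℝ := (stdBump d n).normed volume

theorem isMollifier_stdMollifier (d n : ℕ) : IsMollifier (stdMollifier d n) where
  continuous := (stdBump d n).continuous_normed
  hasCompactSupport := (stdBump d n).hasCompactSupport_normed
  nonneg := (stdBump d n).nonneg_normed
  even := (stdBump d n).normed_neg
  integral_eq_one := (stdBump d n).integral_normed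

theorem ae_tendsto_integral_stdMollifier {g : Rd d → ℝ} (hg : LocallyIntegrable g volume) :
    ∀ᵐ x, Tendsto (fun n => ∫ y, g y * stdMollifier d n (x - y)) atTop (𝓝 (g x)) := by
  have h1 : Tendsto (fun n : ℕ => (stdBump d n).rOut) atTop (𝓝 0) := by
    have h := (tendsto_one_div_add_atTop_nhds_zero_nat (𝕜 := ℝ)).const_mul 2
    rw [mul_zero] at h
    refine h.congr fun n => ?_
    show 2 * (1 / ((n : ℝ) + 1)) = 2 / ((n : ℝ) + 1)
    ring
  -- A bounded ratio of the radii is what makes Lebesgue differentiation apply to the convolutions.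
  have h2 : ∀ᶠ n in atTop, (stdBump d n).rOut ≤ 2 * (stdBump d n).rIn := by
    refine Eventually.of_forall fun n => ?_
    show 2 / ((n : ℝ) + 1) ≤ 2 * (1 / ((n : ℝ) + 1))
    exact le_of_eq (by ring)
  filter_upwards [ContDiffBump.ae_convolution_tendsto_right_of_locallyIntegrable (μ := volume)
    h1 h2 hg] with x hx
  refine hx.congr fun n => ?_
  rw [convolution_eq_swap]
  refine integral_congr_ae (Eventually.of_forall fun y => ?_)
  simp [stdMollifier, mul_comm]

namespace Mac

theorem integral_toM (μ : Mac d) (f : Rd d → ℝ) :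
    ∫ x, f x ∂μ.toM = ∫ x, μ.dens x * f x := by
  rw [μ.toM_eq_withDensity, integral_withDensity_eq_integral_toReal_smul
    (by have := μ.measurable_dens; fun_prop) (Eventually.of_forall fun x => ENNReal.ofReal_lt_top)]
  refine integral_congr_ae (Eventually.of_forall fun x => ?_)
  simp [ENNReal.toReal_ofReal (μ.dens_nonneg x)]

theorem lintegral_toM (μ : Mac d) {f : Rd d → ℝ≥0∞} (hf : Measurable f) :
    ∫⁻ x, f x ∂μ.toM = ∫⁻ x, ENNReal.ofReal (μ.dens x) * f x := by
  have := μ.measurable_dens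
  conv_lhs => rw [μ.toM_eq_withDensity]
  exact lintegral_withDensity_eq_lintegral_mul _ (by fun_prop) hf

theorem integrable_mul_dens (μ : Mac d) {f : Rd d → ℝ} (hf : AEStronglyMeasurable f volume)
    {C : ℝ} (hC : ∀ x, |f x| ≤ C) : Integrable (fun x => μ.dens x * f x) := by
  have := μ.integrable_dens.mul_bdd (g := f) (c := C) hf (Eventually.of_forall hC)
  exact this

/-- The total variation topology is finer than the weak topology. -/
theorem continuous_toFM : Continuous (toFM : Mac d → FiniteMeasure (Rd d)) := by
  rw [continuous_iff_continuousAt]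
  intro μ
  refine FiniteMeasure.tendsto_of_forall_integral_tendsto fun f => ?_
  rw [tendsto_iff_dist_tendsto_zero]
  have hd : Tendsto (fun ν : Mac d => ‖f‖ * dist ν μ) (𝓝 μ) (𝓝 0) := by
    have : Continuous fun ν : Mac d => ‖f‖ * dist ν μ := by fun_prop
    have h := this.tendsto μ
    rwa [dist_self, mul_zero] at h
  refine squeeze_zero (fun _ => dist_nonneg) (fun ν => ?_) hd
  have hfb : ∀ x, |f x| ≤ ‖f‖ := fun x => f.norm_coe_le_norm x
  have hfm : AEStronglyMeasurable f (volume : Measure (Rd d)) :=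
    f.continuous.aestronglyMeasurable
  change dist (∫ x, f x ∂ν.toM) (∫ x, f x ∂μ.toM) ≤ _
  rw [integral_toM, integral_toM, Real.dist_eq, ← integral_sub (ν.integrable_mul_dens hfm hfb)
    (μ.integrable_mul_dens hfm hfb), Mac.dist_eq, ← integral_const_mul, ← Real.norm_eq_abs]
  refine norm_integral_le_of_norm_le
    ((ν.integrable_dens.sub μ.integrable_dens).abs.const_mul _)
    (Eventually.of_forall fun x => ?_)
  rw [← sub_mul, norm_mul, mul_comm]
  exact mul_le_mul_of_nonneg_right (hfb x) (norm_nonneg _)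

theorem mass_toFM (μ : Mac d) : (μ.toFM.mass : ℝ) = ∫ x, μ.dens x := by
  have h := μ.integral_toM fun _ => 1
  simp only [integral_const, smul_eq_mul, mul_one] at h
  rw [← h]
  rfl

theorem mollify_eq (μ : Mac d) (ρ : Rd d → ℝ) (x : Rd d) :
    mollify ρ μ.toM x = ∫ y, μ.dens y * ρ (x - y) := μ.integral_toM _

theorem ae_tendsto_mollify (μ : Mac d) :
    ∀ᵐ x, Tendsto (fun n => mollify (stdMollifier d n) μ.toM x) atTop (𝓝 (μ.dens x)) := by
  filter_upwards [ae_tendsto_integral_stdMollifier μ.integrable_dens.locallyIntegrable] with x hx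
  simpa only [mollify_eq] using hx

/-- A version of the density which is jointly measurable in `(μ, x)`. -/
noncomputable def jdens (μ : Mac d) (x : Rd d) : ℝ :=
  -- The density is chosen separately for each `μ`, with no measurability in `μ`. The mollified
  -- densities are jointly continuous, and their upper limit in `[0, ∞]` exists everywhere and is
  -- jointly measurable.
  (limsup (fun n => ENNReal.ofReal (mollify (stdMollifier d n) μ.toM x)) atTop).toReal

theorem jdens_nonneg (μ : Mac d) (x : Rd d) : 0 ≤ μ.jdens x := ENNReal.toReal_nonneg

theorem jdens_ae_eq (μ : Mac d) : μ.jdens =ᵐ[volume] μ.dens := by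
  filter_upwards [μ.ae_tendsto_mollify] with x hx
  have h := ((ENNReal.continuous_ofReal.tendsto _).comp hx).limsup_eq
  simp only [Function.comp_def] at h
  rw [jdens, h, ENNReal.toReal_ofReal (μ.dens_nonneg x)]

theorem jdens_ae_eq_toM (μ : Mac d) : μ.jdens =ᵐ[μ.toM] μ.dens := μ.ac.ae_le μ.jdens_ae_eq

theorem continuous_mollify {ρ : Rd d → ℝ} (h : IsMollifier ρ) :
    Continuous fun p : Mac d × Rd d => mollify ρ p.1.toM p.2 :=
  h.continuous_mollify.comp ((continuous_toFM.comp continuous_fst).prodMk continuous_snd)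

theorem measurable_jdens : Measurable fun p : Mac d × Rd d => p.1.jdens p.2 := by
  unfold jdens
  refine Measurable.ennreal_toReal (Measurable.limsup fun n => ?_)
  exact (continuous_mollify (isMollifier_stdMollifier d n)).measurable.ennreal_ofReal

/-- With the jointly measurable density the measure of integration becomes Lebesgue measure, and
measurability of a partial integral applies. -/
theorem measurable_lintegral_toM {F : Mac d → Rd d → ℝ≥0∞}
    (hF : Measurable fun p : Mac d × Rd d => F p.1 p.2) :
    Measurable fun μ : Mac d => ∫⁻ x, F μ x ∂μ.toM := by
  have h : ∀ μ : Mac d, ∫⁻ x, F μ x ∂μ.toM = ∫⁻ x, ENNReal.ofReal (μ.jdens x) * F μ x := by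
    intro μ
    rw [μ.lintegral_toM (f := F μ) (hF.comp measurable_prodMk_left)]
    refine lintegral_congr_ae ?_
    filter_upwards [μ.jdens_ae_eq] with x hx
    rw [hx]
  simp_rw [h]
  exact Measurable.lintegral_prod_right' (f := fun p : Mac d × Rd d =>
    ENNReal.ofReal (p.1.jdens p.2) * F p.1 p.2) (measurable_jdens.ennreal_ofReal.mul hF)

theorem integral_mollify (μ : Mac d) {ρ : Rd d → ℝ} (h : IsMollifier ρ) :
    Integrable (fun x => mollify ρ μ.toM x) ∧ ∫ x, mollify ρ μ.toM x = ∫ x, μ.dens x := by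
  have hm : Measurable fun x => mollify ρ μ.toM x :=
    (h.continuous_mollify.comp (f := fun x => (μ.toFM, x)) (by fun_prop)).measurable
  have hl : ∫⁻ x, ENNReal.ofReal (mollify ρ μ.toM x) = μ.toM univ := by
    calc ∫⁻ x, ENNReal.ofReal (mollify ρ μ.toM x)
        = ∫⁻ x, ∫⁻ y, ENNReal.ofReal (ρ (x - y)) ∂μ.toM := by
          refine lintegral_congr fun x => ?_
          exact ofReal_integral_eq_lintegral_ofReal (h.integrable_comp_sub _ _)
            (Eventually.of_forall fun y => h.nonneg _)
      _ = ∫⁻ y, ∫⁻ x, ENNReal.ofReal (ρ (x - y)) ∂volume ∂μ.toM := by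
          refine lintegral_lintegral_swap ?_
          have : Continuous fun p : Rd d × Rd d => ρ (p.1 - p.2) :=
            h.continuous.comp (continuous_fst.sub continuous_snd)
          exact this.measurable.ennreal_ofReal.aemeasurable
      _ = ∫⁻ _, 1 ∂μ.toM := by
          refine lintegral_congr fun y => ?_
          rw [← ofReal_integral_eq_lintegral_ofReal (h.integrable.comp_sub_right y)
            (Eventually.of_forall fun y => h.nonneg _), h.integral_comp_sub_right,
            ENNReal.ofReal_one]
      _ = μ.toM univ := by simp
  have hnn : 0 ≤ᵐ[volume] fun x => mollify ρ μ.toM x :=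
    Eventually.of_forall fun x => h.mollify_nonneg _ _
  constructor
  · rw [← lintegral_ofReal_ne_top_iff_integrable hm.aestronglyMeasurable hnn, hl]
    exact measure_ne_top _ _
  · rw [integral_eq_lintegral_of_nonneg_ae hnn hm.aestronglyMeasurable, hl, ← mass_toFM]
    rfl

/-- Scheffé's argument: mollification preserves mass, so the `L¹` distance is twice the integral of
the positive part of `h_μ - h_μ * ρ`, which is dominated by `h_μ`. -/
theorem tendsto_integral_abs_mollify_sub (μ : Mac d) :
    Tendsto (fun n => ∫ x, |mollify (stdMollifier d n) μ.toM x - μ.dens x|) atTop (𝓝 0) := by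
  have hρ := isMollifier_stdMollifier d
  have h1 : Tendsto (fun n => ∫ x, max (μ.dens x - mollify (stdMollifier d n) μ.toM x) 0) atTop
      (𝓝 (∫ _ : Rd d, (0 : ℝ))) := by
    refine tendsto_integral_of_dominated_convergence μ.dens (fun n => ?_) μ.integrable_dens
      (fun n => Eventually.of_forall fun x => ?_) ?_
    · have h2 := (μ.integrable_dens.sub (μ.integral_mollify (hρ n)).1).pos_part
      exact h2.aestronglyMeasurable
    · rw [Real.norm_eq_abs, abs_of_nonneg (le_max_right _ _)]
      exact max_le (by linarith [(hρ n).mollify_nonneg μ.toM x]) (μ.dens_nonneg x)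
    · filter_upwards [μ.ae_tendsto_mollify] with x hx
      have := ((tendsto_const_nhds (x := μ.dens x)).sub hx).max (tendsto_const_nhds (x := (0 : ℝ)))
      simpa using this
  rw [integral_zero] at h1
  have h2 := h1.const_mul 2
  rw [mul_zero] at h2
  refine h2.congr fun n => ?_
  have hi := (μ.integral_mollify (hρ n)).1
  have e : ∀ x, |mollify (stdMollifier d n) μ.toM x - μ.dens x| =
      (mollify (stdMollifier d n) μ.toM x - μ.dens x) +
        2 * max (μ.dens x - mollify (stdMollifier d n) μ.toM x) 0 := by
    intro x
    rcases le_total (mollify (stdMollifier d n) μ.toM x) (μ.dens x) with hx | hx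
    · rw [abs_of_nonpos (by linarith), max_eq_left (by linarith)]; ring
    · rw [abs_of_nonneg (by linarith), max_eq_right (by linarith)]; ring
  simp_rw [e]
  have hp : Integrable fun x => max (μ.dens x - mollify (stdMollifier d n) μ.toM x) 0 :=
    (μ.integrable_dens.sub hi).pos_part
  have hs : Integrable fun x => mollify (stdMollifier d n) μ.toM x - μ.dens x :=
    hi.sub μ.integrable_dens
  rw [integral_add hs (hp.const_mul 2), integral_sub hi μ.integrable_dens,
    (μ.integral_mollify (hρ n)).2, sub_self, zero_add, integral_const_mul]

end Mac

/-! ### The graph norm and the closure. -/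

/-- The squared distance at `μ` of the pairs `(u, D)` and `(v, w)` of a function and a gradient. -/
noncomputable def formDist (u v : Mac d → ℝ) (D w : Mac d → Rd d → ℝ) (μ : Mac d) : ℝ≥0∞ :=
  ‖u μ - v μ‖ₑ ^ 2 + ∫⁻ x, ‖D μ x - w μ x‖ₑ ^ 2 ∂μ.toM

theorem enorm_add_sq_le (a b : ℝ) : ‖a + b‖ₑ ^ 2 ≤ 2 * ‖a‖ₑ ^ 2 + 2 * ‖b‖ₑ ^ 2 := by
  simp only [Real.enorm_eq_ofReal_abs, ← ENNReal.ofReal_pow (abs_nonneg _), sq_abs]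
  rw [← ENNReal.ofReal_ofNat 2, ← ENNReal.ofReal_mul (by norm_num),
    ← ENNReal.ofReal_mul (by norm_num), ← ENNReal.ofReal_add (by positivity) (by positivity)]
  exact ENNReal.ofReal_le_ofReal (by nlinarith [sq_nonneg (a - b)])

section energy

variable {Λ : Measure (Mac d)}

theorem measurable_lintegral_enorm_sq {D : Mac d → Rd d → ℝ}
    (hD : Measurable fun p : Mac d × Rd d => D p.1 p.2) :
    Measurable fun μ : Mac d => ∫⁻ x, ‖D μ x‖ₑ ^ 2 ∂μ.toM :=
  Mac.measurable_lintegral_toM (F := fun μ x => ‖D μ x‖ₑ ^ 2) (hD.enorm.pow_const 2)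

theorem energy_add_le {D w : Mac d → Rd d → ℝ}
    (hD : Measurable fun p : Mac d × Rd d => D p.1 p.2) :
    energy Λ (fun μ x => D μ x + w μ x) ≤ 2 * energy Λ D + 2 * energy Λ w := by
  unfold energy
  rw [← lintegral_const_mul' _ _ (by simp), ← lintegral_const_mul' _ _ (by simp),
    ← lintegral_add_left ((measurable_lintegral_enorm_sq hD).const_mul 2)]
  refine lintegral_mono fun μ => ?_
  have hDμ : Measurable fun x => ‖D μ x‖ₑ ^ 2 :=
    (hD.comp (measurable_prodMk_left (x := μ))).enorm.pow_const 2
  simp only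
  rw [← lintegral_const_mul' _ _ (by simp), ← lintegral_const_mul' _ _ (by simp),
    ← lintegral_add_left (hDμ.const_mul 2)]
  exact lintegral_mono fun x => enorm_add_sq_le _ _

theorem energy_neg (D : Mac d → Rd d → ℝ) : energy Λ (fun μ x => -D μ x) = energy Λ D := by
  simp [energy]

theorem formDist_triangle {u v β : Mac d → ℝ} {D w E : Mac d → Rd d → ℝ}
    (hD : Measurable fun p : Mac d × Rd d => D p.1 p.2)
    (hE : Measurable fun p : Mac d × Rd d => E p.1 p.2) (μ : Mac d) :
    formDist u β D w μ ≤ 2 * formDist u v D E μ + 2 * formDist v β E w μ := by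
  have h1 := enorm_add_sq_le (u μ - v μ) (v μ - β μ)
  rw [sub_add_sub_cancel] at h1
  have h2 : ∫⁻ x, ‖D μ x - w μ x‖ₑ ^ 2 ∂μ.toM ≤
      2 * ∫⁻ x, ‖D μ x - E μ x‖ₑ ^ 2 ∂μ.toM + 2 * ∫⁻ x, ‖E μ x - w μ x‖ₑ ^ 2 ∂μ.toM := by
    have hm : Measurable fun x => ‖D μ x - E μ x‖ₑ ^ 2 :=
      ((hD.comp (measurable_prodMk_left (x := μ))).sub
        (hE.comp (measurable_prodMk_left (x := μ)))).enorm.pow_const 2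
    rw [← lintegral_const_mul' _ _ (by simp), ← lintegral_const_mul' _ _ (by simp),
      ← lintegral_add_left (hm.const_mul 2)]
    refine lintegral_mono fun x => ?_
    have := enorm_add_sq_le (D μ x - E μ x) (E μ x - w μ x)
    rwa [sub_add_sub_cancel] at this
  unfold formDist
  calc _ ≤ _ := add_le_add h1 h2
    _ = _ := by ring

theorem measurable_formDist {u v : Mac d → ℝ} {D w : Mac d → Rd d → ℝ} (hu : Measurable u)
    (hv : Measurable v) (hD : Measurable fun p : Mac d × Rd d => D p.1 p.2)
    (hw : Measurable fun p : Mac d × Rd d => w p.1 p.2) : Measurable (formDist u v D w) :=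
  ((hu.sub hv).enorm.pow_const 2).add (measurable_lintegral_enorm_sq (D := fun μ x => D μ x - w μ x)
    (hD.sub hw))

theorem IsCbE12.measurable_comp {u : FiniteMeasure (Rd d) → ℝ}
    {Du : FiniteMeasure (Rd d) → Rd d → ℝ} (h : IsCbE12 u Du) :
    Measurable fun μ : Mac d => u μ.toFM := (h.continuous.comp Mac.continuous_toFM).measurable

theorem IsCbE12.measurable_deriv_comp {u : FiniteMeasure (Rd d) → ℝ}
    {Du : FiniteMeasure (Rd d) → Rd d → ℝ} (h : IsCbE12 u Du) :
    Measurable fun p : Mac d × Rd d => Du p.1.toFM p.2 :=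
  (h.continuous_deriv.comp (f := fun p : Mac d × Rd d => (p.1.toFM, p.2))
    ((Mac.continuous_toFM.comp continuous_fst).prodMk continuous_snd)).measurable

theorem eLpNorm_two_eq {Ω : Type*} [MeasurableSpace Ω] {P : Measure Ω} (f : Ω → ℝ) :
    eLpNorm f 2 P = (∫⁻ ω, ‖f ω‖ₑ ^ 2 ∂P) ^ (1 / 2 : ℝ) := by
  rw [eLpNorm_eq_lintegral_rpow_enorm_toReal (by simp) (by simp)]
  simp

theorem IsCbE12.energy_lt_top [IsFiniteMeasure Λ] {u : FiniteMeasure (Rd d) → ℝ}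
    {Du : FiniteMeasure (Rd d) → Rd d → ℝ} (h : IsCbE12 u Du) :
    energy Λ (fun μ => Du μ.toFM) < ∞ := by
  obtain ⟨C, hC⟩ := h.bounded_L2
  have h1 : ∀ μ : Mac d, ∫⁻ x, ‖Du μ.toFM x‖ₑ ^ 2 ∂μ.toM ≤ (C : ℝ≥0∞) ^ 2 := by
    intro μ
    have h2 := hC μ
    rw [eLpNorm_two_eq] at h2
    have h3 := ENNReal.rpow_le_rpow h2 (z := 2) (by norm_num)
    rw [← ENNReal.rpow_mul] at h3
    norm_num at h3
    exact h3
  refine (lintegral_mono h1).trans_lt ?_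
  rw [lintegral_const]
  exact ENNReal.mul_lt_top (by simp) (measure_lt_top _ _)

/-- A pair `(β, w)` which is a limit of pairs `(u, Dᴱ u)` belongs to the closure. -/
theorem memFormDomain_and_hasWeakExtrinsicDeriv [IsFiniteMeasure Λ] {β : Mac d → ℝ}
    {w : Mac d → Rd d → ℝ} (hβ : AEStronglyMeasurable β Λ)
    (hw : Measurable fun p : Mac d × Rd d => w p.1 p.2)
    {u : ℕ → FiniteMeasure (Rd d) → ℝ} {Du : ℕ → FiniteMeasure (Rd d) → Rd d → ℝ}
    (hu : ∀ n, IsCbE12 (u n) (Du n))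
    (hlim : Tendsto (fun n => ∫⁻ μ, formDist (fun ν => u n ν.toFM) β (fun ν => Du n ν.toFM) w μ ∂Λ)
      atTop (𝓝 0)) :
    MemFormDomain Λ β ∧ HasWeakExtrinsicDeriv Λ β w := by
  have hL2 : Tendsto (fun n => eLpNorm (fun μ : Mac d => u n μ.toFM - β μ) 2 Λ) atTop (𝓝 0) := by
    have h1 := tendsto_of_tendsto_of_tendsto_of_le_of_le tendsto_const_nhds hlim
      (fun _ => zero_le) (fun n => (lintegral_mono fun μ => (self_le_add_right _ _) :
        ∫⁻ μ : Mac d, ‖u n μ.toFM - β μ‖ₑ ^ 2 ∂Λ ≤ _))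
    have h2 := ((ENNReal.continuous_rpow_const (y := 1 / 2)).tendsto 0).comp h1
    simp only [ENNReal.zero_rpow_of_pos (by norm_num : (0 : ℝ) < 1 / 2)] at h2
    refine h2.congr fun n => ?_
    rw [eLpNorm_two_eq]
    rfl
  have hE : Tendsto (fun n => energy Λ fun μ x => Du n μ.toFM x - w μ x) atTop (𝓝 0) :=
    tendsto_of_tendsto_of_tendsto_of_le_of_le tendsto_const_nhds hlim
      (fun _ => zero_le) fun n => lintegral_mono fun μ => self_le_add_left _ _
  -- A single approximant at distance below one suffices: it is bounded and `Λ` is finite. The same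
  -- device gives finite energy of `w`.
  have hmem : MemLp β 2 Λ := by
    obtain ⟨n, hn⟩ := (hL2.eventually_lt_const zero_lt_one).exists
    obtain ⟨C, hC⟩ := (hu n).bounded
    have h1 : MemLp (fun μ : Mac d => u n μ.toFM) 2 Λ := by
      refine MemLp.of_bound (hu n).measurable_comp.aestronglyMeasurable C
        (Eventually.of_forall fun μ => ?_)
      have := hC μ.toFM 0
      rw [Real.norm_eq_abs]
      linarith [abs_nonneg (Du n μ.toFM 0)]
    have h2 : MemLp (fun μ : Mac d => u n μ.toFM - β μ) 2 Λ :=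
      ⟨(hu n).measurable_comp.aestronglyMeasurable.sub hβ, hn.trans ENNReal.one_lt_top⟩
    have h3 := h1.sub h2
    refine (memLp_congr_ae (Eventually.of_forall fun μ => ?_)).1 h3
    simp
  have hEw : energy Λ w < ∞ := by
    obtain ⟨n, hn⟩ := (hE.eventually_lt_const zero_lt_one).exists
    have h1 := energy_add_le (Λ := Λ) (D := fun μ => Du n μ.toFM)
      (w := fun μ x => -(Du n μ.toFM x - w μ x)) (hu n).measurable_deriv_comp
    rw [energy_neg] at h1
    simp only [neg_sub, add_sub_cancel] at h1
    refine h1.trans_lt (ENNReal.add_lt_top.2 ⟨?_, ?_⟩)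
    · exact ENNReal.mul_lt_top (by simp) (hu n).energy_lt_top
    · exact ENNReal.mul_lt_top (by simp) (hn.trans ENNReal.one_lt_top)
  refine ⟨⟨hmem, u, Du, hu, hL2, ?_⟩, hmem, hw, hEw, u, Du, hu, hL2, hE⟩
  have hb : ∀ p : ℕ × ℕ, (energy Λ fun μ x => Du p.1 μ.toFM x - Du p.2 μ.toFM x) ≤
      2 * (energy Λ fun μ x => Du p.1 μ.toFM x - w μ x) +
        2 * (energy Λ fun μ x => Du p.2 μ.toFM x - w μ x) := by
    intro p
    have h1 := energy_add_le (Λ := Λ) (D := fun μ x => Du p.1 μ.toFM x - w μ x)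
      (w := fun μ x => -(Du p.2 μ.toFM x - w μ x)) ((hu p.1).measurable_deriv_comp.sub hw)
    rw [energy_neg] at h1
    simpa only [neg_sub, sub_add_sub_cancel] using h1
  have ht := (ENNReal.Tendsto.const_mul (a := 2) (hE.comp tendsto_fst) (Or.inr (by simp))).add
    (ENNReal.Tendsto.const_mul (a := 2) (hE.comp tendsto_snd) (Or.inr (by simp)))
  rw [mul_zero, add_zero] at ht
  exact tendsto_of_tendsto_of_tendsto_of_le_of_le tendsto_const_nhds ht (fun _ => zero_le) hb

end energy

/-! ### Removal of the mollifier. -/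

namespace Mac

theorem measurable_jdens_apply (μ : Mac d) : Measurable μ.jdens := by
  have h : Measurable fun x => (fun p : Mac d × Rd d => p.1.jdens p.2) (μ, x) :=
    measurable_jdens.comp measurable_prodMk_left
  exact h

theorem integrable_jdens (μ : Mac d) : Integrable μ.jdens :=
  μ.integrable_dens.congr μ.jdens_ae_eq.symm

theorem lintegral_toM_jdens (μ : Mac d) {f : Rd d → ℝ≥0∞} (hf : Measurable f) :
    ∫⁻ x, f x ∂μ.toM = ∫⁻ x, ENNReal.ofReal (μ.jdens x) * f x := by
  rw [μ.lintegral_toM hf]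
  refine lintegral_congr_ae ?_
  filter_upwards [μ.jdens_ae_eq] with x hx
  rw [hx]

theorem ae_tendsto_mollify_jdens (μ : Mac d) :
    ∀ᵐ x, Tendsto (fun n => mollify (stdMollifier d n) μ.toM x) atTop (𝓝 (μ.jdens x)) := by
  filter_upwards [μ.ae_tendsto_mollify, μ.jdens_ae_eq] with x hx he
  rwa [he]

theorem tendsto_lintegral_mollify_sub (μ : Mac d) :
    Tendsto (fun n => ∫⁻ x, ENNReal.ofReal |mollify (stdMollifier d n) μ.toM x - μ.jdens x|) atTop
      (𝓝 0) := by
  have h := (ENNReal.continuous_ofReal.tendsto 0).comp μ.tendsto_integral_abs_mollify_sub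
  rw [ENNReal.ofReal_zero] at h
  refine h.congr fun n => ?_
  have hi : Integrable fun x => |mollify (stdMollifier d n) μ.toM x - μ.dens x| :=
    ((μ.integral_mollify (isMollifier_stdMollifier d n)).1.sub μ.integrable_dens).abs
  simp only [Function.comp_apply]
  rw [ofReal_integral_eq_lintegral_ofReal hi (Eventually.of_forall fun x => abs_nonneg _)]
  refine lintegral_congr_ae ?_
  filter_upwards [μ.jdens_ae_eq] with x hx
  rw [hx]

theorem ofReal_mollify (μ : Mac d) {ρ : Rd d → ℝ} (h : IsMollifier ρ) (x : Rd d) :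
    ∫⁻ y, ENNReal.ofReal (ρ (x - y)) ∂μ.toM = ENNReal.ofReal (mollify ρ μ.toM x) :=
  (ofReal_integral_eq_lintegral_ofReal (h.integrable_comp_sub _ _)
    (Eventually.of_forall fun _ => h.nonneg _)).symm

/-- If `G_n → G` almost everywhere, boundedly, and `G` is integrable, then the mollifications of
`G_n` converge to `G` in `L²(μ)`. -/
theorem tendsto_lintegral_sq_mollify_sub (μ : Mac d) {M : ℝ} {G : Rd d → ℝ}
    {Gn : ℕ → Rd d → ℝ} (hG : Measurable G) (hGi : Integrable G) (hGn : ∀ n, Measurable (Gn n))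
    (hGM : ∀ x, |G x| ≤ M) (hGnM : ∀ n x, |Gn n x| ≤ M)
    (hlim : ∀ᵐ x, Tendsto (fun n => Gn n x) atTop (𝓝 (G x))) :
    Tendsto (fun n => ∫⁻ y, ‖(∫ x, Gn n x * stdMollifier d n (x - y)) - G y‖ₑ ^ 2 ∂μ.toM) atTop
      (𝓝 0) := by
  have hρ := isMollifier_stdMollifier d
  have hρc : ∀ n, Continuous fun p : Rd d × Rd d => stdMollifier d n (p.2 - p.1) := fun n =>
    (hρ n).continuous.comp (continuous_snd.sub continuous_fst)
  have hmeas : ∀ (F : Rd d → ℝ) (n : ℕ), Measurable F →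
      Measurable fun y => ∫ x, F x * stdMollifier d n (x - y) := fun F n hF =>
    (StronglyMeasurable.integral_prod_right' (f := fun p : Rd d × Rd d =>
      F p.2 * stdMollifier d n (p.2 - p.1))
      ((hF.comp measurable_snd).mul (hρc n).measurable).stronglyMeasurable).measurable
  have hint : ∀ (F : Rd d → ℝ) (n : ℕ) (y : Rd d) (C : ℝ), Measurable F → (∀ x, |F x| ≤ C) →
      Integrable fun x => F x * stdMollifier d n (x - y) := fun F n y C hF hC =>
    ((hρ n).integrable.comp_sub_right y).bdd_mul (c := C) hF.aestronglyMeasurable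
      (Eventually.of_forall hC)
  have hbd : ∀ (F : Rd d → ℝ) (n : ℕ) (y : Rd d), (∀ x, |F x| ≤ M) →
      |∫ x, F x * stdMollifier d n (x - y)| ≤ M := by
    intro F n y hF
    have e : M = ∫ x, M * stdMollifier d n (x - y) := by
      rw [integral_const_mul, (hρ n).integral_comp_sub_right, mul_one]
    rw [← Real.norm_eq_abs]
    refine (norm_integral_le_of_norm_le (((hρ n).integrable.comp_sub_right y).const_mul M)
      (Eventually.of_forall fun x => ?_)).trans e.ge
    rw [Real.norm_eq_abs, abs_mul, abs_of_nonneg ((hρ n).nonneg _)]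
    exact mul_le_mul_of_nonneg_right (hF x) ((hρ n).nonneg _)
  have hD : ∀ n, Measurable fun x => Gn n x - G x := fun n => (hGn n).sub hG
  have hDM : ∀ n x, |Gn n x - G x| ≤ 2 * M := fun n x =>
    (abs_sub _ _).trans (by linarith [hGM x, hGnM n x])
  -- the mollification error of the limit
  have hB : Tendsto (fun n => ∫⁻ y, ‖(∫ x, G x * stdMollifier d n (x - y)) - G y‖ₑ ∂μ.toM) atTop
      (𝓝 0) := by
    have h0 : Tendsto (fun n => ∫⁻ y, ‖(∫ x, G x * stdMollifier d n (x - y)) - G y‖ₑ ∂μ.toM) atTop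
        (𝓝 (∫⁻ _, 0 ∂μ.toM)) := by
      refine tendsto_lintegral_of_dominated_convergence (fun _ => ENNReal.ofReal (2 * M))
        (fun n => ((hmeas G n hG).sub hG).enorm) (fun n => Eventually.of_forall fun y => ?_) ?_ ?_
      · simp only [Real.enorm_eq_ofReal_abs]
        exact ENNReal.ofReal_le_ofReal ((abs_sub _ _).trans (by linarith [hGM y, hbd G n y hGM]))
      · rw [lintegral_const]
        exact ENNReal.mul_ne_top ENNReal.ofReal_ne_top (measure_ne_top _ _)
      · refine μ.ac.ae_le ?_
        filter_upwards [ae_tendsto_integral_stdMollifier hGi.locallyIntegrable] with y hy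
        have h1 := (hy.sub_const (G y)).enorm
        simp only [sub_self, enorm_zero] at h1
        refine h1.congr fun n => ?_
        congr 3
        funext x
        -- The kernel `ρ(x - y)` is here integrated in its first variable `x`; symmetry turns it
        -- into the convolution at `y`.
        rw [← (hρ n).even, neg_sub]
    simpa using h0
  -- the mollification of the error
  have hA : Tendsto (fun n => ∫⁻ y, ‖∫ x, (Gn n x - G x) * stdMollifier d n (x - y)‖ₑ ∂μ.toM) atTop
      (𝓝 0) := by
    -- By Tonelli the mollifier can be moved onto `μ`. The mollified density is then replaced by the
    -- density itself: the main part is this limit, and the error is at most `2M` times an `L¹`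
    -- distance tending to zero.
    have h1 : Tendsto (fun n => ∫⁻ x, ENNReal.ofReal |Gn n x - G x| * ENNReal.ofReal (μ.jdens x))
        atTop (𝓝 (∫⁻ _ : Rd d, 0)) := by
      refine tendsto_lintegral_of_dominated_convergence
        (fun x => ENNReal.ofReal (2 * M) * ENNReal.ofReal (μ.jdens x))
        (fun n => (by have := hD n; have := μ.measurable_jdens_apply; fun_prop))
        (fun n => Eventually.of_forall fun x => ?_) ?_ ?_
      · exact mul_le_mul' (ENNReal.ofReal_le_ofReal (hDM n x)) le_rfl
      · rw [lintegral_const_mul' _ _ ENNReal.ofReal_ne_top]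
        exact ENNReal.mul_ne_top ENNReal.ofReal_ne_top
          ((lintegral_ofReal_ne_top_iff_integrable μ.measurable_jdens_apply.aestronglyMeasurable
            (Eventually.of_forall μ.jdens_nonneg)).2 μ.integrable_jdens)
      · filter_upwards [hlim] with x hx
        have h2 := (ENNReal.continuous_ofReal.tendsto _).comp (hx.sub_const (G x)).abs
        simp only [sub_self, abs_zero, ENNReal.ofReal_zero] at h2
        have h3 := ENNReal.Tendsto.mul_const (b := ENNReal.ofReal (μ.jdens x)) h2
          (Or.inr ENNReal.ofReal_ne_top)
        rw [zero_mul] at h3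
        exact h3
    rw [lintegral_zero] at h1
    have h2 := h1.add (ENNReal.Tendsto.const_mul (a := ENNReal.ofReal (2 * M))
      μ.tendsto_lintegral_mollify_sub (Or.inr ENNReal.ofReal_ne_top))
    rw [mul_zero, add_zero] at h2
    refine tendsto_of_tendsto_of_tendsto_of_le_of_le tendsto_const_nhds h2 (fun _ => zero_le)
      fun n => ?_
    have hm : Measurable fun x => mollify (stdMollifier d n) μ.toM x :=
      ((hρ n).continuous_mollify.comp (f := fun x => (μ.toFM, x)) (by fun_prop)).measurable
    calc ∫⁻ y, ‖∫ x, (Gn n x - G x) * stdMollifier d n (x - y)‖ₑ ∂μ.toM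
        ≤ ∫⁻ y, ∫⁻ x, ENNReal.ofReal |Gn n x - G x| *
            ENNReal.ofReal (stdMollifier d n (x - y)) ∂volume ∂μ.toM := by
          refine lintegral_mono fun y => (enorm_integral_le_lintegral_enorm _).trans
            (lintegral_mono fun x => ?_)
          rw [enorm_mul, Real.enorm_eq_ofReal_abs, Real.enorm_eq_ofReal_abs,
            abs_of_nonneg ((hρ n).nonneg _)]
      _ = ∫⁻ x, ∫⁻ y, ENNReal.ofReal |Gn n x - G x| *
            ENNReal.ofReal (stdMollifier d n (x - y)) ∂μ.toM := by
          refine lintegral_lintegral_swap ?_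
          have h3 := (hρc n).measurable.ennreal_ofReal
          have h4 : Measurable fun p : Rd d × Rd d => ENNReal.ofReal |Gn n p.2 - G p.2| := by
            have h5 := hD n
            have h6 : Measurable fun x => ENNReal.ofReal |Gn n x - G x| := by fun_prop
            exact h6.comp measurable_snd
          exact (h4.mul h3).aemeasurable
      _ = ∫⁻ x, ENNReal.ofReal |Gn n x - G x| *
            ENNReal.ofReal (mollify (stdMollifier d n) μ.toM x) := by
          refine lintegral_congr fun x => ?_
          rw [lintegral_const_mul' _ _ ENNReal.ofReal_ne_top, μ.ofReal_mollify (hρ n)]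
      _ ≤ ∫⁻ x, (ENNReal.ofReal |Gn n x - G x| * ENNReal.ofReal (μ.jdens x) +
            ENNReal.ofReal (2 * M) *
              ENNReal.ofReal |mollify (stdMollifier d n) μ.toM x - μ.jdens x|) := by
          refine lintegral_mono fun x => ?_
          have h3 : ENNReal.ofReal (mollify (stdMollifier d n) μ.toM x) ≤
              ENNReal.ofReal (μ.jdens x) +
                ENNReal.ofReal |mollify (stdMollifier d n) μ.toM x - μ.jdens x| := by
            rw [← ENNReal.ofReal_add (μ.jdens_nonneg x) (abs_nonneg _)]
            refine ENNReal.ofReal_le_ofReal ?_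
            linarith [le_abs_self (mollify (stdMollifier d n) μ.toM x - μ.jdens x)]
          refine (mul_le_mul' le_rfl h3).trans ?_
          rw [mul_add]
          exact add_le_add le_rfl (mul_le_mul' (ENNReal.ofReal_le_ofReal (hDM n x)) le_rfl)
      _ = _ := by
          rw [lintegral_add_left (by have := hD n; have := μ.measurable_jdens_apply; fun_prop),
            lintegral_const_mul' _ _ ENNReal.ofReal_ne_top]
  -- Both functions are bounded by `M`, so a squared difference is at most `2M` times the
  -- difference, and `L¹(μ)` convergence suffices.
  have hAB := ENNReal.Tendsto.const_mul (a := ENNReal.ofReal (2 * M)) (hA.add hB)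
    (Or.inr ENNReal.ofReal_ne_top)
  rw [add_zero, mul_zero] at hAB
  refine tendsto_of_tendsto_of_tendsto_of_le_of_le tendsto_const_nhds hAB (fun _ => zero_le)
    fun n => ?_
  simp only
  rw [← lintegral_add_left (hmeas (fun x => Gn n x - G x) n (hD n)).enorm,
    ← lintegral_const_mul' _ _ ENNReal.ofReal_ne_top]
  refine lintegral_mono fun y => ?_
  rw [sq]
  refine mul_le_mul' ?_ ?_
  · rw [Real.enorm_eq_ofReal_abs]
    exact ENNReal.ofReal_le_ofReal ((abs_sub _ _).trans
      (by linarith [hGM y, hbd (Gn n) n y (hGnM n)]))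
  · have e : (∫ x, Gn n x * stdMollifier d n (x - y)) - G y =
        (∫ x, (Gn n x - G x) * stdMollifier d n (x - y)) +
          ((∫ x, G x * stdMollifier d n (x - y)) - G y) := by
      simp_rw [sub_mul]
      rw [integral_sub (hint (Gn n) n y M (hGn n) (hGnM n)) (hint G n y M hG hGM)]
      ring
    rw [e]
    exact enorm_add_le _ _

end Mac

namespace TruncatedFunctional

variable (T : TruncatedFunctional d)

/-- The limit of `T.inner ρ μ` as the mollifier tends to the Dirac measure. -/
noncomputable def limInner (μ : Mac d) : ℝ :=
  (∫ x, T.χ x * T.Q (μ.jdens x)) + ∫ x, T.g x ∂μ.toM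

/-- The limit of `T.fn ρ μ` as the mollifier tends to the Dirac measure. -/
noncomputable def limFn (μ : Mac d) : ℝ := T.ψ μ.toFM.mass * T.limInner μ

/-- The limit of `T.fnDeriv ρ μ` as the mollifier tends to the Dirac measure. -/
noncomputable def limDeriv (μ : Mac d) (y : Rd d) : ℝ :=
  T.ψ' μ.toFM.mass * T.limInner μ + T.ψ μ.toFM.mass * (T.χ y * T.Q' (μ.jdens y) + T.g y)

theorem tendsto_inner (μ : Mac d) :
    Tendsto (fun n => T.inner (stdMollifier d n) μ.toFM) atTop (𝓝 (T.limInner μ)) := by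
  have hρ := isMollifier_stdMollifier d
  refine Tendsto.add_const _ ?_
  refine tendsto_integral_of_dominated_convergence (fun x => |T.χ x| * T.M) (fun n => ?_)
    (T.integrable_χ.abs.mul_const _) (fun n => Eventually.of_forall fun x => ?_) ?_
  · have hmc : Continuous fun x => mollify (stdMollifier d n) (μ.toFM : Measure (Rd d)) x :=
      (hρ n).continuous_mollify.comp (continuous_const.prodMk continuous_id)
    exact (T.continuous_χ.mul (T.continuousOn_Q.comp_continuous hmc
      fun x => (hρ n).mollify_nonneg _ _)).aestronglyMeasurable
  · rw [norm_mul]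
    exact mul_le_mul_of_nonneg_left (T.abs_Q_le _ ((hρ n).mollify_nonneg _ _)) (norm_nonneg _)
  · filter_upwards [μ.ae_tendsto_mollify_jdens] with x hx
    refine Tendsto.const_mul _ ?_
    exact ((T.continuousOn_Q _ (μ.jdens_nonneg x)).tendsto).comp
      (tendsto_nhdsWithin_iff.2 ⟨hx, Eventually.of_forall fun n => (hρ n).mollify_nonneg _ _⟩)

theorem tendsto_fn (μ : Mac d) :
    Tendsto (fun n => T.fn (stdMollifier d n) μ.toFM) atTop (𝓝 (T.limFn μ)) :=
  (T.tendsto_inner μ).const_mul _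

theorem measurable_limInner : Measurable T.limInner :=
  measurable_of_tendsto_metrizable
    (fun n => ((T.continuous_inner (isMollifier_stdMollifier d n)).comp
      Mac.continuous_toFM).measurable)
    (tendsto_pi_nhds.2 T.tendsto_inner)

theorem measurable_mass_toFM : Measurable fun μ : Mac d => (μ.toFM.mass : ℝ) := by
  have h : Continuous fun μ : FiniteMeasure (Rd d) => (μ.mass : ℝ) := by fun_prop
  exact (h.comp Mac.continuous_toFM).measurable

theorem measurable_limFn : Measurable T.limFn :=
  (T.continuous_ψ.measurable.comp measurable_mass_toFM).mul T.measurable_limInner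

theorem measurable_Q'_comp {X : Type*} [MeasurableSpace X] {f : X → ℝ} (hf : Measurable f)
    (hf0 : ∀ x, 0 ≤ f x) : Measurable fun x => T.Q' (f x) :=
  measurable_comp_of_continuousOn_Ici T.continuousOn_Q' hf hf0

theorem measurable_limDeriv : Measurable fun p : Mac d × Rd d => T.limDeriv p.1 p.2 := by
  have h1 : Measurable fun p : Mac d × Rd d => (p.1.toFM.mass : ℝ) :=
    measurable_mass_toFM.comp measurable_fst
  have h2 := T.measurable_Q'_comp (Mac.measurable_jdens (d := d)) fun p => p.1.jdens_nonneg _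
  exact ((T.continuous_ψ'.measurable.comp h1).mul (T.measurable_limInner.comp measurable_fst)).add
    ((T.continuous_ψ.measurable.comp h1).mul
      (((T.continuous_χ.measurable.comp measurable_snd).mul h2).add
        (T.continuous_g.measurable.comp measurable_snd)))

theorem abs_χ_mul_Q'_le (x : Rd d) {s : ℝ} (hs : 0 ≤ s) : |T.χ x * T.Q' s| ≤ T.M := by
  rw [abs_mul]
  calc |T.χ x| * |T.Q' s| ≤ 1 * T.M :=
        mul_le_mul (T.abs_χ_le x) (T.abs_Q'_le _ hs) (abs_nonneg _) zero_le_one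
    _ = T.M := one_mul _

/-- The difference of the gradients splits into a part constant in `y`, governed by `tendsto_inner`,
and the mollification of `χ Q'(h_μ * ρ)`, governed by `Mac.tendsto_lintegral_sq_mollify_sub`. -/
theorem tendsto_lintegral_fnDeriv_sub (μ : Mac d) :
    Tendsto (fun n => ∫⁻ y, ‖T.fnDeriv (stdMollifier d n) μ.toFM y - T.limDeriv μ y‖ₑ ^ 2 ∂μ.toM)
      atTop (𝓝 0) := by
  have hρ := isMollifier_stdMollifier d
  have hmc : ∀ n, Continuous fun x => mollify (stdMollifier d n) (μ.toFM : Measure (Rd d)) x :=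
    fun n => (hρ n).continuous_mollify.comp (continuous_const.prodMk continuous_id)
  have hQj := T.measurable_Q'_comp μ.measurable_jdens_apply μ.jdens_nonneg
  have hG : Measurable fun x => T.χ x * T.Q' (μ.jdens x) := T.continuous_χ.measurable.mul hQj
  have h1 := μ.tendsto_lintegral_sq_mollify_sub (M := T.M)
    (Gn := fun n x => T.χ x * T.Q' (mollify (stdMollifier d n) (μ.toFM : Measure (Rd d)) x)) hG
    (T.integrable_χ.mul_bdd (c := T.M) hQj.aestronglyMeasurable
      (Eventually.of_forall fun x => T.abs_Q'_le _ (μ.jdens_nonneg x)))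
    (fun n => T.continuous_χ.measurable.mul (T.measurable_Q'_comp (hmc n).measurable
      fun x => (hρ n).mollify_nonneg _ _))
    (fun x => T.abs_χ_mul_Q'_le x (μ.jdens_nonneg x))
    (fun n x => T.abs_χ_mul_Q'_le x ((hρ n).mollify_nonneg _ _))
    (by
      filter_upwards [μ.ae_tendsto_mollify_jdens] with x hx
      refine Tendsto.const_mul _ ?_
      exact ((T.continuousOn_Q' _ (μ.jdens_nonneg x)).tendsto).comp
        (tendsto_nhdsWithin_iff.2 ⟨hx, Eventually.of_forall fun n => (hρ n).mollify_nonneg _ _⟩))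
  have h2 := (((T.tendsto_inner μ).sub_const (T.limInner μ)).const_mul (T.ψ' μ.toFM.mass)).enorm
  rw [sub_self, mul_zero, enorm_zero] at h2
  have h3 := (ENNReal.Tendsto.mul_const (b := μ.toM univ) ((ENNReal.continuous_pow 2).tendsto 0 |>.comp h2)
    (Or.inr (measure_ne_top _ _)))
  have h4 := (ENNReal.Tendsto.const_mul (a := 2) h3 (Or.inr (by simp))).add
    (ENNReal.Tendsto.const_mul (a := 2 * ‖T.ψ μ.toFM.mass‖ₑ ^ 2) h1 (Or.inr (by finiteness)))
  rw [zero_pow two_ne_zero, zero_mul, mul_zero, mul_zero, add_zero] at h4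
  refine tendsto_of_tendsto_of_tendsto_of_le_of_le tendsto_const_nhds h4 (fun _ => zero_le)
    fun n => ?_
  simp only [Function.comp_apply]
  rw [← lintegral_const, ← lintegral_const_mul' _ _ (by simp),
    ← lintegral_const_mul' _ _ (by finiteness), ← lintegral_add_left (by fun_prop)]
  refine lintegral_mono fun y => ?_
  have e : T.fnDeriv (stdMollifier d n) μ.toFM y - T.limDeriv μ y =
      T.ψ' μ.toFM.mass * (T.inner (stdMollifier d n) μ.toFM - T.limInner μ) +
      T.ψ μ.toFM.mass * ((∫ x, T.χ x * T.Q' (mollify (stdMollifier d n)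
        (μ.toFM : Measure (Rd d)) x) * stdMollifier d n (x - y)) - T.χ y * T.Q' (μ.jdens y)) := by
    rw [fnDeriv, limDeriv, innerDeriv]
    ring
  rw [e]
  refine (enorm_add_sq_le _ _).trans (le_of_eq ?_)
  rw [enorm_mul (T.ψ μ.toFM.mass), mul_pow, mul_assoc]

theorem abs_limFn_le (μ : Mac d) : |T.limFn μ| ≤ T.M * (T.M * T.mass + T.M * T.B) :=
  le_of_tendsto (T.tendsto_fn μ).abs
    (Eventually.of_forall fun n => T.abs_fn_le (isMollifier_stdMollifier d n) _)

theorem abs_limInner_le (μ : Mac d) : |T.limInner μ| ≤ T.M * T.mass + T.M * μ.toFM.mass :=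
  le_of_tendsto (T.tendsto_inner μ).abs
    (Eventually.of_forall fun n => T.abs_inner_le (isMollifier_stdMollifier d n) _)

theorem abs_limDeriv_le (μ : Mac d) (y : Rd d) :
    |T.limDeriv μ y| ≤ T.M * (T.M * T.mass + T.M * T.B) + T.M * (2 * T.M) := by
  have hM := T.hM
  have hB := T.hB
  have hm := T.mass_nonneg
  rw [limDeriv]
  rcases le_or_gt T.B μ.toFM.mass with hb | hb
  · rw [T.ψ_eq_zero _ hb, T.ψ'_eq_zero _ hb, zero_mul, zero_mul, add_zero, abs_zero]; positivity
  · refine (abs_add_le _ _).trans (add_le_add ?_ ?_)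
    · rw [abs_mul]
      refine mul_le_mul (T.abs_ψ'_le _) ((T.abs_limInner_le μ).trans ?_) (abs_nonneg _) T.hM
      gcongr
    · rw [abs_mul]
      refine mul_le_mul (T.abs_ψ_le _) ((abs_add_le _ _).trans ?_) (abs_nonneg _) T.hM
      linarith [T.abs_g_le y, T.abs_χ_mul_Q'_le y (μ.jdens_nonneg y)]

/-- The integrand converges to zero at every `μ`. For mass at least `B` both gradients vanish, and
otherwise all bounds are uniform in the mollifier, so a constant dominates. -/
theorem tendsto_lintegral_formDist (Λ : Measure (Mac d)) [IsFiniteMeasure Λ] :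
    Tendsto (fun n => ∫⁻ μ, formDist (fun ν => T.fn (stdMollifier d n) ν.toFM) T.limFn
      (fun ν => T.fnDeriv (stdMollifier d n) ν.toFM) T.limDeriv μ ∂Λ) atTop (𝓝 0) := by
  have hρ := isMollifier_stdMollifier d
  set K := T.M * (T.M * T.mass + T.M * T.B) with hK
  set L := K + T.M * (2 * T.M) with hL
  have h0 : Tendsto (fun n => ∫⁻ μ, formDist (fun ν => T.fn (stdMollifier d n) ν.toFM) T.limFn
      (fun ν => T.fnDeriv (stdMollifier d n) ν.toFM) T.limDeriv μ ∂Λ) atTop (𝓝 (∫⁻ _, 0 ∂Λ)) := by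
    refine tendsto_lintegral_of_dominated_convergence
      (fun _ => ENNReal.ofReal (2 * K) ^ 2 + ENNReal.ofReal (2 * L) ^ 2 * ENNReal.ofReal T.B)
      (fun n => measurable_formDist (T.isCbE12 (hρ n)).measurable_comp T.measurable_limFn
        (T.isCbE12 (hρ n)).measurable_deriv_comp T.measurable_limDeriv)
      (fun n => Eventually.of_forall fun μ => ?_) ?_ (Eventually.of_forall fun μ => ?_)
    · refine add_le_add (pow_le_pow_left' ?_ 2) ?_
      · rw [Real.enorm_eq_ofReal_abs]
        refine ENNReal.ofReal_le_ofReal ((abs_sub _ _).trans ?_)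
        linarith [T.abs_fn_le (hρ n) μ.toFM, T.abs_limFn_le μ]
      · rcases le_or_gt T.B μ.toFM.mass with hb | hb
        · have : ∀ y, T.fnDeriv (stdMollifier d n) μ.toFM y - T.limDeriv μ y = 0 := fun y => by
            rw [T.fnDeriv_eq_zero hb, limDeriv, T.ψ_eq_zero _ hb, T.ψ'_eq_zero _ hb]
            ring
          simp [this]
        · calc _ ≤ ∫⁻ _, ENNReal.ofReal (2 * L) ^ 2 ∂μ.toM := by
                refine lintegral_mono fun y => pow_le_pow_left' ?_ 2
                rw [Real.enorm_eq_ofReal_abs]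
                refine ENNReal.ofReal_le_ofReal ((abs_sub _ _).trans ?_)
                linarith [T.abs_fnDeriv_le (hρ n) μ.toFM y, T.abs_limDeriv_le μ y]
            _ ≤ _ := by
                rw [lintegral_const]
                refine mul_le_mul' le_rfl ?_
                have e : μ.toM univ = (μ.toFM.mass : ℝ≥0∞) := FiniteMeasure.ennreal_mass.symm
                rw [e, ← ENNReal.ofReal_coe_nnreal]
                exact ENNReal.ofReal_le_ofReal hb.le
    · rw [lintegral_const]
      exact ENNReal.mul_ne_top (by finiteness) (measure_ne_top _ _)
    · have h1 := ((T.tendsto_fn μ).sub_const (T.limFn μ)).enorm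
      rw [sub_self, enorm_zero] at h1
      have h2 := ((ENNReal.continuous_pow 2).tendsto 0).comp h1
      have h3 := h2.add (T.tendsto_lintegral_fnDeriv_sub μ)
      rw [zero_pow two_ne_zero, add_zero] at h3
      exact h3
  rwa [lintegral_zero] at h0

end TruncatedFunctional

/-! ### Regularization of the integrand -/

/-- A smooth map of `[0, ∞)` into the compact subset `[δ, δ + 1/δ]` of `(0, ∞)`. -/
noncomputable def regArg (δ s : ℝ) : ℝ := δ + s / (1 + δ * s)

/-- The regularization `s ↦ q(regArg δ s) - q(δ)`. -/
noncomputable def regFun (q : ℝ → ℝ) (δ s : ℝ) : ℝ := q (regArg δ s) - q δ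

/-- The derivative of `regFun q δ`. -/
noncomputable def regDeriv (q : ℝ → ℝ) (δ s : ℝ) : ℝ :=
  deriv q (regArg δ s) * (1 / (1 + δ * s) ^ 2)

section reg

variable {δ s : ℝ}

theorem le_regArg (hδ : 0 < δ) (hs : 0 ≤ s) : δ ≤ regArg δ s := by
  have : 0 ≤ s / (1 + δ * s) := by positivity
  rw [regArg]; linarith

theorem regArg_le (hδ : 0 < δ) (hs : 0 ≤ s) : regArg δ s ≤ δ + 1 / δ := by
  rw [regArg]
  gcongr 1
  rw [div_le_div_iff₀ (by positivity) hδ]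
  linarith

theorem div_one_add_le (hδ : 0 < δ) (hs : 0 ≤ s) : s / (1 + δ * s) ≤ s :=
  div_le_self hs (by have : 0 ≤ δ * s := by positivity
                     linarith)

theorem hasDerivAt_regArg (hδ : 0 < δ) (hs : 0 ≤ s) :
    HasDerivAt (regArg δ) (1 / (1 + δ * s) ^ 2) s := by
  have h1 : HasDerivAt (fun s : ℝ => 1 + δ * s) δ s := by
    simpa using ((hasDerivAt_id s).const_mul δ).const_add 1
  have h0 : 1 + δ * s ≠ 0 := by positivity
  have h2 := ((hasDerivAt_id s).div h1 h0).const_add δ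
  refine h2.congr_deriv ?_
  simp only [id_eq]
  field_simp
  ring

theorem hasDerivAt_regFun {q : ℝ → ℝ} (hq1 : ContDiffOn ℝ 1 q (Ioi 0)) (hδ : 0 < δ) (hs : 0 ≤ s) :
    HasDerivAt (regFun q δ) (regDeriv q δ s) s := by
  have hpos : 0 < regArg δ s := hδ.trans_le (le_regArg hδ hs)
  have h1 : HasDerivAt q (deriv q (regArg δ s)) (regArg δ s) :=
    ((hq1.differentiableOn one_ne_zero).differentiableAt (Ioi_mem_nhds hpos)).hasDerivAt
  exact (h1.comp s (hasDerivAt_regArg hδ hs)).sub_const (q δ)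

theorem continuousOn_regDeriv {q : ℝ → ℝ} (hq1 : ContDiffOn ℝ 1 q (Ioi 0)) (hδ : 0 < δ) :
    ContinuousOn (regDeriv q δ) (Ici 0) := by
  have h1 : ContinuousOn (deriv q) (Ioi 0) := hq1.continuousOn_deriv_of_isOpen isOpen_Ioi le_rfl
  refine (h1.comp (fun s hs => (hasDerivAt_regArg hδ hs).continuousAt.continuousWithinAt)
    fun s hs => hδ.trans_le (le_regArg hδ hs)).mul ?_
  refine ContinuousOn.div (by fun_prop) (by fun_prop) fun s (hs : 0 ≤ s) => ?_
  positivity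

theorem exists_regFun_bound {q : ℝ → ℝ} (hq1 : ContDiffOn ℝ 1 q (Ioi 0)) (hδ : 0 < δ) :
    ∃ C, ∀ s, 0 ≤ s → |regFun q δ s| ≤ C ∧ |regDeriv q δ s| ≤ C := by
  have hsub : Icc δ (δ + 1 / δ) ⊆ Ioi 0 := fun t ht => hδ.trans_le ht.1
  obtain ⟨C1, hC1⟩ := isCompact_Icc.exists_bound_of_continuousOn (hq1.continuousOn.mono hsub)
  obtain ⟨C2, hC2⟩ := isCompact_Icc.exists_bound_of_continuousOn
    ((hq1.continuousOn_deriv_of_isOpen isOpen_Ioi le_rfl).mono hsub)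
  refine ⟨max (C1 + C1) C2, fun s hs => ⟨le_max_of_le_left ?_, le_max_of_le_right ?_⟩⟩
  · exact (abs_sub _ _).trans (add_le_add (hC1 _ ⟨le_regArg hδ hs, regArg_le hδ hs⟩)
      (hC1 _ ⟨le_rfl, by have : 0 < 1 / δ := by positivity
                         linarith⟩))
  · have h1 := hC2 _ ⟨le_regArg hδ hs, regArg_le hδ hs⟩
    rw [Real.norm_eq_abs] at h1
    rw [regDeriv, abs_mul]
    have h2 : |1 / (1 + δ * s) ^ 2| ≤ 1 := by
      rw [abs_of_nonneg (by positivity), div_le_one (by positivity)]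
      have : 0 ≤ δ * s := by positivity
      nlinarith
    calc _ ≤ |deriv q (regArg δ s)| * 1 := mul_le_mul_of_nonneg_left h2 (abs_nonneg _)
      _ ≤ C2 := by rwa [mul_one]

/-- Uniform in `δ ≤ 1`, with a right side vanishing at `r = 0`. For small `r` Bernoulli's inequality
makes the increment linear in `r`, hence at most of order `r^(1/2)`; for `r ≥ 1` the term `r^θ`
suffices. -/
theorem rpow_add_sub_rpow_le {θ r : ℝ} (hθ : 1 < θ) (hδ : 0 < δ) (hδ1 : δ ≤ 1) (hr : 0 ≤ r) :
    (δ + r) ^ θ - δ ^ θ ≤ θ * 2 ^ θ * (r ^ (1 / 2 : ℝ) + r ^ θ) := by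
  have h2 : (0 : ℝ) < 2 ^ θ := by positivity
  have hrθ : 0 ≤ r ^ θ := by positivity
  have hrh : 0 ≤ r ^ (1 / 2 : ℝ) := by positivity
  rcases le_total r 1 with h | h
  · have hx : 0 < δ + r := by positivity
    have hb := one_add_mul_self_le_rpow_one_add (s := -(r / (δ + r))) (p := θ) (by
      rw [neg_le_neg_iff, div_le_one hx]; linarith) hθ.le
    have e1 : (1 + -(r / (δ + r))) = δ / (δ + r) := by field_simp; ring
    rw [e1, Real.div_rpow hδ.le hx.le, le_div_iff₀ (by positivity)] at hb
    have h3 : (δ + r) ^ θ - δ ^ θ ≤ θ * (r / (δ + r)) * (δ + r) ^ θ := by linarith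
    have h4 : (δ + r) ^ θ = (δ + r) ^ (θ - 1) * (δ + r) := by
      rw [← Real.rpow_add_one hx.ne']; ring_nf
    have h5 : θ * (r / (δ + r)) * (δ + r) ^ θ = θ * (r * (δ + r) ^ (θ - 1)) := by
      rw [h4]; field_simp
    have h6 : (δ + r) ^ (θ - 1) ≤ 2 ^ θ :=
      (Real.rpow_le_rpow hx.le (by linarith : δ + r ≤ 2) (by linarith)).trans
        (Real.rpow_le_rpow_of_exponent_le (by norm_num) (by linarith))
    have h7 : r ≤ r ^ (1 / 2 : ℝ) := by
      have := Real.rpow_le_rpow_of_exponent_ge' hr h (by norm_num : (0 : ℝ) ≤ 1 / 2)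
        (by norm_num : (1 / 2 : ℝ) ≤ 1)
      rwa [Real.rpow_one] at this
    calc _ ≤ θ * (r * (δ + r) ^ (θ - 1)) := by rw [← h5]; exact h3
      _ ≤ θ * (r ^ (1 / 2 : ℝ) * 2 ^ θ) := by gcongr
      _ ≤ θ * 2 ^ θ * (r ^ (1 / 2 : ℝ) + r ^ θ) := by
        have : 0 ≤ θ * 2 ^ θ * r ^ θ := by positivity
        nlinarith
  · have h1 : (δ + r) ^ θ ≤ (2 * r) ^ θ := by gcongr; linarith
    rw [Real.mul_rpow (by norm_num) hr] at h1
    have h3 : 0 ≤ δ ^ θ := by positivity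
    have h4 : 0 ≤ 2 ^ θ * r ^ θ := by positivity
    have h5 : 0 ≤ θ * 2 ^ θ * r ^ (1 / 2 : ℝ) := by positivity
    nlinarith

/-- Subtracting `q δ` makes the regularization vanish at `0`, so that a bound with no constant term,
uniform in `δ`, is possible. A constant would not be integrable over the whole space. -/
theorem abs_regFun_le {q : ℝ → ℝ} {C θ : ℝ} (hθ : 1 < θ) (hC : 0 ≤ C)
    (hL : ∀ s t : ℝ, 0 ≤ s → 0 ≤ t →
      |q s - q t| ≤ C * (|s ^ (1 / 2 : ℝ) - t ^ (1 / 2 : ℝ)| + |s ^ θ - t ^ θ|))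
    (hδ : 0 < δ) (hδ1 : δ ≤ 1) (hs : 0 ≤ s) :
    |regFun q δ s| ≤ C * (1 + θ * 2 ^ θ) * (s ^ (1 / 2 : ℝ) + s ^ θ) := by
  set r := s / (1 + δ * s) with hr
  have hr0 : 0 ≤ r := by positivity
  have hrs : r ≤ s := div_one_add_le hδ hs
  have h1 := hL (δ + r) δ (by positivity) hδ.le
  rw [abs_of_nonneg (sub_nonneg.2 (Real.rpow_le_rpow hδ.le (by linarith) (by norm_num))),
    abs_of_nonneg (sub_nonneg.2 (Real.rpow_le_rpow hδ.le (by linarith) (by linarith)))] at h1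
  have h2 := Real.rpow_add_le_add_rpow hδ.le hr0 (p := 1 / 2) (by norm_num) (by norm_num)
  have h3 := rpow_add_sub_rpow_le hθ hδ hδ1 hr0
  have h4 : r ^ (1 / 2 : ℝ) ≤ s ^ (1 / 2 : ℝ) := by gcongr
  have h5 : r ^ θ ≤ s ^ θ := by gcongr
  have h6 : 0 ≤ s ^ θ := by positivity
  refine h1.trans ?_
  rw [mul_assoc]
  refine mul_le_mul_of_nonneg_left ?_ hC
  have h7 : θ * 2 ^ θ * (r ^ (1 / 2 : ℝ) + r ^ θ) ≤ θ * 2 ^ θ * (s ^ (1 / 2 : ℝ) + s ^ θ) := by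
    gcongr
  linarith

theorem one_add_rpow_mul_le {θ : ℝ} (hθ : 1 < θ) (hs : 0 ≤ s) :
    (1 + s) ^ (θ - 1) * s ≤ 2 ^ θ * (s ^ (1 / 2 : ℝ) + s ^ θ) := by
  have hθs : 0 ≤ s ^ θ := by positivity
  have hhs : 0 ≤ s ^ (1 / 2 : ℝ) := by positivity
  have h2 : (2 : ℝ) ^ (θ - 1) ≤ 2 ^ θ :=
    Real.rpow_le_rpow_of_exponent_le (by norm_num) (by linarith)
  rcases le_total s 1 with h | h
  · have h7 : s ≤ s ^ (1 / 2 : ℝ) := by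
      have := Real.rpow_le_rpow_of_exponent_ge' hs h (by norm_num : (0 : ℝ) ≤ 1 / 2)
        (by norm_num : (1 / 2 : ℝ) ≤ 1)
      rwa [Real.rpow_one] at this
    have h1 : (1 + s) ^ (θ - 1) ≤ 2 ^ (θ - 1) := by gcongr; linarith
    exact mul_le_mul (h1.trans h2) (by linarith) hs (by positivity)
  · have h1 : (1 + s) ^ (θ - 1) ≤ (2 * s) ^ (θ - 1) := by gcongr; linarith
    rw [Real.mul_rpow (by norm_num) hs] at h1
    calc (1 + s) ^ (θ - 1) * s ≤ (2 ^ (θ - 1) * s ^ (θ - 1)) * s := by gcongr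
      _ = 2 ^ (θ - 1) * s ^ θ := by
        rw [mul_assoc, ← Real.rpow_add_one (by linarith)]; ring_nf
      _ ≤ 2 ^ θ * (s ^ (1 / 2 : ℝ) + s ^ θ) := by gcongr; linarith

/-- The hypothesis is used at `s^(1/2)` and then squared, which restores the original exponents.
Squaring the other bound on `q'` would only give `q'(s)^2 s` of order `1 + s^(2θ-1)`. -/
theorem deriv_sq_le {q : ℝ → ℝ} {C θ : ℝ}
    (h : ∀ s : ℝ, 0 < s → |deriv q (s ^ 2)| ≤ C * (s ^ (-(1 / 2) : ℝ) + s ^ (θ - 1)))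
    (hs : 0 < s) : deriv q s ^ 2 ≤ 2 * C ^ 2 * (s ^ (-(1 / 2) : ℝ) + s ^ (θ - 1)) := by
  have h1 := h (s ^ (1 / 2 : ℝ)) (by positivity)
  have e : (s ^ (1 / 2 : ℝ)) ^ 2 = s := by
    rw [← Real.rpow_natCast, ← Real.rpow_mul hs.le]; norm_num
  rw [e] at h1
  have e1 : ((s ^ (1 / 2 : ℝ)) ^ (-(1 / 2) : ℝ)) ^ 2 = s ^ (-(1 / 2) : ℝ) := by
    rw [← Real.rpow_natCast, ← Real.rpow_mul hs.le, ← Real.rpow_mul hs.le]; norm_num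
  have e2 : ((s ^ (1 / 2 : ℝ)) ^ (θ - 1)) ^ 2 = s ^ (θ - 1) := by
    rw [← Real.rpow_natCast, ← Real.rpow_mul hs.le, ← Real.rpow_mul hs.le]
    congr 1; push_cast; ring
  set a := (s ^ (1 / 2 : ℝ)) ^ (-(1 / 2) : ℝ)
  set b := (s ^ (1 / 2 : ℝ)) ^ (θ - 1)
  rw [← e1, ← e2, ← sq_abs]
  calc |deriv q s| ^ 2 ≤ (C * (a + b)) ^ 2 := pow_le_pow_left₀ (abs_nonneg _) h1 2
    _ = C ^ 2 * (a + b) ^ 2 := by ring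
    _ ≤ C ^ 2 * (2 * (a ^ 2 + b ^ 2)) := by gcongr; nlinarith [sq_nonneg (a - b)]
    _ = _ := by ring

theorem deriv_sq_mul_le {q : ℝ → ℝ} {D θ : ℝ}
    (h : ∀ s : ℝ, 0 < s → deriv q s ^ 2 ≤ D * (s ^ (-(1 / 2) : ℝ) + s ^ (θ - 1)))
    (hs : 0 < s) : deriv q s ^ 2 * s ≤ D * (s ^ (1 / 2 : ℝ) + s ^ θ) := by
  have e1 : s ^ (1 / 2 : ℝ) = s ^ (-(1 / 2) : ℝ) * s := by
    rw [← Real.rpow_add_one hs.ne']; norm_num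
  have e2 : s ^ θ = s ^ (θ - 1) * s := by
    rw [← Real.rpow_add_one hs.ne']; ring_nf
  rw [e1, e2, ← add_mul, ← mul_assoc]
  exact mul_le_mul_of_nonneg_right (h s hs) hs.le

/-- The inner derivative `1/p²` compensates for `regArg δ s` being smaller than `s` when `δ s` is
large, so the bound survives the regularization uniformly in `δ`. -/
theorem regDeriv_sq_mul_le {q : ℝ → ℝ} {D θ : ℝ} (hθ : 1 < θ) (hD : 0 ≤ D)
    (h : ∀ s : ℝ, 0 < s → deriv q s ^ 2 ≤ D * (s ^ (-(1 / 2) : ℝ) + s ^ (θ - 1)))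
    (hδ : 0 < δ) (hδ1 : δ ≤ 1) (hs : 0 < s) :
    regDeriv q δ s ^ 2 * s ≤ D * (1 + 2 ^ θ) * (s ^ (1 / 2 : ℝ) + s ^ θ) := by
  set t := regArg δ s with ht
  set p := 1 + δ * s with hp
  have hp1 : 1 ≤ p := by
    have : 0 ≤ δ * s := by positivity
    linarith
  have hp0 : 0 < p := by linarith
  have ht0 : 0 < t := hδ.trans_le (le_regArg hδ hs.le)
  have hrt : s / p ≤ t := by rw [ht, regArg]; linarith
  have ht1 : t ≤ 1 + s := by
    rw [ht, regArg]; linarith [div_one_add_le hδ hs.le]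
  have h1 : t ^ (-(1 / 2) : ℝ) ≤ (s / p) ^ (-(1 / 2) : ℝ) :=
    Real.rpow_le_rpow_of_nonpos (by positivity) hrt (by norm_num)
  have h2 : t ^ (θ - 1) ≤ (1 + s) ^ (θ - 1) := Real.rpow_le_rpow ht0.le ht1 (by linarith)
  have h3 : (s / p) ^ (-(1 / 2) : ℝ) * (1 / p ^ 2) ^ 2 * s ≤ s ^ (1 / 2 : ℝ) := by
    rw [Real.div_rpow hs.le hp0.le]
    have e1 : s ^ (1 / 2 : ℝ) = s ^ (-(1 / 2) : ℝ) * s := by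
      rw [← Real.rpow_add_one hs.ne']; norm_num
    -- The exponent is `4 - 1/2`: the inner derivative squared gives `p^(-4)`, and `(s / p)^(-1/2)`
    -- returns `p^(1/2)`.
    have e2 : p ^ (-(1 / 2) : ℝ) * (p ^ 2) ^ 2 = p ^ (7 / 2 : ℝ) := by
      rw [← pow_mul, ← Real.rpow_natCast, ← Real.rpow_add hp0]; norm_num
    have e3 : 1 ≤ p ^ (7 / 2 : ℝ) := Real.one_le_rpow hp1 (by norm_num)
    have e4 : s ^ (-(1 / 2) : ℝ) / p ^ (-(1 / 2) : ℝ) * (1 / p ^ 2) ^ 2 * s =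
        s ^ (1 / 2 : ℝ) / p ^ (7 / 2 : ℝ) := by
      rw [← e2, e1]; field_simp
    rw [e4]
    exact div_le_self (by positivity) e3
  have h4 : (1 / p ^ 2) ^ 2 ≤ 1 := by
    have : 1 / p ^ 2 ≤ 1 := by
      rw [div_le_one (by positivity)]; nlinarith
    exact pow_le_one₀ (by positivity) this
  have h5 := one_add_rpow_mul_le hθ hs.le
  have h6 : 0 ≤ s ^ θ := by positivity
  calc regDeriv q δ s ^ 2 * s = deriv q t ^ 2 * ((1 / p ^ 2) ^ 2 * s) := by rw [regDeriv]; ring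
    _ ≤ D * (t ^ (-(1 / 2) : ℝ) + t ^ (θ - 1)) * ((1 / p ^ 2) ^ 2 * s) := by
        gcongr
        exact h t ht0
    _ ≤ D * ((s / p) ^ (-(1 / 2) : ℝ) + (1 + s) ^ (θ - 1)) * ((1 / p ^ 2) ^ 2 * s) := by gcongr
    _ = D * ((s / p) ^ (-(1 / 2) : ℝ) * (1 / p ^ 2) ^ 2 * s +
          (1 + s) ^ (θ - 1) * s * (1 / p ^ 2) ^ 2) := by ring
    _ ≤ D * (s ^ (1 / 2 : ℝ) + (1 + s) ^ (θ - 1) * s * 1) := by gcongr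
    _ ≤ D * (s ^ (1 / 2 : ℝ) + 2 ^ θ * (s ^ (1 / 2 : ℝ) + s ^ θ)) := by
        rw [mul_one]; gcongr
    _ ≤ _ := by
        rw [mul_assoc]
        refine mul_le_mul_of_nonneg_left ?_ hD
        linarith

theorem tendsto_regArg (s : ℝ) :
    Tendsto (fun j : ℕ => regArg (1 / ((j : ℝ) + 1)) s) atTop (𝓝 s) := by
  have h := tendsto_one_div_add_atTop_nhds_zero_nat (𝕜 := ℝ)
  have h1 : Tendsto (fun j : ℕ => s / (1 + 1 / ((j : ℝ) + 1) * s)) atTop (𝓝 (s / (1 + 0 * s))) :=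
    Tendsto.div tendsto_const_nhds ((h.mul_const s).const_add 1) (by simp)
  have h2 := h.add h1
  simpa [regArg] using h2

theorem tendsto_regFun {q : ℝ → ℝ} (hq0 : ContinuousOn q (Ici 0)) (hq : q 0 = 0) (hs : 0 ≤ s) :
    Tendsto (fun j : ℕ => regFun q (1 / ((j : ℝ) + 1)) s) atTop (𝓝 (q s)) := by
  have h := tendsto_one_div_add_atTop_nhds_zero_nat (𝕜 := ℝ)
  have h1 : Tendsto (fun j : ℕ => q (regArg (1 / ((j : ℝ) + 1)) s)) atTop (𝓝 (q s)) :=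
    (hq0 s hs).tendsto.comp (tendsto_nhdsWithin_iff.2 ⟨tendsto_regArg s,
      Eventually.of_forall fun j => by
        have hj : (0 : ℝ) < 1 / ((j : ℝ) + 1) := by positivity
        exact hj.le.trans (le_regArg hj hs)⟩)
  have h2 : Tendsto (fun j : ℕ => q (1 / ((j : ℝ) + 1))) atTop (𝓝 (q 0)) :=
    (hq0 0 self_mem_Ici).tendsto.comp (tendsto_nhdsWithin_iff.2 ⟨h,
      Eventually.of_forall fun j => by
        have hj : (0 : ℝ) < 1 / ((j : ℝ) + 1) := by positivity
        exact hj.le⟩)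
  have h3 := h1.sub h2
  rwa [hq, sub_zero] at h3

theorem tendsto_regDeriv {q : ℝ → ℝ} (hq1 : ContDiffOn ℝ 1 q (Ioi 0)) (hs : 0 < s) :
    Tendsto (fun j : ℕ => regDeriv q (1 / ((j : ℝ) + 1)) s) atTop (𝓝 (deriv q s)) := by
  have h := tendsto_one_div_add_atTop_nhds_zero_nat (𝕜 := ℝ)
  have hc : ContinuousAt (deriv q) s :=
    (hq1.continuousOn_deriv_of_isOpen isOpen_Ioi le_rfl).continuousAt (Ioi_mem_nhds hs)
  have h1 := hc.tendsto.comp (tendsto_regArg s)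
  have h2 : Tendsto (fun j : ℕ => 1 / (1 + 1 / ((j : ℝ) + 1) * s) ^ 2) atTop
      (𝓝 (1 / (1 + 0 * s) ^ 2)) :=
    Tendsto.div tendsto_const_nhds (((h.mul_const s).const_add 1).pow 2) (by simp)
  have h3 := h1.mul h2
  simpa [regDeriv, Function.comp_def] using h3

end reg

/-! ### Cutoff functions -/

/-- A continuous cutoff function, equal to `1` on the ball of radius `j`. -/
noncomputable def cutoff (d j : ℕ) (x : Rd d) : ℝ := max 0 (min 1 ((j : ℝ) + 1 - ‖x‖))

theorem continuous_cutoff (j : ℕ) : Continuous (cutoff d j) := by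
  unfold cutoff; fun_prop

theorem cutoff_nonneg (j : ℕ) (x : Rd d) : 0 ≤ cutoff d j x := le_max_left _ _

theorem abs_cutoff_le (j : ℕ) (x : Rd d) : |cutoff d j x| ≤ 1 := by
  rw [abs_of_nonneg (cutoff_nonneg j x)]
  exact max_le zero_le_one (min_le_left _ _)

theorem hasCompactSupport_cutoff (j : ℕ) : HasCompactSupport (cutoff d j) := by
  refine HasCompactSupport.intro (isCompact_closedBall 0 ((j : ℝ) + 1)) fun x hx => ?_
  rw [mem_closedBall_zero_iff, not_le] at hx
  exact max_eq_left ((min_le_right _ _).trans (by linarith))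

theorem tendsto_cutoff (x : Rd d) : Tendsto (fun j => cutoff d j x) atTop (𝓝 1) := by
  obtain ⟨N, hN⟩ := exists_nat_ge ‖x‖
  refine tendsto_const_nhds.congr' ?_
  filter_upwards [eventually_ge_atTop N] with j hj
  have : (N : ℝ) ≤ j := by exact_mod_cast hj
  rw [cutoff, min_eq_left (by linarith), max_eq_right zero_le_one]

/-- A smooth function equal to `1` on `(-∞, 1]` and to `0` on `[2, ∞)`. -/
noncomputable def smoothStep (t : ℝ) : ℝ := Real.smoothTransition (2 - t)

theorem contDiff_smoothStep : ContDiff ℝ 1 smoothStep :=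
  (Real.smoothTransition.contDiff (n := 1)).comp (contDiff_const.sub contDiff_id)

theorem deriv_smoothStep_eq_zero {t : ℝ} (ht : 2 < t) : deriv smoothStep t = 0 := by
  have : smoothStep =ᶠ[𝓝 t] fun _ => 0 := by
    filter_upwards [Ioi_mem_nhds ht] with s (hs : 2 < s)
    exact Real.smoothTransition.zero_of_nonpos (by linarith)
  rw [this.deriv_eq, deriv_const]

theorem exists_abs_deriv_smoothStep_le : ∃ C, ∀ t, |deriv smoothStep t| ≤ C := by
  have hc : HasCompactSupport (deriv smoothStep) := by
    refine HasCompactSupport.intro (isCompact_Icc (a := 1) (b := 2)) fun t ht => ?_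
    rcases lt_or_ge 2 t with h | h
    · exact deriv_smoothStep_eq_zero h
    · have h1 : t < 1 := by
        by_contra! h1
        exact ht ⟨h1, h⟩
      have : smoothStep =ᶠ[𝓝 t] fun _ => 1 := by
        filter_upwards [Iio_mem_nhds h1] with s (hs : s < 1)
        exact Real.smoothTransition.one_of_one_le (by linarith)
      rw [this.deriv_eq, deriv_const]
  exact hc.exists_bound_of_continuous (contDiff_smoothStep.continuous_deriv le_rfl)

/-- The truncated functionals which approximate `β_{q,φ}`. -/
theorem exists_truncatedFunctional {q : ℝ → ℝ} (hq1 : ContDiffOn ℝ 1 q (Ioi 0)) {φ : Rd d → ℝ}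
    (hφ : Continuous φ) (j : ℕ) :
    ∃ T : TruncatedFunctional d, T.χ = cutoff d j ∧ (T.g = fun x => φ x * cutoff d j x) ∧
      T.Q = regFun q (1 / ((j : ℝ) + 1)) ∧ T.Q' = regDeriv q (1 / ((j : ℝ) + 1)) ∧
      (T.ψ = fun t => smoothStep (t / ((j : ℝ) + 1))) ∧
      (T.ψ' = fun t => deriv smoothStep (t / ((j : ℝ) + 1)) / ((j : ℝ) + 1)) := by
  have hj : (0 : ℝ) < (j : ℝ) + 1 := by positivity
  have hδ : (0 : ℝ) < 1 / ((j : ℝ) + 1) := by positivity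
  have hg : Continuous fun x => φ x * cutoff d j x := hφ.mul (continuous_cutoff j)
  obtain ⟨C1, hC1⟩ := ((hasCompactSupport_cutoff j).mul_left (f := φ)).exists_bound_of_continuous hg
  obtain ⟨C2, hC2⟩ := exists_regFun_bound hq1 hδ
  obtain ⟨C3, hC3⟩ := exists_abs_deriv_smoothStep_le
  have h1 : 0 ≤ C1 := (norm_nonneg _).trans (hC1 0)
  have h2 : 0 ≤ C2 := (abs_nonneg _).trans (hC2 0 le_rfl).1
  have h3 : 0 ≤ C3 := (abs_nonneg _).trans (hC3 0)
  refine ⟨{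
    χ := cutoff d j
    g := fun x => φ x * cutoff d j x
    Q := regFun q (1 / ((j : ℝ) + 1))
    Q' := regDeriv q (1 / ((j : ℝ) + 1))
    ψ := fun t => smoothStep (t / ((j : ℝ) + 1))
    ψ' := fun t => deriv smoothStep (t / ((j : ℝ) + 1)) / ((j : ℝ) + 1)
    M := 1 + C1 + C2 + C3
    -- The factor `3` instead of `2` leaves strict room: the derivative of the step function is
    -- known to vanish only strictly beyond `2`.
    B := 3 * ((j : ℝ) + 1)
    hM := by positivity
    hB := by positivity
    continuous_χ := continuous_cutoff j
    hasCompactSupport_χ := hasCompactSupport_cutoff j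
    abs_χ_le := abs_cutoff_le j
    continuous_g := hg
    abs_g_le := fun x => (hC1 x).trans (by linarith)
    hasDeriv_Q := fun s hs => (hasDerivAt_regFun hq1 hδ hs).hasDerivWithinAt
    continuousOn_Q' := continuousOn_regDeriv hq1 hδ
    abs_Q_le := fun s hs => (hC2 s hs).1.trans (by linarith)
    abs_Q'_le := fun s hs => (hC2 s hs).2.trans (by linarith)
    hasDeriv_ψ := fun t => ?_
    continuous_ψ' := ?_
    abs_ψ_le := fun t => ?_
    abs_ψ'_le := fun t => ?_
    ψ_eq_zero := fun t ht => ?_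
    ψ'_eq_zero := fun t ht => ?_ }, rfl, rfl, rfl, rfl, rfl, rfl⟩
  · have h4 := (contDiff_smoothStep.differentiable one_ne_zero (t / ((j : ℝ) + 1))).hasDerivAt
    have h5 := h4.comp t ((hasDerivAt_id t).div_const ((j : ℝ) + 1))
    refine h5.congr_deriv ?_
    ring
  · exact ((contDiff_smoothStep.continuous_deriv le_rfl).comp
      (continuous_id.div_const _)).div_const _
  · rw [smoothStep, abs_of_nonneg (Real.smoothTransition.nonneg _)]
    linarith [Real.smoothTransition.le_one (2 - t / ((j : ℝ) + 1))]
  · rw [abs_div, abs_of_pos hj]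
    refine (div_le_self (abs_nonneg _) (by linarith [j.cast_nonneg (α := ℝ)])).trans ?_
    linarith [hC3 (t / ((j : ℝ) + 1))]
  · refine Real.smoothTransition.zero_of_nonpos ?_
    rw [sub_nonpos, le_div_iff₀ hj]
    linarith
  · rw [deriv_smoothStep_eq_zero, zero_div]
    rw [lt_div_iff₀ hj]
    linarith

/-! ### Passage from truncated functionals to `β_{q,φ}`. -/

/-- The integrand of `niceMass`, in terms of the jointly measurable density. -/
noncomputable def niceDens (k θ : ℝ) (μ : Mac d) (x : Rd d) : ℝ :=
  μ.jdens x ^ (1 / 2 : ℝ) + μ.jdens x ^ θ + (1 + ‖x‖ ^ (2 * k)) * μ.jdens x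

theorem niceDens_nonneg (k θ : ℝ) (μ : Mac d) (x : Rd d) : 0 ≤ niceDens k θ μ x := by
  have := μ.jdens_nonneg x
  rw [niceDens]
  positivity

theorem measurable_niceDens (k θ : ℝ) : Measurable fun p : Mac d × Rd d => niceDens k θ p.1 p.2 := by
  have h : Measurable fun p : Mac d × Rd d => p.1.jdens p.2 := Mac.measurable_jdens
  unfold niceDens
  fun_prop

theorem niceMass_eq (k θ : ℝ) (μ : Mac d) :
    niceMass k θ μ = ∫⁻ x, ENNReal.ofReal (niceDens k θ μ x) := by
  refine lintegral_congr_ae ?_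
  filter_upwards [μ.jdens_ae_eq] with x hx
  rw [niceDens, hx]

theorem measurable_niceMass (k θ : ℝ) : Measurable (niceMass (d := d) k θ) := by
  have h : niceMass (d := d) k θ = fun μ => ∫⁻ x, ENNReal.ofReal (niceDens k θ μ x) :=
    funext fun μ => niceMass_eq k θ μ
  rw [h]
  exact Measurable.lintegral_prod_right' (f := fun p : Mac d × Rd d =>
    ENNReal.ofReal (niceDens k θ p.1 p.2)) (measurable_niceDens k θ).ennreal_ofReal

theorem measurable_niceDens_apply (k θ : ℝ) (μ : Mac d) : Measurable (niceDens k θ μ) := by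
  have := μ.measurable_jdens_apply
  unfold niceDens
  fun_prop

theorem integrable_niceDens {k θ : ℝ} {μ : Mac d} (h : niceMass k θ μ ≠ ∞) :
    Integrable (niceDens k θ μ) := by
  rw [niceMass_eq] at h
  exact (lintegral_ofReal_ne_top_iff_integrable
    (measurable_niceDens_apply k θ μ).aestronglyMeasurable
    (Eventually.of_forall (niceDens_nonneg k θ μ))).1 h

theorem niceDensity_of_niceMass {k θ : ℝ} {μ : Mac d} (h : niceMass k θ μ ≠ ∞) :
    NiceDensity k θ μ := by
  refine (integrable_niceDens h).congr ?_
  filter_upwards [μ.jdens_ae_eq] with x hx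
  rw [niceDens, hx]
  ring

/-- The functional `β_{q,φ}`, as a measurable function on `𝕄ᵃᶜ`. -/
noncomputable def betaReal (q : ℝ → ℝ) (φ : Rd d → ℝ) (μ : Mac d) : ℝ :=
  ∫ x, (q (μ.jdens x) + φ x * μ.jdens x)

/-- The candidate for the weak extrinsic derivative of `β_{q,φ}`. -/
noncomputable def betaGrad (q : ℝ → ℝ) (φ : Rd d → ℝ) (μ : Mac d) (x : Rd d) : ℝ :=
  deriv q (μ.jdens x) + φ x

theorem measurable_betaReal {q : ℝ → ℝ} (hq0 : ContinuousOn q (Ici 0)) {φ : Rd d → ℝ}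
    (hφ : Continuous φ) : Measurable (betaReal q φ) := by
  have h1 : Measurable fun p : Mac d × Rd d => q (p.1.jdens p.2) :=
    measurable_comp_of_continuousOn_Ici hq0 Mac.measurable_jdens fun p => p.1.jdens_nonneg _
  have h2 : Measurable fun p : Mac d × Rd d => q (p.1.jdens p.2) + φ p.2 * p.1.jdens p.2 :=
    h1.add ((hφ.measurable.comp measurable_snd).mul Mac.measurable_jdens)
  exact (StronglyMeasurable.integral_prod_right' (f := fun p : Mac d × Rd d =>
    q (p.1.jdens p.2) + φ p.2 * p.1.jdens p.2) h2.stronglyMeasurable).measurable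

theorem measurable_betaGrad (q : ℝ → ℝ) {φ : Rd d → ℝ} (hφ : Continuous φ) :
    Measurable fun p : Mac d × Rd d => betaGrad q φ p.1 p.2 :=
  ((measurable_deriv q).comp Mac.measurable_jdens).add (hφ.measurable.comp measurable_snd)

theorem toReal_betaFun {q : ℝ → ℝ} {φ : Rd d → ℝ} {μ : Mac d}
    (h : Integrable fun x => q (μ.dens x) + φ x * μ.dens x) :
    (betaFun q φ μ).toReal = betaReal q φ μ := by
  rw [betaFun, if_pos h, EReal.toReal_coe]
  refine integral_congr_ae ?_
  filter_upwards [μ.jdens_ae_eq] with x hx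
  rw [hx]

theorem Mac.integral_toM_jdens (μ : Mac d) (f : Rd d → ℝ) :
    ∫ x, f x ∂μ.toM = ∫ x, μ.jdens x * f x := by
  rw [μ.integral_toM]
  refine integral_congr_ae ?_
  filter_upwards [μ.jdens_ae_eq] with x hx
  rw [hx]

/-- Uniform bounds and pointwise convergence of a sequence of truncated functionals to the
functional `β_{q,φ}`. -/
structure IsApproximation (k θ C : ℝ) (q : ℝ → ℝ) (φ : Rd d → ℝ) (T : ℕ → TruncatedFunctional d) :
    Prop where
  nonneg : 0 ≤ C
  abs_q_le : ∀ s, 0 ≤ s → |q s| ≤ C * (s ^ (1 / 2 : ℝ) + s ^ θ)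
  deriv_q_sq_le : ∀ s, 0 < s → deriv q s ^ 2 * s ≤ C * (s ^ (1 / 2 : ℝ) + s ^ θ)
  abs_φ_le : ∀ x, |φ x| ≤ C * (1 + ‖x‖ ^ (2 * k))
  φ_sq_le : ∀ x, φ x ^ 2 ≤ C * (1 + ‖x‖ ^ (2 * k))
  abs_Q_le : ∀ j x s, 0 ≤ s → |(T j).χ x * (T j).Q s| ≤ C * (s ^ (1 / 2 : ℝ) + s ^ θ)
  Q'_sq_le : ∀ j x s, 0 < s → ((T j).χ x * (T j).Q' s) ^ 2 * s ≤ C * (s ^ (1 / 2 : ℝ) + s ^ θ)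
  abs_g_le : ∀ j x, |(T j).g x| ≤ |φ x|
  abs_ψ_le : ∀ j t, |(T j).ψ t| ≤ 1
  -- The factor `t` stands for the total mass, which arises when a term constant in `x` is squared
  -- and integrated against `μ`.
  ψ'_sq_le : ∀ j t, 0 ≤ t → (T j).ψ' t ^ 2 * t ≤ C
  tendsto_Q : ∀ x s, 0 ≤ s → Tendsto (fun j => (T j).χ x * (T j).Q s) atTop (𝓝 (q s))
  tendsto_Q' : ∀ x s, 0 < s → Tendsto (fun j => (T j).χ x * (T j).Q' s) atTop (𝓝 (deriv q s))
  tendsto_g : ∀ x, Tendsto (fun j => (T j).g x) atTop (𝓝 (φ x))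
  tendsto_ψ : ∀ t, Tendsto (fun j => (T j).ψ t) atTop (𝓝 1)
  tendsto_ψ' : ∀ t, Tendsto (fun j => (T j).ψ' t) atTop (𝓝 0)

namespace IsApproximation

variable {k θ C : ℝ} {q : ℝ → ℝ} {φ : Rd d → ℝ} {T : ℕ → TruncatedFunctional d}
  (h : IsApproximation k θ C q φ T)

include h

theorem rpow_le (μ : Mac d) (x : Rd d) :
    C * (μ.jdens x ^ (1 / 2 : ℝ) + μ.jdens x ^ θ) ≤ C * niceDens k θ μ x := by
  have h0 := μ.jdens_nonneg x
  refine mul_le_mul_of_nonneg_left ?_ h.nonneg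
  have : 0 ≤ (1 + ‖x‖ ^ (2 * k)) * μ.jdens x := by positivity
  rw [niceDens]; linarith

theorem weight_le (μ : Mac d) (x : Rd d) :
    C * (1 + ‖x‖ ^ (2 * k)) * μ.jdens x ≤ C * niceDens k θ μ x := by
  have h0 := μ.jdens_nonneg x
  rw [mul_assoc]
  refine mul_le_mul_of_nonneg_left ?_ h.nonneg
  have h1 : 0 ≤ μ.jdens x ^ (1 / 2 : ℝ) := by positivity
  have h2 : 0 ≤ μ.jdens x ^ θ := by positivity
  rw [niceDens]; linarith

theorem abs_Q_jdens_le (j : ℕ) (μ : Mac d) (x : Rd d) :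
    |(T j).χ x * (T j).Q (μ.jdens x)| ≤ C * niceDens k θ μ x :=
  (h.abs_Q_le j x _ (μ.jdens_nonneg x)).trans (h.rpow_le μ x)

theorem jdens_mul_abs_le {a : ℝ} (μ : Mac d) (x : Rd d) (ha : |a| ≤ |φ x|) :
    |μ.jdens x * a| ≤ C * niceDens k θ μ x := by
  rw [abs_mul, abs_of_nonneg (μ.jdens_nonneg x), mul_comm]
  exact (mul_le_mul_of_nonneg_right (ha.trans (h.abs_φ_le x)) (μ.jdens_nonneg x)).trans
    (h.weight_le μ x)

theorem enorm_integral_le {f : Rd d → ℝ} (μ : Mac d)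
    (hf : ∀ x, |f x| ≤ C * niceDens k θ μ x) :
    ‖∫ x, f x‖ₑ ≤ ENNReal.ofReal C * niceMass k θ μ := by
  rw [niceMass_eq, ← lintegral_const_mul' _ _ ENNReal.ofReal_ne_top]
  refine (enorm_integral_le_lintegral_enorm _).trans (lintegral_mono fun x => ?_)
  rw [Real.enorm_eq_ofReal_abs, ← ENNReal.ofReal_mul h.nonneg]
  exact ENNReal.ofReal_le_ofReal (hf x)

theorem enorm_limInner_le (j : ℕ) (μ : Mac d) :
    ‖(T j).limInner μ‖ₑ ≤ 2 * ENNReal.ofReal C * niceMass k θ μ := by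
  rw [TruncatedFunctional.limInner, μ.integral_toM_jdens]
  refine (enorm_add_le _ _).trans ?_
  rw [mul_assoc, two_mul]
  exact add_le_add (h.enorm_integral_le μ (h.abs_Q_jdens_le j μ))
    (h.enorm_integral_le μ fun x => h.jdens_mul_abs_le μ x (h.abs_g_le j x))

theorem tendsto_limInner (hq0 : ContinuousOn q (Ici 0)) (hφ : Continuous φ) {μ : Mac d}
    (hμ : niceMass k θ μ ≠ ∞) :
    Tendsto (fun j => (T j).limInner μ) atTop (𝓝 (betaReal q φ μ)) := by
  have hF := (integrable_niceDens hμ).const_mul C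
  have hm := μ.measurable_jdens_apply
  have hmq := measurable_comp_of_continuousOn_Ici hq0 hm μ.jdens_nonneg
  have h1 : Tendsto (fun j => ∫ x, (T j).χ x * (T j).Q (μ.jdens x)) atTop
      (𝓝 (∫ x, q (μ.jdens x))) := by
    refine tendsto_integral_of_dominated_convergence (fun x => C * niceDens k θ μ x) (fun j => ?_)
      hF (fun j => Eventually.of_forall (h.abs_Q_jdens_le j μ))
      (Eventually.of_forall fun x => h.tendsto_Q x _ (μ.jdens_nonneg x))
    exact ((T j).continuous_χ.measurable.mul (measurable_comp_of_continuousOn_Ici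
      (T j).continuousOn_Q hm μ.jdens_nonneg)).aestronglyMeasurable
  have h2 : Tendsto (fun j => ∫ x, μ.jdens x * (T j).g x) atTop
      (𝓝 (∫ x, μ.jdens x * φ x)) := by
    refine tendsto_integral_of_dominated_convergence (fun x => C * niceDens k θ μ x) (fun j => ?_)
      hF (fun j => Eventually.of_forall fun x => h.jdens_mul_abs_le μ x (h.abs_g_le j x))
      (Eventually.of_forall fun x => (h.tendsto_g x).const_mul _)
    exact (hm.mul (T j).continuous_g.measurable).aestronglyMeasurable
  have h3 : betaReal q φ μ = (∫ x, q (μ.jdens x)) + ∫ x, μ.jdens x * φ x := by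
    rw [betaReal, ← integral_add]
    · refine integral_congr_ae (Eventually.of_forall fun x => ?_)
      simp only
      ring
    · exact hF.mono' hmq.aestronglyMeasurable (Eventually.of_forall fun x =>
        (h.abs_q_le _ (μ.jdens_nonneg x)).trans (h.rpow_le μ x))
    · exact hF.mono' (hm.mul hφ.measurable).aestronglyMeasurable
        (Eventually.of_forall fun x => h.jdens_mul_abs_le μ x le_rfl)
  rw [h3]
  refine (h1.add h2).congr fun j => ?_
  rw [TruncatedFunctional.limInner, μ.integral_toM_jdens]

theorem enorm_betaReal_le (hq0 : ContinuousOn q (Ici 0)) (hφ : Continuous φ) {μ : Mac d}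
    (hμ : niceMass k θ μ ≠ ∞) :
    ‖betaReal q φ μ‖ₑ ≤ 2 * ENNReal.ofReal C * niceMass k θ μ :=
  le_of_tendsto (h.tendsto_limInner hq0 hφ hμ).enorm
    (Eventually.of_forall fun j => h.enorm_limInner_le j μ)

/-- The square is at most `4` times the sum of the squares of four terms, each bounded by `C *
niceDens` after multiplication by the density; hence `16`. Where the density vanishes so does the
left side, so nothing about `q'` at `0` is needed. -/
theorem jdens_mul_sq_le (j : ℕ) (μ : Mac d) (x : Rd d) {t : ℝ} :
    μ.jdens x * ((T j).ψ t * ((T j).χ x * (T j).Q' (μ.jdens x) + (T j).g x) -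
      betaGrad q φ μ x) ^ 2 ≤ 16 * C * niceDens k θ μ x := by
  have h0 := μ.jdens_nonneg x
  have hn := mul_nonneg h.nonneg (niceDens_nonneg k θ μ x)
  rcases h0.eq_or_lt with he | hpos
  · rw [← he, zero_mul]; linarith
  have hQ := (h.Q'_sq_le j x _ hpos).trans (h.rpow_le μ x)
  have hq := (h.deriv_q_sq_le _ hpos).trans (h.rpow_le μ x)
  have hφ := (mul_le_mul_of_nonneg_right (h.φ_sq_le x) h0).trans (h.weight_le μ x)
  have hg : (T j).g x ^ 2 ≤ φ x ^ 2 := sq_le_sq.2 (h.abs_g_le j x)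
  have hg2 := mul_le_mul_of_nonneg_right hg h0
  have hψ : (T j).ψ t ^ 2 ≤ 1 := by
    rw [← sq_abs]; exact pow_le_one₀ (abs_nonneg _) (h.abs_ψ_le j t)
  rw [betaGrad]
  set s := μ.jdens x
  set a := (T j).χ x * (T j).Q' s
  set g := (T j).g x
  set p := (T j).ψ t
  set b := deriv q s
  set f := φ x
  set R := C * niceDens k θ μ x
  have h1 : (p * (a + g) - (b + f)) ^ 2 ≤ 4 * (a ^ 2 + g ^ 2 + b ^ 2 + f ^ 2) := by
    have h2 : (p * (a + g)) ^ 2 ≤ (a + g) ^ 2 := by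
      rw [mul_pow]
      exact mul_le_of_le_one_left (sq_nonneg _) hψ
    nlinarith [sq_nonneg (p * (a + g) + (b + f)), sq_nonneg (a - g), sq_nonneg (b - f)]
  calc s * (p * (a + g) - (b + f)) ^ 2 ≤ s * (4 * (a ^ 2 + g ^ 2 + b ^ 2 + f ^ 2)) := by gcongr
    _ = 4 * (a ^ 2 * s + g ^ 2 * s + b ^ 2 * s + f ^ 2 * s) := by ring
    _ ≤ 4 * (R + R + R + R) := by gcongr; exact hg2.trans hφ
    _ = 16 * C * niceDens k θ μ x := by ring

omit h in
theorem lintegral_sub_betaGrad (hφ : Continuous φ) (j : ℕ) (μ : Mac d) (t : ℝ) :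
    ∫⁻ x, ‖(T j).ψ t * ((T j).χ x * (T j).Q' (μ.jdens x) + (T j).g x) -
      betaGrad q φ μ x‖ₑ ^ 2 ∂μ.toM =
    ∫⁻ x, ENNReal.ofReal (μ.jdens x * ((T j).ψ t * ((T j).χ x * (T j).Q' (μ.jdens x) + (T j).g x) -
      betaGrad q φ μ x) ^ 2) := by
  have hm := μ.measurable_jdens_apply
  have hw : Measurable fun x => betaGrad q φ μ x :=
    ((measurable_deriv q).comp hm).add hφ.measurable
  have hQ := (T j).measurable_Q'_comp hm μ.jdens_nonneg
  have hχ := (T j).continuous_χ.measurable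
  have hg := (T j).continuous_g.measurable
  rw [μ.lintegral_toM_jdens (by fun_prop)]
  refine lintegral_congr fun x => ?_
  rw [ENNReal.ofReal_mul (μ.jdens_nonneg x), Real.enorm_eq_ofReal_abs,
    ← ENNReal.ofReal_pow (abs_nonneg _), sq_abs]

theorem lintegral_sub_betaGrad_le (hφ : Continuous φ) (j : ℕ) (μ : Mac d) (t : ℝ) :
    ∫⁻ x, ‖(T j).ψ t * ((T j).χ x * (T j).Q' (μ.jdens x) + (T j).g x) -
      betaGrad q φ μ x‖ₑ ^ 2 ∂μ.toM ≤ ENNReal.ofReal (16 * C) * niceMass k θ μ := by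
  rw [lintegral_sub_betaGrad hφ, niceMass_eq, ← lintegral_const_mul' _ _ ENNReal.ofReal_ne_top]
  refine lintegral_mono fun x => ?_
  rw [← ENNReal.ofReal_mul (mul_nonneg (by norm_num) h.nonneg)]
  exact ENNReal.ofReal_le_ofReal (h.jdens_mul_sq_le j μ x)

theorem tendsto_lintegral_sub_betaGrad (hφ : Continuous φ) {μ : Mac d}
    (hμ : niceMass k θ μ ≠ ∞) (t : ℝ) :
    Tendsto (fun j => ∫⁻ x, ‖(T j).ψ t * ((T j).χ x * (T j).Q' (μ.jdens x) + (T j).g x) -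
      betaGrad q φ μ x‖ₑ ^ 2 ∂μ.toM) atTop (𝓝 0) := by
  simp_rw [lintegral_sub_betaGrad hφ]
  have hm := μ.measurable_jdens_apply
  have hw : Measurable fun x => betaGrad q φ μ x :=
    ((measurable_deriv q).comp hm).add hφ.measurable
  rw [← lintegral_zero (μ := (volume : Measure (Rd d)))]
  refine tendsto_lintegral_of_dominated_convergence
    (fun x => ENNReal.ofReal (16 * C * niceDens k θ μ x)) (fun j => ?_)
    (fun j => Eventually.of_forall fun x => ENNReal.ofReal_le_ofReal (h.jdens_mul_sq_le j μ x))
    ?_ (Eventually.of_forall fun x => ?_)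
  · have hQ := (T j).measurable_Q'_comp hm μ.jdens_nonneg
    have hχ := (T j).continuous_χ.measurable
    have hg := (T j).continuous_g.measurable
    fun_prop
  · have h1 := ((integrable_niceDens hμ).const_mul (16 * C)).lintegral_lt_top
    exact h1.ne
  · rcases (μ.jdens_nonneg x).eq_or_lt with he | hpos
    · simp [← he]
    · have h1 := ((h.tendsto_ψ t).mul ((h.tendsto_Q' x _ hpos).add (h.tendsto_g x))).sub_const
        (betaGrad q φ μ x)
      have h2 := (ENNReal.continuous_ofReal.tendsto _).comp ((h1.pow 2).const_mul (μ.jdens x))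
      have e : μ.jdens x * (1 * (deriv q (μ.jdens x) + φ x) - betaGrad q φ μ x) ^ 2 = 0 := by
        rw [betaGrad]; ring
      rw [e, ENNReal.ofReal_zero] at h2
      exact h2

omit h in
-- Differentiating the mass cutoff produces a term constant in `x`, separated here from the part
-- that converges to the gradient of the functional.
theorem lintegral_limDeriv_sub_le (j : ℕ) (μ : Mac d) :
    ∫⁻ x, ‖(T j).limDeriv μ x - betaGrad q φ μ x‖ₑ ^ 2 ∂μ.toM ≤
      2 * (‖(T j).ψ' μ.toFM.mass‖ₑ ^ 2 * μ.toM univ * ‖(T j).limInner μ‖ₑ ^ 2) +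
      2 * ∫⁻ x, ‖(T j).ψ μ.toFM.mass * ((T j).χ x * (T j).Q' (μ.jdens x) + (T j).g x) -
        betaGrad q φ μ x‖ₑ ^ 2 ∂μ.toM := by
  have e : ‖(T j).ψ' μ.toFM.mass‖ₑ ^ 2 * μ.toM univ * ‖(T j).limInner μ‖ₑ ^ 2 =
      ∫⁻ _, ‖(T j).ψ' μ.toFM.mass * (T j).limInner μ‖ₑ ^ 2 ∂μ.toM := by
    rw [lintegral_const, enorm_mul, mul_pow]
    ring
  rw [e, ← lintegral_const_mul' _ _ (by simp), ← lintegral_const_mul' _ _ (by simp),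
    ← lintegral_add_left (by fun_prop)]
  refine lintegral_mono fun x => ?_
  have e2 : (T j).limDeriv μ x - betaGrad q φ μ x = (T j).ψ' μ.toFM.mass * (T j).limInner μ +
      ((T j).ψ μ.toFM.mass * ((T j).χ x * (T j).Q' (μ.jdens x) + (T j).g x) -
        betaGrad q φ μ x) := by
    rw [TruncatedFunctional.limDeriv]; ring
  rw [e2]
  exact enorm_add_sq_le _ _

theorem enorm_ψ'_sq_mul_le (j : ℕ) (μ : Mac d) :
    ‖(T j).ψ' μ.toFM.mass‖ₑ ^ 2 * μ.toM univ ≤ ENNReal.ofReal C := by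
  have e : μ.toM univ = (μ.toFM.mass : ℝ≥0∞) := FiniteMeasure.ennreal_mass.symm
  rw [e, ← ENNReal.ofReal_coe_nnreal, Real.enorm_eq_ofReal_abs, ← ENNReal.ofReal_pow (abs_nonneg _),
    sq_abs, ← ENNReal.ofReal_mul (sq_nonneg _)]
  exact ENNReal.ofReal_le_ofReal (h.ψ'_sq_le j _ NNReal.zero_le_coe)

/-- The bound is a quadratic polynomial in `niceMass`, uniform in `j`. This is why the second moment
of `niceMass` is the quantity to control. -/
theorem formDist_le (hq0 : ContinuousOn q (Ici 0)) (hφ : Continuous φ) (j : ℕ) {μ : Mac d}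
    (hμ : niceMass k θ μ ≠ ∞) :
    formDist (T j).limFn (betaReal q φ) (T j).limDeriv (betaGrad q φ) μ ≤
      (4 * (2 * ENNReal.ofReal C) ^ 2 + 2 * (ENNReal.ofReal C * (2 * ENNReal.ofReal C) ^ 2)) *
        niceMass k θ μ ^ 2 + 2 * ENNReal.ofReal (16 * C) * niceMass k θ μ := by
  set c := ENNReal.ofReal C with hc
  set N := niceMass k θ μ with hN
  have h1 : ‖(T j).limFn μ‖ₑ ≤ 2 * c * N := by
    rw [TruncatedFunctional.limFn, enorm_mul]
    refine (mul_le_mul' ?_ (h.enorm_limInner_le j μ)).trans (one_mul _).le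
    rw [Real.enorm_eq_ofReal_abs, ← ENNReal.ofReal_one]
    exact ENNReal.ofReal_le_ofReal (h.abs_ψ_le j _)
  have h2 : ‖(T j).limFn μ - betaReal q φ μ‖ₑ ^ 2 ≤ 4 * (2 * c * N) ^ 2 := by
    have h3 := enorm_add_sq_le ((T j).limFn μ) (-betaReal q φ μ)
    rw [enorm_neg, ← sub_eq_add_neg] at h3
    refine h3.trans ?_
    calc _ ≤ 2 * (2 * c * N) ^ 2 + 2 * (2 * c * N) ^ 2 := by
          gcongr
          exact h.enorm_betaReal_le hq0 hφ hμ
      _ = _ := by ring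
  have h4 := lintegral_limDeriv_sub_le (T := T) (q := q) (φ := φ) j μ
  have h5 : ‖(T j).ψ' μ.toFM.mass‖ₑ ^ 2 * μ.toM univ * ‖(T j).limInner μ‖ₑ ^ 2 ≤
      c * (2 * c * N) ^ 2 :=
    mul_le_mul' (h.enorm_ψ'_sq_mul_le j μ) (pow_le_pow_left' (h.enorm_limInner_le j μ) 2)
  have h6 := h.lintegral_sub_betaGrad_le hφ j μ μ.toFM.mass
  unfold formDist
  calc _ ≤ 4 * (2 * c * N) ^ 2 + (2 * (c * (2 * c * N) ^ 2) + 2 * (ENNReal.ofReal (16 * C) * N)) :=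
        add_le_add h2 (h4.trans (add_le_add (mul_le_mul' le_rfl h5) (mul_le_mul' le_rfl h6)))
    _ = _ := by ring

theorem tendsto_formDist (hq0 : ContinuousOn q (Ici 0)) (hφ : Continuous φ) {μ : Mac d}
    (hμ : niceMass k θ μ ≠ ∞) :
    Tendsto (fun j => formDist (T j).limFn (betaReal q φ) (T j).limDeriv (betaGrad q φ) μ) atTop
      (𝓝 0) := by
  have h1 := h.tendsto_limInner hq0 hφ hμ
  have h2 := ((((h.tendsto_ψ μ.toFM.mass).mul h1).sub_const (betaReal q φ μ)).enorm)
  rw [one_mul, sub_self, enorm_zero] at h2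
  have h3 := ((ENNReal.continuous_pow 2).tendsto 0).comp h2
  have h4 := ((ENNReal.continuous_pow 2).tendsto _).comp (h.tendsto_ψ' μ.toFM.mass).enorm
  have h5 := ((ENNReal.continuous_pow 2).tendsto _).comp h1.enorm
  rw [enorm_zero, zero_pow two_ne_zero] at h4
  rw [zero_pow two_ne_zero] at h3
  have h6 := ENNReal.Tendsto.mul (ENNReal.Tendsto.mul_const (b := μ.toM univ) h4
    (Or.inr (measure_ne_top _ _))) (Or.inr (by finiteness)) h5 (Or.inr (by simp))
  have h7 := (ENNReal.Tendsto.const_mul (a := 2) h6 (Or.inr (by simp))).add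
    (ENNReal.Tendsto.const_mul (a := 2) (h.tendsto_lintegral_sub_betaGrad hφ hμ μ.toFM.mass)
      (Or.inr (by simp)))
  have h8 := h3.add (tendsto_of_tendsto_of_tendsto_of_le_of_le tendsto_const_nhds
    (by simpa using h7) (fun _ => zero_le) fun j => lintegral_limDeriv_sub_le j μ)
  rw [add_zero] at h8
  exact h8

/-- The truncated functionals converge to `β_{q,φ}` in the graph norm. -/
theorem tendsto_lintegral_formDist {Λ : Measure (Mac d)} [IsFiniteMeasure Λ]
    (hq0 : ContinuousOn q (Ici 0)) (hφ : Continuous φ)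
    (hΛ : ∫⁻ μ, niceMass k θ μ ^ 2 ∂Λ ≠ ∞) (hN : ∀ᵐ μ ∂Λ, niceMass k θ μ ≠ ∞) :
    Tendsto (fun j => ∫⁻ μ, formDist (T j).limFn (betaReal q φ) (T j).limDeriv (betaGrad q φ) μ ∂Λ)
      atTop (𝓝 0) := by
  rw [← lintegral_zero (μ := Λ)]
  set a := 4 * (2 * ENNReal.ofReal C) ^ 2 + 2 * (ENNReal.ofReal C * (2 * ENNReal.ofReal C) ^ 2)
    with ha
  set b := 2 * ENNReal.ofReal (16 * C) with hb
  have ha' : a ≠ ∞ := by finiteness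
  have hb' : b ≠ ∞ := by finiteness
  refine tendsto_lintegral_of_dominated_convergence
    -- The linear term is absorbed by `N ≤ N² + 1`; the `1` is integrable as `Λ` is finite.
    (fun μ => a * niceMass k θ μ ^ 2 + b * (niceMass k θ μ ^ 2 + 1))
    (fun j => measurable_formDist (T j).measurable_limFn (measurable_betaReal hq0 hφ)
      (T j).measurable_limDeriv (measurable_betaGrad q hφ)) (fun j => ?_) ?_ ?_
  · filter_upwards [hN] with μ hμ
    refine (h.formDist_le hq0 hφ j hμ).trans (add_le_add le_rfl (mul_le_mul' le_rfl ?_))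
    rcases le_total (niceMass k θ μ) 1 with h1 | h1
    · exact h1.trans le_add_self
    · exact (le_self_pow₀ h1 two_ne_zero).trans le_self_add
  · have hm := measurable_niceMass (d := d) k θ
    rw [lintegral_add_left (by fun_prop), lintegral_const_mul' _ _ ha', lintegral_const_mul' _ _ hb',
      lintegral_add_left (by fun_prop), lintegral_const]
    have := measure_ne_top Λ univ
    finiteness
  · filter_upwards [hN] with μ hμ
    exact h.tendsto_formDist hq0 hφ hμ

/-- The functional `β_{q,φ}` belongs to the closure. -/
theorem memFormDomain {Λ : Measure (Mac d)} [IsFiniteMeasure Λ]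
    (hq0 : ContinuousOn q (Ici 0)) (hφ : Continuous φ)
    (hΛ : ∫⁻ μ, niceMass k θ μ ^ 2 ∂Λ ≠ ∞) (hN : ∀ᵐ μ ∂Λ, niceMass k θ μ ≠ ∞) {β : Mac d → ℝ}
    (hβ : β =ᵐ[Λ] betaReal q φ) :
    MemFormDomain Λ β ∧ HasWeakExtrinsicDeriv Λ β (betaGrad q φ) := by
  have hρ := isMollifier_stdMollifier d
  have hlim := h.tendsto_lintegral_formDist hq0 hφ hΛ hN
  -- Diagonal choice: for each cutoff level `j` the mollifier is taken fine enough for an error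
  -- below `1 / (j + 1)`.
  have hn : ∀ j : ℕ, ∃ n : ℕ, ∫⁻ μ, formDist (fun ν => (T j).fn (stdMollifier d n) ν.toFM) (T j).limFn
      (fun ν => (T j).fnDeriv (stdMollifier d n) ν.toFM) (T j).limDeriv μ ∂Λ <
      ENNReal.ofReal (1 / ((j : ℝ) + 1)) := fun j =>
    (((T j).tendsto_lintegral_formDist Λ).eventually_lt_const
      (ENNReal.ofReal_pos.2 (by positivity))).exists
  choose n hn using hn
  refine memFormDomain_and_hasWeakExtrinsicDeriv
    ((measurable_betaReal hq0 hφ).aestronglyMeasurable.congr hβ.symm) (measurable_betaGrad q hφ)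
    (u := fun j => (T j).fn (stdMollifier d (n j)))
    (Du := fun j => (T j).fnDeriv (stdMollifier d (n j))) (fun j => (T j).isCbE12 (hρ _)) ?_
  have h0 := (ENNReal.continuous_ofReal.tendsto 0).comp
    (tendsto_one_div_add_atTop_nhds_zero_nat (𝕜 := ℝ))
  rw [ENNReal.ofReal_zero] at h0
  have h1 := (ENNReal.Tendsto.const_mul (a := 2) h0 (Or.inr (by simp))).add
    (ENNReal.Tendsto.const_mul (a := 2) hlim (Or.inr (by simp)))
  rw [mul_zero, add_zero] at h1
  refine tendsto_of_tendsto_of_tendsto_of_le_of_le tendsto_const_nhds h1 (fun _ => zero_le)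
    fun j => ?_
  have hm : Measurable (formDist (fun ν => (T j).fn (stdMollifier d (n j)) ν.toFM) (T j).limFn
      (fun ν => (T j).fnDeriv (stdMollifier d (n j)) ν.toFM) (T j).limDeriv) :=
    measurable_formDist ((T j).isCbE12 (hρ _)).measurable_comp (T j).measurable_limFn
      ((T j).isCbE12 (hρ _)).measurable_deriv_comp (T j).measurable_limDeriv
  calc _ = ∫⁻ μ, formDist (fun ν => (T j).fn (stdMollifier d (n j)) ν.toFM) (betaReal q φ)
        (fun ν => (T j).fnDeriv (stdMollifier d (n j)) ν.toFM) (betaGrad q φ) μ ∂Λ := by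
        refine lintegral_congr_ae ?_
        filter_upwards [hβ] with μ hμ
        rw [formDist, formDist, hμ]
    _ ≤ ∫⁻ μ, (2 * formDist (fun ν => (T j).fn (stdMollifier d (n j)) ν.toFM) (T j).limFn
          (fun ν => (T j).fnDeriv (stdMollifier d (n j)) ν.toFM) (T j).limDeriv μ +
        2 * formDist (T j).limFn (betaReal q φ) (T j).limDeriv (betaGrad q φ) μ) ∂Λ :=
        lintegral_mono fun μ => formDist_triangle ((T j).isCbE12 (hρ _)).measurable_deriv_comp
          (T j).measurable_limDeriv μ
    _ = 2 * ∫⁻ μ, formDist (fun ν => (T j).fn (stdMollifier d (n j)) ν.toFM) (T j).limFn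
          (fun ν => (T j).fnDeriv (stdMollifier d (n j)) ν.toFM) (T j).limDeriv μ ∂Λ +
        2 * ∫⁻ μ, formDist (T j).limFn (betaReal q φ) (T j).limDeriv (betaGrad q φ) μ ∂Λ := by
        rw [lintegral_add_left (hm.const_mul 2), lintegral_const_mul' _ _ (by simp),
          lintegral_const_mul' _ _ (by simp)]
    _ ≤ _ := add_le_add (mul_le_mul' le_rfl (hn j).le) le_rfl

end IsApproximation

theorem exists_isApproximation {k θ K A : ℝ} (hθ : 1 < θ) (hA : 0 ≤ A)
    {q : ℝ → ℝ} (hq0 : ContinuousOn q (Ici 0)) (hq1 : ContDiffOn ℝ 1 q (Ioi 0))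
    {φ : Rd d → ℝ} (hφ : Continuous φ) (hφA : ∀ x, |φ x| ≤ A * (1 + ‖x‖ ^ (2 * k)))
    (hφK : ∀ x, |φ x| ≤ K * (1 + ‖x‖ ^ k))
    (hq : ∃ c : ℝ, 0 < c ∧ ∀ s : ℝ, 0 ≤ s →
      -c * s ^ (1 / 2 : ℝ) ≤ q s ∧ q s ≤ c * (s ^ (1 / 2 : ℝ) + s ^ θ))
    (hq' : ∃ C : ℝ, ∀ s : ℝ, 0 < s → |deriv q s| ≤ C * (s ^ (-(1 / 2) : ℝ) + s ^ (θ - 1)))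
    (hq2 : ∃ C : ℝ, ∀ s : ℝ, 0 < s →
      |deriv q (s ^ 2)| ≤ C * (s ^ (-(1 / 2) : ℝ) + s ^ (θ - 1))) :
    ∃ (C : ℝ) (T : ℕ → TruncatedFunctional d), IsApproximation k θ C q φ T := by
  obtain ⟨c, hc, hq⟩ := hq
  obtain ⟨L, hL0, hL⟩ := exists_abs_sub_le_rpow hθ hq0 hq1 hq'
  obtain ⟨D0, hD0⟩ := hq2
  obtain ⟨S, hS⟩ := exists_abs_deriv_smoothStep_le
  have hD : ∀ s : ℝ, 0 < s →
      deriv q s ^ 2 ≤ 2 * D0 ^ 2 * (s ^ (-(1 / 2) : ℝ) + s ^ (θ - 1)) :=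
    fun s hs => deriv_sq_le hD0 hs
  set D := 2 * D0 ^ 2 with hDdef
  have hDnn : 0 ≤ D := by positivity
  have hθ0 : 0 < θ := by linarith
  -- Both growth bounds vanish at `0`. This is what makes the regularization, which subtracts `q δ`,
  -- converge to `q`.
  have hq00 : q 0 = 0 := by
    have h := hq 0 le_rfl
    rw [Real.zero_rpow (by norm_num), Real.zero_rpow hθ0.ne'] at h
    linarith [h.1, h.2]
  choose T hχ hg hQ hQ' hψ hψ' using exists_truncatedFunctional hq1 hφ
  have e1 : 0 ≤ L * (1 + θ * 2 ^ θ) := by positivity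
  have e2 : 0 ≤ D * (1 + 2 ^ θ) := by positivity
  have e3 : 0 ≤ 2 * K ^ 2 := by positivity
  have e4 : 0 ≤ 2 * S ^ 2 := by positivity
  have hp : ∀ s : ℝ, 0 ≤ s → 0 ≤ s ^ (1 / 2 : ℝ) + s ^ θ := fun s hs => by positivity
  have hw : ∀ x : Rd d, 0 ≤ 1 + ‖x‖ ^ (2 * k) := fun x => by positivity
  have hδ : ∀ j : ℕ, (0 : ℝ) < 1 / ((j : ℝ) + 1) := fun j => by positivity
  have hδ1 : ∀ j : ℕ, 1 / ((j : ℝ) + 1) ≤ 1 := fun j => by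
    rw [div_le_one (by positivity)]; linarith [j.cast_nonneg (α := ℝ)]
  -- Each summand serves one of the required bounds, and all of them are nonnegative.
  refine ⟨c + D + A + 2 * K ^ 2 + L * (1 + θ * 2 ^ θ) + D * (1 + 2 ^ θ) + 2 * S ^ 2, T, ?_⟩
  constructor
  · positivity
  · intro s hs
    exact (abs_growth hc hq hs).trans (mul_le_mul_of_nonneg_right (by linarith) (hp s hs))
  · intro s hs
    exact (deriv_sq_mul_le hD hs).trans (mul_le_mul_of_nonneg_right (by linarith) (hp s hs.le))
  · intro x
    exact (hφA x).trans (mul_le_mul_of_nonneg_right (by linarith) (hw x))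
  · intro x
    have h1 : φ x ^ 2 ≤ 2 * K ^ 2 * (1 + ‖x‖ ^ (2 * k)) := by
      have e : ‖x‖ ^ (2 * k) = (‖x‖ ^ k) ^ 2 := by
        rw [← Real.rpow_natCast, ← Real.rpow_mul (norm_nonneg x), mul_comm]
        norm_num
      rw [e, ← sq_abs]
      calc |φ x| ^ 2 ≤ (K * (1 + ‖x‖ ^ k)) ^ 2 := pow_le_pow_left₀ (abs_nonneg _) (hφK x) 2
        _ = K ^ 2 * (1 + ‖x‖ ^ k) ^ 2 := by ring
        _ ≤ K ^ 2 * (2 * (1 + (‖x‖ ^ k) ^ 2)) := by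
          gcongr
          nlinarith [sq_nonneg (1 - ‖x‖ ^ k)]
        _ = _ := by ring
    exact h1.trans (mul_le_mul_of_nonneg_right (by linarith) (hw x))
  · intro j x s hs
    rw [hχ, hQ, abs_mul]
    calc _ ≤ 1 * |regFun q (1 / ((j : ℝ) + 1)) s| :=
          mul_le_mul_of_nonneg_right (abs_cutoff_le j x) (abs_nonneg _)
      _ = |regFun q (1 / ((j : ℝ) + 1)) s| := one_mul _
      _ ≤ _ := abs_regFun_le hθ hL0 hL (hδ j) (hδ1 j) hs
      _ ≤ _ := mul_le_mul_of_nonneg_right (by linarith) (hp s hs)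
  · intro j x s hs
    rw [hχ, hQ', mul_pow]
    have h1 : cutoff d j x ^ 2 ≤ 1 := by
      rw [← sq_abs]; exact pow_le_one₀ (abs_nonneg _) (abs_cutoff_le j x)
    calc _ ≤ 1 * regDeriv q (1 / ((j : ℝ) + 1)) s ^ 2 * s := by gcongr
      _ = regDeriv q (1 / ((j : ℝ) + 1)) s ^ 2 * s := by rw [one_mul]
      _ ≤ _ := regDeriv_sq_mul_le hθ hDnn hD (hδ j) (hδ1 j) hs
      _ ≤ _ := mul_le_mul_of_nonneg_right (by linarith) (hp s hs.le)
  · intro j x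
    rw [hg, abs_mul]
    exact mul_le_of_le_one_right (abs_nonneg _) (abs_cutoff_le j x)
  · intro j t
    simp only [hψ, smoothStep]
    rw [abs_of_nonneg (Real.smoothTransition.nonneg _)]
    exact Real.smoothTransition.le_one _
  · intro j t ht
    rw [hψ']
    have hj : (1 : ℝ) ≤ (j : ℝ) + 1 := by linarith [j.cast_nonneg (α := ℝ)]
    have hj0 : (0 : ℝ) < (j : ℝ) + 1 := by linarith
    suffices h : (deriv smoothStep (t / ((j : ℝ) + 1)) / ((j : ℝ) + 1)) ^ 2 * t ≤ 2 * S ^ 2 by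
      linarith
    -- The derivative of the cutoff vanishes beyond `2(j + 1)`. Below that, one of its two factors
    -- `1 / (j + 1)` absorbs `t` and leaves at most `2`.
    rcases lt_or_ge 2 (t / ((j : ℝ) + 1)) with h | h
    · rw [deriv_smoothStep_eq_zero h]
      simpa using e4
    · set p := (j : ℝ) + 1
      have h1 : deriv smoothStep (t / p) ^ 2 ≤ S ^ 2 := by
        rw [← sq_abs]; exact pow_le_pow_left₀ (abs_nonneg _) (hS _) 2
      have h2 : 0 ≤ t / p := by positivity
      calc (deriv smoothStep (t / p) / p) ^ 2 * t
          = deriv smoothStep (t / p) ^ 2 * (t / p) / p := by field_simp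
        _ ≤ deriv smoothStep (t / p) ^ 2 * (t / p) := div_le_self (by positivity) hj
        _ ≤ S ^ 2 * 2 := by gcongr
        _ = 2 * S ^ 2 := mul_comm _ _
  · intro x s hs
    have h1 := (tendsto_cutoff x).mul (tendsto_regFun hq0 hq00 hs)
    rw [one_mul] at h1
    refine h1.congr fun j => ?_
    rw [hχ, hQ]
  · intro x s hs
    have h1 := (tendsto_cutoff x).mul (tendsto_regDeriv hq1 hs)
    rw [one_mul] at h1
    refine h1.congr fun j => ?_
    rw [hχ, hQ']
  · intro x
    have h1 := (tendsto_cutoff x).const_mul (φ x)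
    rw [mul_one] at h1
    refine h1.congr fun j => ?_
    rw [hg]
  · intro t
    obtain ⟨n, hn⟩ := exists_nat_ge t
    refine tendsto_const_nhds.congr' ?_
    filter_upwards [eventually_ge_atTop n] with j hj
    have hj' : (n : ℝ) ≤ j := by exact_mod_cast hj
    simp only [hψ, smoothStep]
    rw [Real.smoothTransition.one_of_one_le]
    have : t / ((j : ℝ) + 1) ≤ 1 := by
      rw [div_le_one (by positivity)]; linarith
    linarith
  · intro t
    have h1 := (tendsto_one_div_add_atTop_nhds_zero_nat (𝕜 := ℝ)).const_mul S
    rw [mul_zero] at h1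
    refine squeeze_zero_norm (fun j => ?_) h1
    rw [hψ', Real.norm_eq_abs, abs_div, abs_of_pos (by positivity : (0 : ℝ) < (j : ℝ) + 1),
      mul_one_div]
    gcongr
    exact hS _

instance isFiniteMeasure_refMeasure (k α d' : ℝ) : IsFiniteMeasure (refMeasure d k α d') := by
  unfold refMeasure
  infer_instance

end ExtrinsicFlow

theorem proposition4p8 (d : ℕ) (hd : 1 ≤ d) (K k α₁ θ : ℝ) (hK : 0 < K) (hk : 0 < k)
    (hα₁ : 0 < α₁) (hθ : 1 < θ) (hθd : 2 < d → θ ≤ (d : ℝ) / ((d : ℝ) - 2))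
    (q : ℝ → ℝ) (hq0 : ContinuousOn q (Ici 0)) (hq1 : ContDiffOn ℝ 1 q (Ioi 0))
    (φ : Rd d → ℝ) (hφ : Continuous φ)
    (hφb : ∀ x, |φ x| ≤ min (α₁ * (1 + ‖x‖ ^ (2 * k))) (K * (1 + ‖x‖ ^ k)))
    -- the growth conditions on `q` and `q'`
    (hq : ∃ c : ℝ, 0 < c ∧ ∀ s : ℝ, 0 ≤ s →
      -c * s ^ (1 / 2 : ℝ) ≤ q s ∧ q s ≤ c * (s ^ (1 / 2 : ℝ) + s ^ θ))
    (hq' : ∃ C : ℝ, ∀ s : ℝ, 0 < s → |deriv q s| ≤ C * (s ^ (-(1 / 2) : ℝ) + s ^ (θ - 1))) :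
    -- (1)
    (∃ α₂ : ℝ, 0 < α₂ ∧ Beta1 k θ (betaFun q φ) ∧ Beta2 k α₁ α₂ (betaFun q φ) ∧
      Beta3 k θ (betaFun q φ)) ∧
    -- (2)
    ((∃ C : ℝ, ∀ s : ℝ, 0 < s →
        |deriv q (s ^ 2)| ≤ C * (s ^ (-(1 / 2) : ℝ) + s ^ (θ - 1))) →
      ∀ α d' : ℝ, 0 < α → (d : ℝ) < d' → 2 * α₁ < ((d : ℝ) + α) ^ d' → (d : ℝ) / 2 < k →
        (∀ᵐ μ ∂(refMeasure d k α d'), betaFun q φ μ ≠ ⊤) ∧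
        MemFormDomain (refMeasure d k α d') (fun μ => (betaFun q φ μ).toReal) ∧
        ∃ w : Mac d → Rd d → ℝ,
          HasWeakExtrinsicDeriv (refMeasure d k α d') (fun μ => (betaFun q φ μ).toReal) w ∧
          ∀ᵐ μ ∂(refMeasure d k α d'),
            w μ =ᵐ[μ.toM] fun x => deriv q (μ.dens x) + φ x) := by
  have hφA : ∀ x, |φ x| ≤ α₁ * (1 + ‖x‖ ^ (2 * k)) := fun x => (hφb x).trans (min_le_left _ _)
  have hφK : ∀ x, |φ x| ≤ K * (1 + ‖x‖ ^ k) := fun x => (hφb x).trans (min_le_right _ _)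
  obtain ⟨c, hc, hqc⟩ := hq
  constructor
  · obtain ⟨L, hL0, hL⟩ := exists_abs_sub_le_rpow hθ hq0 hq1 hq'
    exact ⟨c, hc, beta1_betaFun hc hq0 hqc hφ hφA, beta2_betaFun hc hα₁ hqc hφA,
      beta3_betaFun hc hα₁ hL0 hq0 hqc hL hφ hφA⟩
  · intro hq2 α d' hα hd' _ hkd
    obtain ⟨C, T, hT⟩ := exists_isApproximation hθ hα₁.le hq0 hq1 hφ hφA hφK ⟨c, hc, hqc⟩ hq' hq2
    have hΛ := lintegral_niceMass_sq_lt_top hd hα hkd hd' hθ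
    -- A finite second moment gives `niceMass` finite almost everywhere, hence an integrable
    -- integrand and a finite functional there.
    have hN : ∀ᵐ μ ∂(refMeasure d k α d'), niceMass k θ μ ≠ ∞ := by
      filter_upwards [ae_lt_top ((measurable_niceMass k θ).pow_const 2) hΛ.ne] with μ hμ
      rintro h
      simp [h] at hμ
    have hI : ∀ᵐ μ ∂(refMeasure d k α d'),
        Integrable (fun x => q (μ.dens x) + φ x * μ.dens x) volume := by
      filter_upwards [hN] with μ hμ
      exact integrable_betaIntegrand hc hq0 hqc hφ hφA (niceDensity_of_niceMass hμ)
    have hβ : (fun μ => (betaFun q φ μ).toReal) =ᵐ[refMeasure d k α d'] betaReal q φ := by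
      filter_upwards [hI] with μ hμ
      exact toReal_betaFun hμ
    obtain ⟨h1, h2⟩ := hT.memFormDomain hq0 hφ hΛ.ne hN hβ
    refine ⟨?_, h1, betaGrad q φ, h2, Eventually.of_forall fun μ => ?_⟩
    · filter_upwards [hI] with μ hμ
      rw [betaFun, if_pos hμ]
      exact EReal.coe_ne_top _
    -- The two versions of the density agree `λ`-almost everywhere, hence `μ`-almost everywhere.
    · filter_upwards [μ.jdens_ae_eq_toM] with x hx
      rw [betaGrad, hx]
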